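/- Let $k$ be a field (for instance $\mathbb C$) and let $R,R'\in M_n(k)\otimes M_n(k)$ be invertible matrices, with $P$ the permutation matrix, such that $R_{12}R_{13}R_{23}=R_{23}R_{13}R_{12}$ and (i) $R_{12}R_{13}R'_{23}=R'_{23}R_{13}R_{12}$ and $R_{23}R_{13}R'_{12}=R'_{12}R_{13}R_{23}$, (ii) $(PR+1)(PR'-1)=0$, (iii) $R_{21}R'_{12}=R'_{21}R_{12}$. Let $V(R')$ be the algebra with generators $x^1,\dots,x^n$ and relations $x^ix^j=\sum_{a,b}R'^{\,i}{}_a{}^j{}_b\,x^bx^a$ (compactly $\mathbf x_1\mathbf x_2=R'_{12}\mathbf x_2\mathbf x_1$). Let $A$ be a Hopf algebra over $k$ with antipode $S$ and with elements $t^i{}_j$ satisfying $\Delta t^i{}_j=\sum_a t^i{}_a\otimes t^a{}_j$ and $\epsilon(t^i{}_j)=\delta^i_j$ (in particular $A$ may be a Hopf algebra quotient of the bialgebra $A(R)$). Let $\mathcal R:A\otimes A\to k$ be a dual quasitriangular structure, that is, a convolution-invertible map with $\mathcal R(ab\otimes c)=\sum\mathcal R(a\otimes c_{(1)})\mathcal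 R(b\otimes c_{(2)})$, $\mathcal R(a\otimes bc)=\sum\mathcal R(a_{(1)}\otimes c)\mathcal R(a_{(2)}\otimes b)$ and $\sum\mathcal R(a_{(1)}\otimes b_{(1)})a_{(2)}b_{(2)}=\sum b_{(1)}a_{(1)}\mathcal R(a_{(2)}\otimes b_{(2)})$. Suppose that $\mathcal R(\mathbf t_1\otimes\mathbf t_2)=\lambda R_{12}$ with $0\ne\lambda\in k$, and that $R'_{12}\mathbf t_1\mathbf t_2=\mathbf t_2\mathbf t_1R'_{12}$ in $A$. Let $\tilde A=A\otimes k\mathbb Z$, where $k\mathbb Z=k[g,g^{-1}]$ with $g$ group-like, and extend $\mathcal R$ to $\tilde A$ as the tensor product of $\mathcal R$ with the form $\mathcal R(g^a\otimes g^b)=\lambda^{-ab}$. Then the extended $\mathcal R$ is a dual quasitriangular structure on $\tilde A$. The algebra $V(R')$ is a Hopf algebra in the braided category of right $\tilde A$-comodules (with braiding $\Psi(v\otimes w)=\sum w^{(1)}\otimes v^{(1)}\,\mathcal R(v^{(2)}\otimes w^{(2)})$), with coaction $\beta(x^i)=\sum_j x^j\otimes g^{-1}St^i{}_j$, braided coproduct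 $\underline\Delta x^i=x^i\otimes1+1\otimes x^i$, counit $\underline\epsilon(x^i)=0$, braided antipode $\underline Sx^i=-x^i$ and $\Psi(\mathbf x_1\otimes\mathbf x_2)=R_{12}\,\mathbf x_2\otimes\mathbf x_1$. Its bosonization exists. This is a Hopf algebra $V(R'){>\!\!\!\triangleleft}\tilde A$ that contains $V(R')$ as a subalgebra and $\tilde A$ as a sub-Hopf algebra, such that both multiplication maps $V(R')\otimes\tilde A\to V(R'){>\!\!\!\triangleleft}\tilde A$ and $\tilde A\otimes V(R')\to V(R'){>\!\!\!\triangleleft}\tilde A$ are bijective, and such that for all $v\in V(R')$ and $a\in\tilde A$ $$va=\sum a_{(1)}(v\triangleleft a_{(2)}),\quad v\triangleleft a=\sum v^{(1)}\mathcal R(v^{(2)}\otimes a),\quad \Delta v=\sum v_{\underline{(1)}}{}^{(1)}\otimes v_{\underline{(1)}}{}^{(2)}\,v_{\underline{(2)}},\quad \epsilon(v)=\underline\epsilon(v),$$ where $\beta(v)=\sum v^{(1)}\otimes v^{(2)}$ and $\underline\Delta v=\sum v_{\underline{(1)}}\otimes v_{\underline{(2)}}$. Explicitly, in this Hopf algebra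 $$x^ig=\lambda\,g\,x^i,\qquad x^i\,t^j{}_l=\lambda^{-1}\sum_{m,a}(R^{-1})^i{}_a{}^m{}_l\;t^j{}_m\,x^a\quad(\text{compactly }\mathbf x_1\mathbf t_2=\lambda^{-1}\mathbf t_2R_{12}^{-1}\mathbf x_1),$$ $$\Delta x^i=\sum_j x^j\otimes g^{-1}St^i{}_j+1\otimes x^i,\qquad \Delta t^i{}_j=\sum_a t^i{}_a\otimes t^a{}_j,\qquad \Delta g=g\otimes g.$$ -/

import Mathlib

open scoped TensorProduct LaurentPolynomial

universe u v w

noncomputable section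

namespace BraidedVectors

/-! ## R-matrices

A matrix in `M_n ⊗ M_n` is a matrix indexed by pairs, `R (i, j) (k, l)` being `R^i_k^j_l`. -/

section RMatrix

variable {k : Type u} [Field k] {n : ℕ}

/-- Square matrices acting on the tensor square of `k^n`. -/
abbrev Mat2 (k : Type u) (n : ℕ) := Matrix (Fin n × Fin n) (Fin n × Fin n) k

/-- Square matrices acting on the tensor cube of `k^n`. -/
abbrev Mat3 (k : Type u) (n : ℕ) :=
  Matrix (Fin n × Fin n × Fin n) (Fin n × Fin n × Fin n) k

/-- `R₁₂`, acting in the first and second tensor factors. -/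
def leg12 (R : Mat2 k n) : Mat3 k n :=
  fun p q => if p.2.2 = q.2.2 then R (p.1, p.2.1) (q.1, q.2.1) else 0

/-- `R₁₃`, acting in the first and third tensor factors. -/
def leg13 (R : Mat2 k n) : Mat3 k n :=
  fun p q => if p.2.1 = q.2.1 then R (p.1, p.2.2) (q.1, q.2.2) else 0

/-- `R₂₃`, acting in the second and third tensor factors. -/
def leg23 (R : Mat2 k n) : Mat3 k n :=
  fun p q => if p.1 = q.1 then R (p.2.1, p.2.2) (q.2.1, q.2.2) else 0

/-- The permutation matrix `P`. -/
def flipMat (k : Type u) [Field k] (n : ℕ) : Mat2 k n :=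
  fun p q => if p.1 = q.2 ∧ p.2 = q.1 then 1 else 0

/-- `R₂₁`. -/
def leg21 (R : Mat2 k n) : Mat2 k n := fun p q => R p.swap q.swap

/-- The conditions on a pair of matrices `R, R'` under which the braided vectors are defined. -/
structure IsBraidedVectorDatum (R R' : Mat2 k n) : Prop where
  isUnit_R : IsUnit R
  isUnit_R' : IsUnit R'
  qybe : leg12 R * leg13 R * leg23 R = leg23 R * leg13 R * leg12 R
  compat_left : leg12 R * leg13 R * leg23 R' = leg23 R' * leg13 R * leg12 R
  compat_right : leg23 R * leg13 R * leg12 R' = leg12 R' * leg13 R * leg23 R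
  hecke : (flipMat k n * R + 1) * (flipMat k n * R' - 1) = 0
  exchange : leg21 R * R' = leg21 R' * R

/-- The defining relations `x^i x^j = ∑ R'^i_a^j_b x^b x^a` of the algebra of braided vectors,
in compact notation `x₁ x₂ = R' x₂ x₁`. -/
inductive VectorRel (R' : Mat2 k n) : FreeAlgebra k (Fin n) → FreeAlgebra k (Fin n) → Prop
  | rel (i j : Fin n) : VectorRel R' (FreeAlgebra.ι k i * FreeAlgebra.ι k j)
      (∑ a, ∑ b, R' (i, j) (a, b) • (FreeAlgebra.ι k b * FreeAlgebra.ι k a))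

/-- The algebra `V(R')` of braided vectors. -/
abbrev VectorAlg (R' : Mat2 k n) : Type u := RingQuot (VectorRel R')

/-- The generator `x^i` of `V(R')`. -/
def vecGen (R' : Mat2 k n) (i : Fin n) : VectorAlg R' :=
  RingQuot.mkAlgHom k (VectorRel R') (FreeAlgebra.ι k i)

end RMatrix

/-! ## Dual quasitriangular structures -/

section DualQuasitriangular

variable {k : Type u} [Field k] {H : Type v} [Ring H] [HopfAlgebra k H]

/-- Convolution product of linear functionals on a coalgebra. -/
def convMul {C : Type w} [AddCommGroup C] [Module k C] [Coalgebra k C] (f g : C →ₗ[k] k) :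
    C →ₗ[k] k :=
  LinearMap.mul' k k ∘ₗ TensorProduct.map f g ∘ₗ Coalgebra.comul

/-- A bilinear form `r` on a Hopf algebra is a dual quasitriangular structure: it is convolution
invertible, a skew bicharacter, and `∑ r(a₁, b₁) a₂ b₂ = ∑ b₁ a₁ r(a₂, b₂)`. -/
structure IsDualQuasitriangular (r : H →ₗ[k] H →ₗ[k] k) : Prop where
  exists_inv : ∃ s : H ⊗[k] H →ₗ[k] k,
    convMul (TensorProduct.lift r) s = Coalgebra.counit ∧
      convMul s (TensorProduct.lift r) = Coalgebra.counit
  /-- `r(ab, c) = ∑ r(a, c₁) r(b, c₂)` -/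
  mul_left : ∀ a b c : H, r (a * b) c =
    LinearMap.mul' k k (TensorProduct.map (r a) (r b) (Coalgebra.comul c))
  /-- `r(a, bc) = ∑ r(a₁, c) r(a₂, b)` -/
  mul_right : ∀ a b c : H, r a (b * c) =
    LinearMap.mul' k k (TensorProduct.map (r.flip c) (r.flip b) (Coalgebra.comul a))
  quasi_comm : ∀ a b : H,
    TensorProduct.lid k H (TensorProduct.map (TensorProduct.lift r) (LinearMap.mul' k H)
        (Coalgebra.comul (a ⊗ₜ[k] b))) =
      TensorProduct.rid k H (TensorProduct.map
        (LinearMap.mul' k H ∘ₗ (TensorProduct.comm k H H).toLinearMap) (TensorProduct.lift r)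
        (Coalgebra.comul (a ⊗ₜ[k] b)))

end DualQuasitriangular

/-! ## Braided Hopf algebras among right comodules -/

section Braided

variable {k : Type u} [Field k] {H : Type v} [Ring H] [HopfAlgebra k H]
  {V : Type w} [Ring V] [Algebra k V]

/-- The braiding `Ψ(v ⊗ w) = ∑ w⁽¹⁾ ⊗ v⁽¹⁾ r(v⁽²⁾, w⁽²⁾)` induced by a right coaction `β` of `H`
and a bilinear form `r` on `H`. -/
def braiding (r : H →ₗ[k] H →ₗ[k] k) (β : V →ₗ[k] V ⊗[k] H) : V ⊗[k] V →ₗ[k] V ⊗[k] V :=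
  (TensorProduct.rid k (V ⊗[k] V)).toLinearMap ∘ₗ
    TensorProduct.map (TensorProduct.comm k V V).toLinearMap (TensorProduct.lift r) ∘ₗ
    (TensorProduct.tensorTensorTensorComm k V H V H).toLinearMap ∘ₗ TensorProduct.map β β

/-- The product `(a ⊗ b)(c ⊗ d) = a Ψ(b ⊗ c) d` on `V ⊗ V`. -/
def braidedMul (Ψ : V ⊗[k] V →ₗ[k] V ⊗[k] V) :
    (V ⊗[k] V) ⊗[k] (V ⊗[k] V) →ₗ[k] V ⊗[k] V :=
  TensorProduct.map (LinearMap.mul' k V) (LinearMap.mul' k V) ∘ₗ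
    (TensorProduct.assoc k V V (V ⊗[k] V)).symm.toLinearMap ∘ₗ
    LinearMap.lTensor V ((TensorProduct.assoc k V V V).toLinearMap ∘ₗ
      LinearMap.rTensor V Ψ ∘ₗ (TensorProduct.assoc k V V V).symm.toLinearMap) ∘ₗ
    (TensorProduct.assoc k V V (V ⊗[k] V)).toLinearMap

/-- The codiagonal coaction `v ⊗ w ↦ ∑ v⁽¹⁾ ⊗ w⁽¹⁾ ⊗ v⁽²⁾ w⁽²⁾` on `V ⊗ V`. -/
def coactTensor (β : V →ₗ[k] V ⊗[k] H) : V ⊗[k] V →ₗ[k] (V ⊗[k] V) ⊗[k] H :=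
  LinearMap.lTensor (V ⊗[k] V) (LinearMap.mul' k H) ∘ₗ
    (TensorProduct.tensorTensorTensorComm k V H V H).toLinearMap ∘ₗ TensorProduct.map β β

/-- The right action `v ◁ a = ∑ v⁽¹⁾ r(v⁽²⁾, a)` of `H` obtained from a right coaction `β`. -/
def actOf (r : H →ₗ[k] H →ₗ[k] k) (β : V →ₗ[k] V ⊗[k] H) : V →ₗ[k] H →ₗ[k] V :=
  TensorProduct.curry ((TensorProduct.rid k V).toLinearMap ∘ₗ
    LinearMap.lTensor V (TensorProduct.lift r) ∘ₗ
    (TensorProduct.assoc k V H H).toLinearMap ∘ₗ LinearMap.rTensor H β)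

/-- A Hopf algebra structure on the algebra `V` in the braided category of right `H`-comodules,
whose braiding is induced by the form `r`. All structure maps are comodule maps; for the product
and the unit this says that the coaction is an algebra homomorphism. -/
structure BraidedHopfAlgebra (r : H →ₗ[k] H →ₗ[k] k) (V : Type w) [Ring V] [Algebra k V] where
  coact : V →ₐ[k] V ⊗[k] H
  coact_coassoc : (TensorProduct.assoc k V H H).toLinearMap ∘ₗ
      LinearMap.rTensor H coact.toLinearMap ∘ₗ coact.toLinearMap =
    LinearMap.lTensor V Coalgebra.comul ∘ₗ coact.toLinearMap
  coact_counit : (TensorProduct.rid k V).toLinearMap ∘ₗ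
      LinearMap.lTensor V Coalgebra.counit ∘ₗ coact.toLinearMap = LinearMap.id
  comul : V →ₗ[k] V ⊗[k] V
  counit : V →ₐ[k] k
  antipode : V →ₗ[k] V
  coassoc : (TensorProduct.assoc k V V V).toLinearMap ∘ₗ LinearMap.rTensor V comul ∘ₗ comul =
    LinearMap.lTensor V comul ∘ₗ comul
  counit_comul : (TensorProduct.lid k V).toLinearMap ∘ₗ
    LinearMap.rTensor V counit.toLinearMap ∘ₗ comul = LinearMap.id
  comul_counit : (TensorProduct.rid k V).toLinearMap ∘ₗ
    LinearMap.lTensor V counit.toLinearMap ∘ₗ comul = LinearMap.id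
  comul_one : comul 1 = 1 ⊗ₜ[k] 1
  comul_mul : ∀ a b : V, comul (a * b) =
    braidedMul (braiding r coact.toLinearMap) (comul a ⊗ₜ[k] comul b)
  antipode_left : LinearMap.mul' k V ∘ₗ LinearMap.rTensor V antipode ∘ₗ comul =
    Algebra.linearMap k V ∘ₗ counit.toLinearMap
  antipode_right : LinearMap.mul' k V ∘ₗ LinearMap.lTensor V antipode ∘ₗ comul =
    Algebra.linearMap k V ∘ₗ counit.toLinearMap
  coact_comul : coactTensor coact.toLinearMap ∘ₗ comul =
    LinearMap.rTensor H comul ∘ₗ coact.toLinearMap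
  coact_counit_eq : ∀ a : V, TensorProduct.lid k H
    (LinearMap.rTensor H counit.toLinearMap (coact a)) = algebraMap k H (counit a)
  coact_antipode : coact.toLinearMap ∘ₗ antipode =
    LinearMap.rTensor H antipode ∘ₗ coact.toLinearMap

variable {r : H →ₗ[k] H →ₗ[k] k}

/-- The Hopf algebra `E`, with the homomorphisms `ιV : V → E` and `ιH : H → E`, is the bosonization
`V ⋊ H` of the braided Hopf algebra `V`: as an algebra it is the semidirect product of `V` and `H`
by the action `◁` that `r` makes out of the coaction, and as a coalgebra the semidirect coproduct
by the coaction. Together these properties determine `E` up to a unique isomorphism. -/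
structure IsBosonization (B : BraidedHopfAlgebra r V) {E : Type*} [Ring E] [HopfAlgebra k E]
    (ιV : V →ₐ[k] E) (ιH : H →ₐc[k] E) : Prop where
  /-- `v ⊗ a ↦ v a` is bijective. -/
  bijective_mul : Function.Bijective (LinearMap.mul' k E ∘ₗ
    TensorProduct.map ιV.toLinearMap (ιH : H →ₐ[k] E).toLinearMap)
  /-- `a ⊗ v ↦ a v` is bijective. -/
  bijective_mul' : Function.Bijective (LinearMap.mul' k E ∘ₗ
    TensorProduct.map (ιH : H →ₐ[k] E).toLinearMap ιV.toLinearMap)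
  /-- `v a = ∑ a₁ (v ◁ a₂)` -/
  cross : ∀ (b : V) (a : H), ιV b * ιH a = LinearMap.mul' k E (TensorProduct.map
    (ιH : H →ₐ[k] E).toLinearMap (ιV.toLinearMap ∘ₗ actOf r B.coact.toLinearMap b)
    (Coalgebra.comul a))
  /-- `Δ b = ∑ b₁⁽¹⁾ ⊗ b₁⁽²⁾ b₂`, where `∑ b₁ ⊗ b₂` is the braided coproduct of `b`. -/
  comul_eq : ∀ b : V, Coalgebra.comul (R := k) (ιV b) =
    TensorProduct.map ιV.toLinearMap (LinearMap.mul' k E ∘ₗ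
        TensorProduct.map (ιH : H →ₐ[k] E).toLinearMap ιV.toLinearMap)
      (TensorProduct.assoc k V H V
        (LinearMap.rTensor V B.coact.toLinearMap (B.comul b)))
  counit_eq : ∀ b : V, Coalgebra.counit (R := k) (ιV b) = B.counit b

end Braided

/-! ## The extension of a Hopf algebra by a central group-like element -/

section Extension

variable {k : Type u} [Field k] (A : Type v) [Ring A] [HopfAlgebra k A]

variable (k) in
/-- `Ã`: the tensor product Hopf algebra of `A` with the group algebra of `ℤ`. -/
abbrev Ext : Type (max u v) := A ⊗[k] k[T;T⁻¹]

variable (k) in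
/-- The element `g ^ m` of `Ã`, with `g` the generator of `ℤ`. -/
def gPow (m : ℤ) : Ext k A := 1 ⊗ₜ[k] LaurentPolynomial.T m

variable {A} in
variable (k) in
/-- The copy of `a` in `Ã`. -/
def toExt (a : A) : Ext k A := a ⊗ₜ[k] 1

/-- The bilinear form `(g ^ a, g ^ b) ↦ lam ^ (- a b)` on the group algebra of `ℤ`. -/
def zForm (lam : k) : k[T;T⁻¹] →ₗ[k] k[T;T⁻¹] →ₗ[k] k :=
  Finsupp.linearCombination k (fun a : ℤ =>
      Finsupp.linearCombination k (fun b : ℤ => lam ^ (-(a * b))) ∘ₗ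
        (AddMonoidAlgebra.coeffLinearEquiv k).toLinearMap) ∘ₗ
    (AddMonoidAlgebra.coeffLinearEquiv k).toLinearMap

variable {A}

/-- The tensor product of a form `r` on `A` with the form `zForm lam`, as a form on `Ã`. -/
def extForm (r : A →ₗ[k] A →ₗ[k] k) (lam : k) : Ext k A →ₗ[k] Ext k A →ₗ[k] k :=
  TensorProduct.curry (LinearMap.mul' k k ∘ₗ
    TensorProduct.map (TensorProduct.lift r) (TensorProduct.lift (zForm lam)) ∘ₗ
    (TensorProduct.tensorTensorTensorComm k A k[T;T⁻¹] A k[T;T⁻¹]).toLinearMap)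

theorem extForm_tmul_T (r : A →ₗ[k] A →ₗ[k] k) (lam : k) (a b : A) (p q : ℤ) :
    extForm r lam (a ⊗ₜ[k] LaurentPolynomial.T p) (b ⊗ₜ[k] LaurentPolynomial.T q) =
      r a b * lam ^ (-(p * q)) := by
  have h : ∀ m : ℤ, (AddMonoidAlgebra.coeffLinearEquiv k) (LaurentPolynomial.T m : k[T;T⁻¹]) =
      Finsupp.single m (1 : k) := fun m => rfl
  simp [extForm, zForm, h]

end Extension

end BraidedVectors

end

open BraidedVectors

open BraidedVectors TensorProduct LaurentPolynomial

noncomputable section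

namespace BraidedVectors

/-! The bosonization is built first, and the braided Hopf algebra is then read off from it. Let `H`
be a Hopf algebra with dual quasitriangular form `r`, and `u` a matrix over `H` that coacts on the
generators of `V = V(R')`, respects its relations, and satisfies `r(u, u) = R` (`IsVectorCoaction`).
The general argument needs nothing more about `H`. The theorem is the case `H = Ã`, `u = g⁻¹ St`:
here `r(St, St) = r(t, t) = λR`, and the value `λ⁻¹` of the form at `(g⁻¹, g⁻¹)` removes the factor
`λ`.

The smash product `E`, with `x^i a = ∑ a₁ r(u i j, a₂) x^j`, is realized by operators on `H ⊗ V`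
(`exists_isSmash`). By its universal property, `Δ`, `ε` and `S` are determined by their values on
`H` and on the `x^i`, and only the relations have to be checked. Condition (iii) says that `PR` and
`PR'` commute; with it, (ii) says that `PR'` fixes the image of `PR + 1`. For `Δ x^i = ∑ x^j ⊗ u i j
+ 1 ⊗ x^i`, the products within each of the two summands satisfy the relations separately, and the
mixed terms have the form `PR + 1` applied to a family (`genComul_rel`). For `S x^i = -∑ x^m S(u i
m)`, reordering produces `PR` applied to the family `x x`, which is still fixed by `PR'`
(`genAntipode_rel`). The cross relations survive by the quasi-commutativity of `r`. The Hopf axioms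
then need checking on generators only.

Conversely, the projection `a v ↦ ε(a) v` from `E` to `V` carries `Δ` to the braided coproduct. The
map `cosmash`, `v ⊗ w ↦ ∑ v⁽¹⁾ ⊗ v⁽²⁾ w`, embeds the braided tensor square of `V` in `E ⊗ E`
multiplicatively, and `Δ V` lies in its image; this transports the axioms from `E` to `V`. The
braided antipode is `v ↦ ∑ S(v⁽¹⁾) v⁽²⁾`, and an induction on monomials shows that its values lie in
`V`. Convolution invertibility of `r` makes multiplication bijective in the other order as well. -/

theorem sum_sum_comm {ι ι' κ κ' M : Type*} [Fintype ι] [Fintype ι'] [Fintype κ] [Fintype κ']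
    [AddCommMonoid M] (f : ι → ι' → κ → κ' → M) :
    ∑ a, ∑ b, ∑ c, ∑ d, f a b c d = ∑ c, ∑ d, ∑ a, ∑ b, f a b c d := by
  have h : ∑ a, ∑ b, ∑ c, ∑ d, f a b c d =
      ∑ p : ι × ι', ∑ q : κ × κ', f p.1 p.2 q.1 q.2 := by
    simp only [Fintype.sum_prod_type]
  rw [h, Finset.sum_comm]
  simp only [Fintype.sum_prod_type]

/-! ### Conditions (ii) and (iii) as statements about families of vectors -/

section Matrices

variable {k : Type u} [Field k] {n : ℕ} {R R' : Mat2 k n}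

theorem flipMat_mul_apply (R : Mat2 k n) (p q : Fin n × Fin n) :
    (flipMat k n * R) p q = R p.swap q := by
  rw [Matrix.mul_apply, Finset.sum_eq_single p.swap]
  · simp [flipMat]
  · intro b _ hb
    rw [flipMat, if_neg, zero_mul]
    rintro ⟨h1, h2⟩
    exact hb (Prod.ext h2.symm h1.symm)
  · simp

/-- Since `R₂₁ R' = (PR)(PR')`, condition (iii) says that `PR` and `PR'` commute. Cancelling the
leftmost `P` leaves `R P R' = R' P R`. -/
theorem IsBraidedVectorDatum.exchange_apply (hR : IsBraidedVectorDatum R R') (i j c d : Fin n) :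
    ∑ a, ∑ b, R (i, j) (a, b) * R' (b, a) (c, d) =
      ∑ a, ∑ b, R' (i, j) (a, b) * R (b, a) (c, d) := by
  have h := congrFun (congrFun hR.exchange (j, i)) (c, d)
  simp only [Matrix.mul_apply, leg21, Fintype.sum_prod_type, Prod.swap] at h
  rw [Finset.sum_comm, h, Finset.sum_comm]

/-- Because `PR` and `PR'` commute, (ii) also reads `PR + 1 = PR' (PR + 1)`. Multiplied by `P` on
the left this becomes `P + R = R' + R' P R`. -/
theorem IsBraidedVectorDatum.hecke_apply (hR : IsBraidedVectorDatum R R') (i j d c : Fin n) :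
    (if i = c ∧ j = d then 1 else 0) + R (i, j) (d, c) =
      R' (i, j) (d, c) + ∑ a, ∑ b, R' (i, j) (a, b) * R (b, a) (d, c) := by
  have h := congrFun (congrFun hR.hecke (j, i)) (d, c)
  rw [mul_sub, add_mul, mul_one, one_mul, Matrix.mul_assoc] at h
  simp only [Matrix.sub_apply, Matrix.add_apply, flipMat_mul_apply, Prod.swap,
    Matrix.zero_apply, Matrix.one_apply, Prod.mk.injEq] at h
  simp only [Matrix.mul_apply (M := R), flipMat_mul_apply, Fintype.sum_prod_type, Prod.swap] at h
  rw [← hR.exchange_apply]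
  simp only [and_comm (a := i = c)]
  linear_combination -h

/-- Commuting operators preserve each other's fixed vectors: a family fixed by `R'P` stays fixed
after `RP` is applied. The antipode relations rest on this. -/
theorem IsBraidedVectorDatum.sum_exchange (hR : IsBraidedVectorDatum R R') {M : Type*}
    [AddCommGroup M] [Module k M] (z : Fin n → Fin n → M)
    (hz : ∀ i j, z i j = ∑ a, ∑ b, R' (i, j) (a, b) • z b a) (i j : Fin n) :
    ∑ a, ∑ b, R (i, j) (a, b) • z b a =
      ∑ a, ∑ b, R' (i, j) (a, b) • ∑ c, ∑ d, R (b, a) (c, d) • z d c := by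
  have e : ∀ S T : Mat2 k n, ∑ a, ∑ b, S (i, j) (a, b) • ∑ c, ∑ d, T (b, a) (c, d) • z d c =
      ∑ c, ∑ d, (∑ a, ∑ b, S (i, j) (a, b) * T (b, a) (c, d)) • z d c := by
    intro S T
    simp only [Finset.smul_sum, Finset.sum_smul, smul_smul]
    exact sum_sum_comm _
  rw [e R' R]
  simp only [← hR.exchange_apply]
  rw [← e R R']
  simp only [← hz]

/-- The image of `1 + RP` is fixed by `R'P`, for an arbitrary family `z`. This absorbs the mixed
terms in the coproduct relations. -/
theorem IsBraidedVectorDatum.sum_hecke (hR : IsBraidedVectorDatum R R') {M : Type*}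
    [AddCommGroup M] [Module k M] (z : Fin n → Fin n → M) (i j : Fin n) :
    z i j + ∑ d, ∑ c, R (i, j) (d, c) • z c d =
      ∑ a, ∑ b, R' (i, j) (a, b) • (z b a + ∑ d, ∑ c, R (b, a) (d, c) • z c d) := by
  have e : ∑ a, ∑ b, R' (i, j) (a, b) • ∑ d, ∑ c, R (b, a) (d, c) • z c d =
      ∑ d, ∑ c, (∑ a, ∑ b, R' (i, j) (a, b) * R (b, a) (d, c)) • z c d := by
    simp only [Finset.smul_sum, Finset.sum_smul, smul_smul]
    exact sum_sum_comm _
  simp only [smul_add, Finset.sum_add_distrib]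
  rw [e, ← Finset.sum_add_distrib]
  simp only [← Finset.sum_add_distrib, ← add_smul, ← hR.hecke_apply]
  simp only [add_smul, Finset.sum_add_distrib, ite_smul, one_smul, zero_smul, ite_and]
  congr 1
  rw [Finset.sum_comm]
  simp

end Matrices

/-! ### The algebra of braided vectors and its universal property -/

section Vectors

variable {k : Type u} [Field k] {n : ℕ} {R' : Mat2 k n} {B : Type*} [Ring B] [Algebra k B]

theorem vecGen_mul_vecGen (i j : Fin n) : vecGen R' i * vecGen R' j =
    ∑ a, ∑ b, R' (i, j) (a, b) • (vecGen R' b * vecGen R' a) := by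
  have h := RingQuot.mkAlgHom_rel k (VectorRel.rel (R' := R') i j)
  simp only [map_mul, map_sum, map_smul] at h
  exact h

/-- The universal property of the algebra of braided vectors. -/
def vecLift (X : Fin n → B)
    (hX : ∀ i j, X i * X j = ∑ a, ∑ b, R' (i, j) (a, b) • (X b * X a)) : VectorAlg R' →ₐ[k] B :=
  RingQuot.liftAlgHom k ⟨FreeAlgebra.lift k X, by
    rintro _ _ ⟨i, j⟩
    simpa using hX i j⟩

@[simp]
theorem vecLift_vecGen (X : Fin n → B)
    (hX : ∀ i j, X i * X j = ∑ a, ∑ b, R' (i, j) (a, b) • (X b * X a)) (i : Fin n) :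
    vecLift X hX (vecGen R' i) = X i := by
  simp [vecLift, vecGen]

theorem vecAlgHom_ext {f g : VectorAlg R' →ₐ[k] B}
    (h : ∀ i, f (vecGen R' i) = g (vecGen R' i)) : f = g := by
  apply RingQuot.ringQuot_ext'
  apply FreeAlgebra.hom_ext
  funext i
  exact h i

/-- Twisting a family satisfying the relations of `V(R')` by a commuting quantum matrix. -/
theorem vecRel_twist (X : Fin n → B) (Y : Fin n → Fin n → B)
    (hXY : ∀ a b c, Commute (X a) (Y b c))
    (hX : ∀ i j, X i * X j = ∑ a, ∑ b, R' (i, j) (a, b) • (X b * X a))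
    (hY : ∀ i j q p, ∑ c, ∑ d, R' (i, j) (c, d) • (Y d q * Y c p) =
      ∑ c, ∑ d, R' (c, d) (p, q) • (Y i c * Y j d)) (i j : Fin n) :
    (∑ a, Y i a * X a) * (∑ b, Y j b * X b) =
      ∑ c, ∑ d, R' (i, j) (c, d) • ((∑ q, Y d q * X q) * (∑ p, Y c p * X p)) := by
  have e : ∀ i j : Fin n, (∑ a, Y i a * X a) * (∑ b, Y j b * X b) =
      ∑ a, ∑ b, (Y i a * Y j b) * (X a * X b) := by
    intro i j
    rw [Finset.sum_mul_sum]
    refine Finset.sum_congr rfl fun a _ => Finset.sum_congr rfl fun b _ => ?_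
    rw [mul_assoc, ← mul_assoc (X a), (hXY a j b).eq, mul_assoc, mul_assoc]
  simp only [e]
  have l : ∑ c, ∑ d, R' (i, j) (c, d) • ∑ q, ∑ p, Y d q * Y c p * (X q * X p) =
      ∑ q, ∑ p, (∑ c, ∑ d, R' (i, j) (c, d) • (Y d q * Y c p)) * (X q * X p) := by
    simp only [Finset.smul_sum, Finset.sum_mul, smul_mul_assoc]
    rw [sum_sum_comm]
  rw [l]
  -- The relation for `Y` moves `R'` to the inner indices, where the relation for `X` absorbs it.
  simp only [hY]
  have m : ∀ a b, Y i a * Y j b * (X a * X b) =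
      ∑ p, ∑ q, (R' (a, b) (p, q) • (Y i a * Y j b)) * (X q * X p) := by
    intro a b
    rw [hX a b]
    simp only [Finset.mul_sum, smul_mul_assoc, mul_smul_comm]
  simp only [m, Finset.sum_mul]
  rw [sum_sum_comm]
  exact Finset.sum_comm

variable {V : Type*} [Ring V] [Algebra k V] {x : Fin n → V}

/-- `V` is the algebra of braided vectors, with generators `x`. -/
def IsVectorAlg (R' : Mat2 k n) (x : Fin n → V) : Prop :=
  ∃ e : V ≃ₐ[k] VectorAlg R', ∀ i, e (x i) = vecGen R' i

theorem isVectorAlg_vecGen (R' : Mat2 k n) : IsVectorAlg R' (vecGen R') :=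
  ⟨AlgEquiv.refl, fun _ => rfl⟩

theorem IsVectorAlg.rel (hV : IsVectorAlg R' x) (i j : Fin n) :
    x i * x j = ∑ a, ∑ b, R' (i, j) (a, b) • (x b * x a) := by
  obtain ⟨e, he⟩ := hV
  apply e.injective
  rw [map_mul, he, he, vecGen_mul_vecGen]
  simp [he]

/-- The universal property of the algebra of braided vectors. -/
def IsVectorAlg.lift (hV : IsVectorAlg R' x) (X : Fin n → B)
    (hX : ∀ i j, X i * X j = ∑ a, ∑ b, R' (i, j) (a, b) • (X b * X a)) : V →ₐ[k] B :=
  (vecLift X hX).comp hV.choose.toAlgHom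

@[simp]
theorem IsVectorAlg.lift_gen (hV : IsVectorAlg R' x) (X : Fin n → B)
    (hX : ∀ i j, X i * X j = ∑ a, ∑ b, R' (i, j) (a, b) • (X b * X a)) (i : Fin n) :
    hV.lift X hX (x i) = X i := by
  have h := hV.choose_spec i
  change vecLift X hX (hV.choose (x i)) = X i
  rw [h, vecLift_vecGen]

theorem IsVectorAlg.hom_ext (hV : IsVectorAlg R' x) {f g : V →ₐ[k] B}
    (h : ∀ i, f (x i) = g (x i)) : f = g := by
  obtain ⟨e, he⟩ := hV
  have h' : f.comp e.symm.toAlgHom = g.comp e.symm.toAlgHom := vecAlgHom_ext fun i => by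
    change f (e.symm _) = g (e.symm _)
    rw [← he, AlgEquiv.symm_apply_apply, h]
  ext v
  simpa using DFunLike.congr_fun h' (e v)

/-- The universal property gives a map from `V` to the subalgebra generated by the `x i`; followed
by the inclusion it is the identity, by uniqueness. -/
theorem IsVectorAlg.adjoin_eq_top (hV : IsVectorAlg R' x) :
    Algebra.adjoin k (Set.range x) = ⊤ := by
  have h : (Algebra.adjoin k (Set.range x)).val.comp
      (hV.lift (B := Algebra.adjoin k (Set.range x))
        (fun i => ⟨x i, Algebra.subset_adjoin ⟨i, rfl⟩⟩) (by
        intro i j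
        apply Subtype.ext
        simpa using hV.rel i j)) = AlgHom.id k _ :=
    hV.hom_ext fun i => by simp
  refine top_unique fun v _ => ?_
  have := congrArg (fun f => f v) h
  simp only [AlgHom.comp_apply, AlgHom.id_apply] at this
  rw [← this]
  exact Subtype.property _

theorem IsVectorAlg.induction (hV : IsVectorAlg R' x) {P : V → Prop} (one : P 1)
    (gen_mul : ∀ i v, P v → P (x i * v)) (add : ∀ v w, P v → P w → P (v + w))
    (smul : ∀ (c : k) v, P v → P (c • v)) (v : V) : P v := by
  have h : v ∈ Algebra.adjoin k (Set.range x) := by rw [hV.adjoin_eq_top]; trivial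
  -- The stronger claim is closed under products, which `P` itself need not be.
  suffices H : ∀ w, P w → P (v * w) by simpa using H 1 one
  induction h using Algebra.adjoin_induction with
  | mem x hx =>
    obtain ⟨i, rfl⟩ := hx
    exact gen_mul i
  | algebraMap c =>
    intro w hw
    rw [← Algebra.smul_def]
    exact smul c w hw
  | add x y _ _ hx hy =>
    intro w hw
    rw [add_mul]
    exact add _ _ (hx w hw) (hy w hw)
  | mul x y _ _ hx hy =>
    intro w hw
    rw [mul_assoc]
    exact hx _ (hy w hw)

theorem IsVectorAlg.induction_right (hV : IsVectorAlg R' x) {P : V → Prop} (one : P 1)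
    (mul_gen : ∀ v i, P v → P (v * x i)) (add : ∀ v w, P v → P w → P (v + w))
    (smul : ∀ (c : k) v, P v → P (c • v)) (v : V) : P v := by
  have h : v ∈ Algebra.adjoin k (Set.range x) := by rw [hV.adjoin_eq_top]; trivial
  suffices H : ∀ w, P w → P (w * v) by simpa using H 1 one
  induction h using Algebra.adjoin_induction with
  | mem x hx =>
    obtain ⟨i, rfl⟩ := hx
    exact fun w hw => mul_gen w i hw
  | algebraMap c =>
    intro w hw
    rw [← Algebra.commutes, ← Algebra.smul_def]
    exact smul c w hw
  | add x y _ _ hx hy =>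
    intro w hw
    rw [mul_add]
    exact add _ _ (hx w hw) (hy w hw)
  | mul x y _ _ hx hy =>
    intro w hw
    rw [← mul_assoc]
    exact hy _ (hx w hw)

end Vectors

/-! ### Coregular actions of functionals on a coalgebra -/

section Hit

open Coalgebra

variable {k : Type u} [Field k] {C : Type v} [AddCommGroup C] [Module k C] [Coalgebra k C]

/-- The left coregular action `a ↦ ∑ a₁ f(a₂)` of a functional. -/
def hit (f : C →ₗ[k] k) : C →ₗ[k] C :=
  (TensorProduct.rid k C).toLinearMap ∘ₗ LinearMap.lTensor C f ∘ₗ comul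

/-- The right coregular action `a ↦ ∑ f(a₁) a₂` of a functional. -/
def hitLeft (f : C →ₗ[k] k) : C →ₗ[k] C :=
  (TensorProduct.lid k C).toLinearMap ∘ₗ LinearMap.rTensor C f ∘ₗ comul

theorem hit_apply (f : C →ₗ[k] k) (a : C) :
    hit f a = TensorProduct.rid k C (LinearMap.lTensor C f (comul a)) := rfl

theorem hitLeft_apply (f : C →ₗ[k] k) (a : C) :
    hitLeft f a = TensorProduct.lid k C (LinearMap.rTensor C f (comul a)) := rfl

@[simp]
theorem hit_counit : hit (counit : C →ₗ[k] k) = LinearMap.id := by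
  ext a
  simp [hit_apply]

theorem hit_add (f g : C →ₗ[k] k) : hit (f + g) = hit f + hit g := by
  ext a
  simp [hit_apply, LinearMap.lTensor_add]

theorem hit_smul (c : k) (f : C →ₗ[k] k) : hit (c • f) = c • hit f := by
  ext a
  simp [hit_apply, LinearMap.lTensor_smul]

/-- `hit` as a linear map. -/
def hitLin : (C →ₗ[k] k) →ₗ[k] Module.End k C where
  toFun := hit
  map_add' := hit_add
  map_smul' := hit_smul

@[simp]
theorem hitLin_apply (f : C →ₗ[k] k) : hitLin f = hit f := rfl

/-- Both sides are `∑ a₁ ⊗ a₂ f(a₃)`. -/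
theorem comul_hit (f : C →ₗ[k] k) (a : C) :
    comul (R := k) (hit f a) = LinearMap.lTensor C (hit f) (comul (R := k) a) := by
  have h : ∀ z : C ⊗[k] C, comul (R := k) (TensorProduct.rid k C (LinearMap.lTensor C f z)) =
      LinearMap.lTensor C ((TensorProduct.rid k C).toLinearMap ∘ₗ LinearMap.lTensor C f)
        (TensorProduct.assoc k C C C (LinearMap.rTensor C comul z)) := by
    intro z
    induction z with
    | zero => simp
    | add x y hx hy => simp only [map_add, hx, hy]
    | tmul x y =>
      simp only [LinearMap.lTensor_tmul, TensorProduct.rid_tmul, map_smul, LinearMap.rTensor_tmul]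
      induction comul (R := k) x with
      | zero => simp
      | add x y hx hy => simp only [smul_add, add_tmul, map_add, hx, hy]
      | tmul x y => simp
  rw [hit_apply, h, coassoc_apply, ← LinearMap.comp_apply, ← LinearMap.lTensor_comp]
  rfl

/-- Both sides are `∑ a₁ ⊗ f(a₂) a₃`. -/
theorem rTensor_hit_comul (f : C →ₗ[k] k) (a : C) :
    LinearMap.rTensor C (hit f) (comul (R := k) a) =
      LinearMap.lTensor C (hitLeft f) (comul (R := k) a) := by
  rw [hit, hitLeft, LinearMap.rTensor_comp, LinearMap.rTensor_comp, LinearMap.lTensor_comp,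
    LinearMap.lTensor_comp]
  simp only [LinearMap.comp_apply]
  rw [← coassoc_apply]
  generalize LinearMap.rTensor C comul (comul (R := k) a) = z
  induction z with
  | zero => simp
  | add x y hx hy => simp only [map_add, hx, hy]
  | tmul x y =>
    induction x with
    | zero => simp
    | add x y hx hy => simp only [add_tmul, map_add, hx, hy]
    | tmul x y => simp [smul_tmul]

@[simp]
theorem counit_hit (f : C →ₗ[k] k) (a : C) : counit (R := k) (hit f a) = f a := by
  have h : ∀ z : C ⊗[k] C, counit (R := k) (TensorProduct.rid k C (LinearMap.lTensor C f z)) =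
      f (TensorProduct.lid k C (LinearMap.rTensor C counit z)) := by
    intro z
    induction z with
    | zero => simp
    | add x y hx hy => simp only [map_add, hx, hy]
    | tmul x y => simp [mul_comm]
  rw [hit_apply, h]
  simp

/-- Both sides are `∑ a₁ f(a₂) g(a₃)`, so the convolution algebra acts on `C`. -/
theorem hit_hit (f g : C →ₗ[k] k) (a : C) : hit f (hit g a) = hit (convMul f g) a := by
  rw [hit_apply f, comul_hit, hit_apply (convMul f g), convMul, ← LinearMap.comp_apply,
    ← LinearMap.lTensor_comp]
  congr 2
  congr 1
  ext b
  have h : ∀ z : C ⊗[k] C, f (TensorProduct.rid k C (LinearMap.lTensor C g z)) =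
      LinearMap.mul' k k (TensorProduct.map f g z) := by
    intro z
    induction z with
    | zero => simp
    | add x y hx hy => simp only [map_add, hx, hy]
    | tmul x y => simp [mul_comm]
  exact h _

end Hit

/-! ### Matrix corepresentations paired with a dual quasitriangular form -/

section Corep

open Coalgebra

variable {k : Type u} [Field k] {H : Type v} [Ring H] [HopfAlgebra k H] {ι : Type*} [Fintype ι]
  [DecidableEq ι]

variable (k) in
/-- The coefficients of a right coaction `y i ↦ ∑ j, y j ⊗ U i j`. -/
structure IsCorep (U : ι → ι → H) : Prop where
  comul_eq : ∀ i j, comul (R := k) (U i j) = ∑ a, U a j ⊗ₜ[k] U i a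
  counit_eq : ∀ i j, counit (R := k) (U i j) = if i = j then 1 else 0

theorem IsDualQuasitriangular.convMul_eq {r : H →ₗ[k] H →ₗ[k] k} (hr : IsDualQuasitriangular r)
    (a b : H) : convMul (r a) (r b) = r (a * b) := by
  ext c
  exact (hr.mul_left a b c).symm

/-- In the convolution monoid an idempotent with a right inverse is the unit: `f = f (f g) = (f f) g
= f g = 1`. -/
theorem eq_counit_of_convMul_self {C : Type*} [AddCommGroup C] [Module k C] [Coalgebra k C]
    {f g : C →ₗ[k] k} (hf : convMul f f = f) (hg : convMul f g = counit) : f = counit := by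
  have h1 : WithConv.toConv f * WithConv.toConv f = WithConv.toConv f := congrArg _ hf
  have h2 : WithConv.toConv f * WithConv.toConv g = 1 := by
    apply WithConv.ext
    rw [LinearMap.convOne_def]
    exact hg
  have h3 : WithConv.toConv f = 1 := by
    rw [← h2, ← h1, mul_assoc, h2, mul_one]
    rw [h1]
  have := congrArg WithConv.ofConv h3
  rw [LinearMap.convOne_def] at this
  exact this

/-- Convolution of functionals on `H ⊗ H`, on representatives of the coproducts. -/
theorem convMul_tmul (f g : H ⊗[k] H →ₗ[k] k) {ι κ : Type*} {s : Finset ι} {t : Finset κ}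
    {a b : H} {x y : ι → H} {z w : κ → H} (ha : comul (R := k) a = ∑ i ∈ s, x i ⊗ₜ[k] y i)
    (hb : comul (R := k) b = ∑ i ∈ t, z i ⊗ₜ[k] w i) :
    convMul f g (a ⊗ₜ[k] b) = ∑ i ∈ s, ∑ j ∈ t, f (x i ⊗ₜ z j) * g (y i ⊗ₜ w j) := by
  simp [convMul, TensorProduct.comul_tmul, ha, hb, sum_tmul, tmul_sum]
  rw [Finset.sum_comm]

variable {r : H →ₗ[k] H →ₗ[k] k}

/-- The functional `r 1` is a convolution idempotent because `1 * 1 = 1`, and the inverse of `r`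
with first argument `1` is a right inverse of it. -/
theorem IsDualQuasitriangular.one_left (hr : IsDualQuasitriangular r) : r 1 = counit := by
  obtain ⟨s, hs, -⟩ := hr.exists_inv
  refine eq_counit_of_convMul_self (g := TensorProduct.curry s 1)
    (by rw [hr.convMul_eq, one_mul]) ?_
  ext c
  have h := LinearMap.congr_fun hs (1 ⊗ₜ c)
  rw [convMul_tmul (s := {()}) (x := fun _ => 1) (y := fun _ => 1) _ _
    (by simp [Algebra.TensorProduct.one_def]) (Coalgebra.Repr.arbitrary k c).eq.symm] at h
  rw [TensorProduct.counit_tmul] at h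
  simp only [Finset.sum_singleton, lift.tmul, Bialgebra.counit_one, smul_eq_mul, mul_one] at h
  rw [← h]
  simp [convMul, ← (Coalgebra.Repr.arbitrary k c).eq]

theorem IsDualQuasitriangular.one_right (hr : IsDualQuasitriangular r) : r.flip 1 = counit := by
  obtain ⟨s, hs, -⟩ := hr.exists_inv
  refine eq_counit_of_convMul_self (g := (TensorProduct.curry s).flip 1) ?_ ?_
  · ext c
    conv_rhs => rw [← one_mul (1 : H)]
    exact (hr.mul_right c 1 1).symm
  ext c
  have h := LinearMap.congr_fun hs (c ⊗ₜ 1)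
  rw [convMul_tmul (t := {()}) (z := fun _ => 1) (w := fun _ => 1) _ _
    (Coalgebra.Repr.arbitrary k c).eq.symm (by simp [Algebra.TensorProduct.one_def])] at h
  rw [TensorProduct.counit_tmul] at h
  simp only [Finset.sum_singleton, lift.tmul, Bialgebra.counit_one, smul_eq_mul, one_mul] at h
  rw [← h]
  simp [convMul, ← (Coalgebra.Repr.arbitrary k c).eq]

/-- The action of `H` on itself by the functionals `r a`. -/
def hitHom (hr : IsDualQuasitriangular r) : H →ₐ[k] Module.End k H :=
  AlgHom.ofLinearMap (hitLin ∘ₗ r) (by simp [hr.one_left, Module.End.one_eq_id])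
    (by
      intro a b
      ext c
      simp [hit_hit, hr.convMul_eq])

@[simp]
theorem hitHom_apply (hr : IsDualQuasitriangular r) (a : H) : hitHom hr a = hit (r a) := rfl

variable {U : ι → ι → H}

theorem IsCorep.form_mul (hU : IsCorep k U) (hr : IsDualQuasitriangular r) (i j : ι) (a b : H) :
    r (U i j) (a * b) = ∑ m, r (U m j) b * r (U i m) a := by
  rw [hr.mul_right, hU.comul_eq]
  simp

theorem IsCorep.hit_mul (hU : IsCorep k U) (hr : IsDualQuasitriangular r) (i j : ι) (a b : H) :
    hit (r (U i j)) (a * b) = ∑ m, hit (r (U i m)) a * hit (r (U m j)) b := by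
  simp only [hit_apply, Bialgebra.comul_mul]
  induction comul (R := k) a with
  | zero => simp
  | add x y hx hy => simp only [add_mul, map_add, hx, hy, Finset.sum_add_distrib]
  | tmul x y =>
    induction comul (R := k) b with
    | zero => simp
    | add x y hx hy => simp only [mul_add, map_add, hx, hy, Finset.sum_add_distrib]
    | tmul z w =>
      simp [hU.form_mul hr, Finset.sum_smul, smul_smul]

theorem IsCorep.hit_one (hU : IsCorep k U) (hr : IsDualQuasitriangular r) (i j : ι) :
    hit (r (U i j)) 1 = if i = j then 1 else 0 := by
  have h := LinearMap.congr_fun hr.one_right (U i j)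
  rw [LinearMap.flip_apply, hU.counit_eq] at h
  rw [hit_apply, Bialgebra.comul_one, Algebra.TensorProduct.one_def]
  simp [h]

/-- Quasi-commutativity at `(U i j, a)` with the coproduct of `U i j` expanded. It enters in this
form for the coproduct, the antipode, and the equivariance of the braided antipode. -/
theorem IsCorep.quasi_comm (hU : IsCorep k U) (hr : IsDualQuasitriangular r) (i j : ι) (a : H) :
    ∑ m, U i m * hitLeft (r (U m j)) a = ∑ m, hit (r (U i m)) a * U m j := by
  have h := hr.quasi_comm (U i j) a
  rw [TensorProduct.comul_tmul, hU.comul_eq] at h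
  simp only [hit_apply, hitLeft_apply]
  revert h
  have e1 : ∀ z : H ⊗[k] H, TensorProduct.lid k H (TensorProduct.map (TensorProduct.lift r)
      (LinearMap.mul' k H) (TensorProduct.AlgebraTensorModule.tensorTensorTensorComm k k k k H H H H
        ((∑ m, U m j ⊗ₜ[k] U i m) ⊗ₜ z))) =
      ∑ m, U i m * TensorProduct.lid k H (LinearMap.rTensor H (r (U m j)) z) := by
    intro z
    induction z with
    | zero => simp
    | add x y hx hy => simp only [tmul_add, mul_add, map_add, hx, hy, Finset.sum_add_distrib]
    | tmul x y => simp [sum_tmul]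
  have e2 : ∀ z : H ⊗[k] H, TensorProduct.rid k H (TensorProduct.map
        (LinearMap.mul' k H ∘ₗ (TensorProduct.comm k H H).toLinearMap) (TensorProduct.lift r)
      (TensorProduct.AlgebraTensorModule.tensorTensorTensorComm k k k k H H H H
        ((∑ m, U m j ⊗ₜ[k] U i m) ⊗ₜ z))) =
      ∑ m, TensorProduct.rid k H (LinearMap.lTensor H (r (U i m)) z) * U m j := by
    intro z
    induction z with
    | zero => simp
    | add x y hx hy => simp only [tmul_add, add_mul, map_add, hx, hy, Finset.sum_add_distrib]
    | tmul x y => simp [sum_tmul]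
  rw [e1, e2]
  exact id

/-- Convolution inverse forms on `H ⊗ H` give inverse matrices of operators on `H`; this is what
inverts `crossMap`. -/
theorem IsCorep.sum_hit_hit (hU : IsCorep k U) (f g : H ⊗[k] H →ₗ[k] k)
    (h : convMul f g = counit) (i j : ι) (a : H) :
    ∑ m, hit (TensorProduct.curry f (U m j)) (hit (TensorProduct.curry g (U i m)) a) =
      if i = j then a else 0 := by
  have e : ∑ m, convMul (TensorProduct.curry f (U m j)) (TensorProduct.curry g (U i m)) =
      (if i = j then 1 else 0 : k) • (counit : H →ₗ[k] k) := by
    ext c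
    have := LinearMap.congr_fun h (U i j ⊗ₜ c)
    rw [convMul_tmul f g (hU.comul_eq i j) (Coalgebra.Repr.arbitrary k c).eq.symm,
      TensorProduct.counit_tmul, hU.counit_eq] at this
    rw [LinearMap.smul_apply, smul_eq_mul, mul_comm, ← smul_eq_mul, ← this]
    simp [convMul, ← (Coalgebra.Repr.arbitrary k c).eq]
  simp only [hit_hit]
  rw [← LinearMap.sum_apply]
  simp only [← hitLin_apply]
  rw [← map_sum, e, map_smul]
  split_ifs <;> simp

theorem IsCorep.sum_antipode_mul (hU : IsCorep k U) (i j : ι) :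
    ∑ a, HopfAlgebra.antipode k (U a j) * U i a = if i = j then 1 else 0 := by
  have h := HopfAlgebra.mul_antipode_rTensor_comul_apply (R := k) (U i j)
  rw [hU.comul_eq, hU.counit_eq] at h
  simpa [apply_ite] using h

theorem IsCorep.sum_mul_antipode (hU : IsCorep k U) (i j : ι) :
    ∑ a, U a j * HopfAlgebra.antipode k (U i a) = if i = j then 1 else 0 := by
  have h := HopfAlgebra.mul_antipode_lTensor_comul_apply (R := k) (U i j)
  rw [hU.comul_eq, hU.counit_eq] at h
  simpa [apply_ite] using h

end Corep

/-! ### Cross relations and the antipode -/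

section Cross

open Coalgebra

variable {k : Type u} [Field k] {H : Type v} [Ring H] [HopfAlgebra k H] {ι : Type*} [Fintype ι]
  {B : Type*} [Ring B] [Algebra k B] {r : H →ₗ[k] H →ₗ[k] k} {U : ι → ι → H}

/-- The relations `X i * a = ∑ j, a₁ r(U i j, a₂) * X j`. -/
def Crosses (r : H →ₗ[k] H →ₗ[k] k) (U : ι → ι → H) (g : H →ₐ[k] B) (X : ι → B) : Prop :=
  ∀ i a, X i * g a = ∑ j, g (hit (r (U i j)) a) * X j

variable {g : H →ₐ[k] B} {X : ι → B}

/-- Moving `X i` to the right turns `∑ S(a₁) X i a₂` into `∑ S(a₁) a₂ r(U i j, a₃) X j`, where the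
first two legs collapse to the counit. -/
theorem Crosses.antipode_conj (h : Crosses r U g X) (i : ι) (a : H) :
    LinearMap.mul' k B (TensorProduct.map
      (LinearMap.mulRight k (X i) ∘ₗ g.toLinearMap ∘ₗ HopfAlgebra.antipode k) g.toLinearMap
      (comul a)) = ∑ j, r (U i j) a • X j := by
  have e : ∀ z : H ⊗[k] H, LinearMap.mul' k B (TensorProduct.map
      (LinearMap.mulRight k (X i) ∘ₗ g.toLinearMap ∘ₗ HopfAlgebra.antipode k) g.toLinearMap z) =
      ∑ j, g (LinearMap.mul' k H (LinearMap.rTensor H (HopfAlgebra.antipode k)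
        (LinearMap.lTensor H (hit (r (U i j))) z))) * X j := by
    intro z
    induction z with
    | zero => simp
    | add x y hx hy => simp only [map_add, add_mul, hx, hy, Finset.sum_add_distrib]
    | tmul x y => simp [mul_assoc, h i y, Finset.mul_sum]
  rw [e]
  refine Finset.sum_congr rfl fun j _ => ?_
  rw [← comul_hit, HopfAlgebra.mul_antipode_rTensor_comul_apply, AlgHom.commutes, counit_hit,
    Algebra.smul_def]

/-- Write `S(a) X i` as `∑ S(a₁) X i a₂ S(a₃)` and apply `antipode_conj` to the first three factors.
-/
theorem Crosses.antipode_mul (h : Crosses r U g X) (i : ι) (a : H) :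
    g (HopfAlgebra.antipode k a) * X i =
      ∑ j, X j * g (HopfAlgebra.antipode k (hitLeft (r (U i j)) a)) := by
  have e1 : ∀ z : H ⊗[k] H, ∑ j, X j * g (HopfAlgebra.antipode k (TensorProduct.lid k H
      (LinearMap.rTensor H (r (U i j)) z))) =
      LinearMap.mul' k B (TensorProduct.map (LinearMap.mul' k B ∘ₗ TensorProduct.map
      (LinearMap.mulRight k (X i) ∘ₗ g.toLinearMap ∘ₗ HopfAlgebra.antipode k) g.toLinearMap)
      (g.toLinearMap ∘ₗ HopfAlgebra.antipode k) (LinearMap.rTensor H comul z)) := by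
    intro z
    induction z with
    | zero => simp
    | add x y hx hy => simp only [map_add, mul_add, Finset.sum_add_distrib, hx, hy]
    | tmul x y =>
      rw [LinearMap.rTensor_tmul, TensorProduct.map_tmul, LinearMap.comp_apply, h.antipode_conj]
      simp [Finset.sum_mul]
  have e2 : ∀ z : (H ⊗[k] H) ⊗[k] H,
      LinearMap.mul' k B (TensorProduct.map (LinearMap.mul' k B ∘ₗ TensorProduct.map
      (LinearMap.mulRight k (X i) ∘ₗ g.toLinearMap ∘ₗ HopfAlgebra.antipode k) g.toLinearMap)
      (g.toLinearMap ∘ₗ HopfAlgebra.antipode k) z) =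
      LinearMap.mul' k B (TensorProduct.map
      (LinearMap.mulRight k (X i) ∘ₗ g.toLinearMap ∘ₗ HopfAlgebra.antipode k)
        (g.toLinearMap ∘ₗ LinearMap.mul' k H ∘ₗ LinearMap.lTensor H (HopfAlgebra.antipode k))
        (TensorProduct.assoc k H H H z)) := by
    intro z
    induction z with
    | zero => simp
    | add x y hx hy => simp only [map_add, hx, hy]
    | tmul x y =>
      induction x with
      | zero => simp
      | add x y hx hy => simp only [add_tmul, map_add, hx, hy]
      | tmul x y => simp [mul_assoc]
  have e3 : ∀ z : H ⊗[k] H, LinearMap.mul' k B (TensorProduct.map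
      (LinearMap.mulRight k (X i) ∘ₗ g.toLinearMap ∘ₗ HopfAlgebra.antipode k)
        (g.toLinearMap ∘ₗ LinearMap.mul' k H ∘ₗ LinearMap.lTensor H (HopfAlgebra.antipode k))
        (LinearMap.lTensor H comul z)) = g (HopfAlgebra.antipode k (TensorProduct.rid k H
          (LinearMap.lTensor H counit z))) * X i := by
    intro z
    induction z with
    | zero => simp
    | add x y hx hy => simp only [map_add, add_mul, hx, hy]
    | tmul x y =>
      simp [HopfAlgebra.mul_antipode_lTensor_comul_apply, Algebra.algebraMap_eq_smul_one]
  simp only [hitLeft_apply]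
  rw [e1, e2, coassoc_apply, e3]
  simp

end Cross

/-! ### The smash product as an algebra of operators -/

section Smash

open Coalgebra

variable {k : Type u} [Field k] {n : ℕ} {R R' : Mat2 k n} {H : Type v} [Ring H] [HopfAlgebra k H]
  {r : H →ₗ[k] H →ₗ[k] k} {u : Fin n → Fin n → H}
  {V : Type w} [Ring V] [Algebra k V] {x : Fin n → V}

/-- The quantum matrix `u` defines a coaction `x^i ↦ ∑ j, x^j ⊗ u i j` on `V`, and the form
`r` takes the values `R` on it. -/
structure IsVectorCoaction (R R' : Mat2 k n) (r : H →ₗ[k] H →ₗ[k] k) (u : Fin n → Fin n → H) :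
    Prop extends IsCorep k u where
  rel : ∀ i j q p, ∑ c, ∑ d, R' (i, j) (c, d) • (u d q * u c p) =
    ∑ c, ∑ d, R' (c, d) (p, q) • (u i c * u j d)
  form_eq : ∀ i j a b, r (u i a) (u j b) = R (i, j) (a, b)

theorem rTensorAlgHom_tmul (F : Module.End k H) (a : H) (v : V) :
    Module.End.rTensorAlgHom k H V F (a ⊗ₜ v) = F a ⊗ₜ v := rfl

theorem lTensorAlgHom_tmul (F : Module.End k V) (a : H) (v : V) :
    Module.End.lTensorAlgHom k V H F (a ⊗ₜ v) = a ⊗ₜ F v := rfl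

/-- Left multiplication of `H` on `H ⊗ V`. -/
def smashLeft (k : Type u) [Field k] (H : Type v) [Ring H] [HopfAlgebra k H] (V : Type w)
    [Ring V] [Algebra k V] : H →ₐ[k] Module.End k (H ⊗[k] V) :=
  (Module.End.rTensorAlgHom k H (V)).comp (Algebra.lmul k H)

@[simp]
theorem smashLeft_tmul (a b : H) (v : V) :
    smashLeft k H V a (b ⊗ₜ v) = (a * b) ⊗ₜ v := by
  rw [smashLeft, AlgHom.comp_apply, rTensorAlgHom_tmul]
  rfl

/-- The action of `V` on `H ⊗ V` by left multiplication in the smash product. -/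
def smashRight (hr : IsDualQuasitriangular r) (hV : IsVectorAlg R' x)
    (hu : IsVectorCoaction R R' r u) :
    V →ₐ[k] Module.End k (H ⊗[k] V) :=
  hV.lift (fun i => ∑ a, (Module.End.rTensorAlgHom k H (V)) (hitHom hr (u i a)) *
      (Module.End.lTensorAlgHom k (V) H) (Algebra.lmul k _ (x a))) (by
    -- The generator `x i` acts by the left multiplications by `x a` on `V`, twisted by operators on
    -- `H` that commute with them and satisfy the relations of `u` through `hitHom`.
    refine vecRel_twist _ (fun i a => (Module.End.rTensorAlgHom k H (V))
      (hitHom hr (u i a))) ?_ ?_ ?_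
    · intro a b c
      refine LinearMap.ext fun z => ?_
      induction z with
      | zero => simp
      | add y z hy hz => simp only [map_add, hy, hz]
      | tmul y z =>
        simp only [Module.End.mul_apply, rTensorAlgHom_tmul, lTensorAlgHom_tmul]
    · intro i j
      rw [← map_mul, ← map_mul, hV.rel]
      simp only [map_sum, map_smul, map_mul]
    · intro i j q p
      have := congrArg (fun h => (Module.End.rTensorAlgHom k H (V)) (hitHom hr h))
        (hu.rel i j q p)
      simpa only [map_sum, map_smul, map_mul] using this)

theorem smashRight_vecGen_tmul (hr : IsDualQuasitriangular r) (hV : IsVectorAlg R' x)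
    (hu : IsVectorCoaction R R' r u)
    (i : Fin n) (a : H) (v : V) : smashRight hr hV hu (x i) (a ⊗ₜ v) =
      ∑ j, hit (r (u i j)) a ⊗ₜ (x j * v) := by
  rw [smashRight, hV.lift_gen, LinearMap.sum_apply]
  refine Finset.sum_congr rfl fun j _ => ?_
  rw [Module.End.mul_apply, lTensorAlgHom_tmul, rTensorAlgHom_tmul]
  rfl

theorem smashRight_one_tmul (hr : IsDualQuasitriangular r) (hV : IsVectorAlg R' x)
    (hu : IsVectorCoaction R R' r u)
    (v : V) : smashRight hr hV hu v (1 ⊗ₜ 1) = 1 ⊗ₜ v := by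
  induction v using hV.induction with
  | one => simp
  | gen_mul i v hv =>
    rw [map_mul, Module.End.mul_apply, hv, smashRight_vecGen_tmul]
    simp [hu.hit_one hr, ite_tmul]
  | add v w hv hw => simp only [map_add, LinearMap.add_apply, hv, hw, tmul_add]
  | smul c v hv => simp only [map_smul, LinearMap.smul_apply, hv, tmul_smul]

theorem smash_crosses (hr : IsDualQuasitriangular r) (hV : IsVectorAlg R' x)
    (hu : IsVectorCoaction R R' r u) :
    Crosses r u (smashLeft k H V) (fun i => smashRight hr hV hu (x i)) := by
  intro i a
  refine LinearMap.ext fun z => ?_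
  induction z with
  | zero => simp
  | add x y hx hy => simp only [map_add, hx, hy]
  | tmul b v =>
    simp only [Module.End.mul_apply, smashLeft_tmul, smashRight_vecGen_tmul, hu.hit_mul hr,
      LinearMap.sum_apply, map_sum, sum_tmul]
    rw [Finset.sum_comm]

/-- The operators `a v` on `H ⊗ V`. -/
def smashMap (hr : IsDualQuasitriangular r) (hV : IsVectorAlg R' x) (hu : IsVectorCoaction R R' r u)
    :
    H ⊗[k] V →ₗ[k] Module.End k (H ⊗[k] V) :=
  LinearMap.mul' k _ ∘ₗ
    TensorProduct.map (smashLeft k H V).toLinearMap (smashRight hr hV hu).toLinearMap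

theorem smashMap_tmul (hr : IsDualQuasitriangular r) (hV : IsVectorAlg R' x)
    (hu : IsVectorCoaction R R' r u)
    (a : H) (v : V) :
    smashMap hr hV hu (a ⊗ₜ v) = smashLeft k H V a * smashRight hr hV hu v := by
  simp [smashMap]

/-- An operator in the range is recovered from its value at `1 ⊗ 1`, so `smashMap` is injective. -/
theorem smashMap_apply_one (hr : IsDualQuasitriangular r) (hV : IsVectorAlg R' x)
    (hu : IsVectorCoaction R R' r u)
    (z : H ⊗[k] V) : smashMap hr hV hu z (1 ⊗ₜ 1) = z := by
  induction z with
  | zero => simp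
  | add x y hx hy => simp only [map_add, LinearMap.add_apply, hx, hy]
  | tmul a v => simp [smashMap_tmul, smashRight_one_tmul]

theorem smashMap_right (hr : IsDualQuasitriangular r) (hV : IsVectorAlg R' x)
    (hu : IsVectorCoaction R R' r u)
    (v : V) (z : H ⊗[k] V) :
    smashMap hr hV hu (smashRight hr hV hu v z) = smashRight hr hV hu v * smashMap hr hV hu z := by
  induction v using hV.induction generalizing z with
  | one => simp
  | gen_mul i v hv =>
    rw [map_mul, Module.End.mul_apply, mul_assoc, ← hv]
    generalize smashRight hr hV hu v z = y
    induction y with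
    | zero => simp
    | add x y hx hy => simp only [map_add, mul_add, hx, hy]
    | tmul a w =>
      rw [smashMap_tmul, ← mul_assoc, smash_crosses hr hV hu i a, smashRight_vecGen_tmul,
        Finset.sum_mul, map_sum]
      simp only [smashMap_tmul, map_mul, mul_assoc]
  | add v w hv hw => simp only [map_add, LinearMap.add_apply, add_mul, hv, hw]
  | smul c v hv => simp only [map_smul, LinearMap.smul_apply, smul_mul_assoc, hv]

/-- The range is closed under composition, and the product it induces on `H ⊗ V` is `y · z =
smashMap y z`. Associativity comes for free from operators. -/
theorem smashMap_mul (hr : IsDualQuasitriangular r) (hV : IsVectorAlg R' x)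
    (hu : IsVectorCoaction R R' r u)
    (y z : H ⊗[k] V) :
    smashMap hr hV hu y * smashMap hr hV hu z = smashMap hr hV hu (smashMap hr hV hu y z) := by
  induction y with
  | zero => simp
  | add x y hx hy => simp only [map_add, LinearMap.add_apply, add_mul, hx, hy]
  | tmul a v =>
    rw [smashMap_tmul, mul_assoc, ← smashMap_right, Module.End.mul_apply]
    generalize smashRight hr hV hu v z = y
    induction y with
    | zero => simp
    | add x y hx hy => simp only [map_add, mul_add, hx, hy]
    | tmul b w => simp [smashMap_tmul, mul_assoc]

/-- The smash product of `H` and `V`, as an algebra of operators on `H ⊗ V`. -/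
def smashAlg (hr : IsDualQuasitriangular r) (hV : IsVectorAlg R' x) (hu : IsVectorCoaction R R' r u)
    :
    Subalgebra k (Module.End k (H ⊗[k] V)) :=
  (LinearMap.range (smashMap hr hV hu)).toSubalgebra ⟨1 ⊗ₜ 1, by simp [smashMap_tmul]⟩ (by
    rintro _ _ ⟨y, rfl⟩ ⟨z, rfl⟩
    exact ⟨_, (smashMap_mul hr hV hu y z).symm⟩)

/-- `E` is the smash product of `H` and `V` with respect to `g` and `f`. -/
structure IsSmash {E : Type*} [Ring E] [Algebra k E] (r : H →ₗ[k] H →ₗ[k] k)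
    (u : Fin n → Fin n → H) (x : Fin n → V) (g : H →ₐ[k] E) (f : V →ₐ[k] E) : Prop where
  crosses : Crosses r u g (fun i => f (x i))
  bijective : Function.Bijective (LinearMap.mul' k E ∘ₗ
    TensorProduct.map g.toLinearMap f.toLinearMap)

theorem exists_isSmash (hr : IsDualQuasitriangular r) (hV : IsVectorAlg R' x)
    (hu : IsVectorCoaction R R' r u) :
    ∃ (E : Type (max v w)) (_ : Ring E) (_ : Algebra k E) (g : H →ₐ[k] E)
      (f : V →ₐ[k] E), IsSmash r u x g f := by
  have hg : ∀ a, smashLeft k H V a ∈ smashAlg hr hV hu := fun a =>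
    ⟨a ⊗ₜ 1, by simp [smashMap_tmul]⟩
  have hf : ∀ v, smashRight hr hV hu v ∈ smashAlg hr hV hu := fun v =>
    ⟨1 ⊗ₜ v, by simp [smashMap_tmul]⟩
  refine ⟨smashAlg hr hV hu, inferInstance, inferInstance, (smashLeft k H V).codRestrict _ hg,
    (smashRight hr hV hu).codRestrict _ hf, ?_, ?_⟩
  · intro i a
    apply Subtype.ext
    refine (smash_crosses hr hV hu i a).trans ?_
    rw [AddSubmonoidClass.coe_finsetSum]
    rfl
  · have e : ∀ z, ((LinearMap.mul' k (smashAlg hr hV hu) ∘ₗ TensorProduct.map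
        ((smashLeft k H V).codRestrict (smashAlg hr hV hu) hg).toLinearMap
        ((smashRight hr hV hu).codRestrict (smashAlg hr hV hu) hf).toLinearMap) z :
          Module.End k (H ⊗[k] V)) = smashMap hr hV hu z := by
      intro z
      induction z with
      | zero => simp
      | add x y hx hy =>
        rw [map_add, map_add, ← hx, ← hy]
        rfl
      | tmul a v =>
        rw [smashMap_tmul]
        rfl
    constructor
    · intro y z h
      have h' := congrArg Subtype.val h
      rw [e, e] at h'
      rw [← smashMap_apply_one hr hV hu y, h', smashMap_apply_one]
    · rintro ⟨_, z, rfl⟩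
      exact ⟨z, Subtype.ext (e z)⟩

end Smash

/-! ### Universal property of the smash product -/

section SmashLift

variable {k : Type u} [Field k] {n : ℕ} {R' : Mat2 k n} {H : Type v} [Ring H] [HopfAlgebra k H]
  {r : H →ₗ[k] H →ₗ[k] k} {u : Fin n → Fin n → H} {V : Type w} [Ring V] [Algebra k V]
      {x : Fin n → V} {E : Type*} [Ring E] [Algebra k E]
  {g : H →ₐ[k] E} {f : V →ₐ[k] E} {B : Type*} [Ring B] [Algebra k B]

theorem IsSmash.induction (h : IsSmash r u x g f) {P : E → Prop} (e : E)
    (mul : ∀ a v, P (g a * f v)) (add : ∀ x y, P x → P y → P (x + y)) : P e := by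
  obtain ⟨z, rfl⟩ := h.bijective.2 e
  induction z with
  | zero => simpa using mul 0 0
  | add x y hx hy => rw [map_add]; exact add _ _ hx hy
  | tmul a v => exact mul a v

theorem IsSmash.hom_ext (h : IsSmash r u x g f) (hV : IsVectorAlg R' x) {F G : E →ₐ[k] B}
    (hg : ∀ a, F (g a) = G (g a)) (hf : ∀ i, F (f (x i)) = G (f (x i))) :
    F = G := by
  have hv : F.comp f = G.comp f := hV.hom_ext hf
  ext e
  induction e using h.induction with
  | mul a v =>
    rw [map_mul, map_mul, hg]
    exact congrArg _ (DFunLike.congr_fun hv v)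
  | add x y hx hy => rw [map_add, map_add, hx, hy]

/-- The linear equivalence `a ⊗ v ↦ a v`. -/
def IsSmash.equiv (h : IsSmash r u x g f) : H ⊗[k] V ≃ₗ[k] E :=
  LinearEquiv.ofBijective _ h.bijective

theorem IsSmash.equiv_tmul (h : IsSmash r u x g f) (a : H) (v : V) :
    h.equiv (a ⊗ₜ v) = g a * f v := rfl

@[simp]
theorem IsSmash.equiv_symm_mul (h : IsSmash r u x g f) (a : H) (v : V) :
    h.equiv.symm (g a * f v) = a ⊗ₜ v := by
  rw [← h.equiv_tmul, LinearEquiv.symm_apply_apply]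

variable {g' : H →ₐ[k] B} {f' : V →ₐ[k] B}

/-- The linear map underlying `IsSmash.lift`. -/
def IsSmash.liftLin (h : IsSmash r u x g f) (g' : H →ₐ[k] B) (f' : V →ₐ[k] B) :
    E →ₗ[k] B :=
  LinearMap.mul' k B ∘ₗ TensorProduct.map g'.toLinearMap f'.toLinearMap ∘ₗ
    h.equiv.symm.toLinearMap

theorem IsSmash.liftLin_mul (h : IsSmash r u x g f) (a : H) (v : V) :
    h.liftLin g' f' (g a * f v) = g' a * f' v := by
  simp [IsSmash.liftLin]

theorem IsSmash.liftLin_left (h : IsSmash r u x g f) (a : H) (e : E) :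
    h.liftLin g' f' (g a * e) = g' a * h.liftLin g' f' e := by
  induction e using h.induction with
  | mul b v => rw [← mul_assoc, ← map_mul, h.liftLin_mul, h.liftLin_mul, map_mul, mul_assoc]
  | add x y hx hy => rw [mul_add, map_add, map_add, mul_add, hx, hy]

/-- The same cross relation holds in `E` and in `B`, so a generator moves past elements of `H`
identically on both sides. Together with `liftLin_left` this gives multiplicativity. -/
theorem IsSmash.liftLin_right (h : IsSmash r u x g f) (hV : IsVectorAlg R' x)
    (h' : Crosses r u g' (fun i => f' (x i))) (v : V) (e : E) :
    h.liftLin g' f' (f v * e) = f' v * h.liftLin g' f' e := by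
  induction v using hV.induction generalizing e with
  | one => simp
  | gen_mul i v hv =>
    rw [map_mul f, mul_assoc, map_mul f', mul_assoc, ← hv]
    generalize f v * e = e
    induction e using h.induction with
    | mul b v =>
      have e1 := h.crosses i b
      have e2 := h' i b
      simp only at e1 e2
      rw [← mul_assoc, e1, h.liftLin_mul, ← mul_assoc, e2, Finset.sum_mul, map_sum, Finset.sum_mul]
      simp only [mul_assoc, ← map_mul f, h.liftLin_mul, map_mul f']
    | add x y hx hy => rw [mul_add, map_add, map_add, mul_add, hx, hy]
  | add v w hv hw => rw [map_add, map_add, add_mul, add_mul, map_add, hv, hw]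
  | smul c v hv => rw [map_smul, map_smul, smul_mul_assoc, smul_mul_assoc, map_smul, hv]

/-- The universal property of the smash product. -/
def IsSmash.lift (h : IsSmash r u x g f) (hV : IsVectorAlg R' x) (g' : H →ₐ[k] B) (f' : V →ₐ[k] B)
    (h' : Crosses r u g' (fun i => f' (x i))) : E →ₐ[k] B :=
  AlgHom.ofLinearMap (h.liftLin g' f') (by simpa using h.liftLin_mul (g' := g') (f' := f') 1 1) (by
    intro x y
    induction x using h.induction with
    | mul a v => rw [mul_assoc, h.liftLin_left, h.liftLin_right hV h', h.liftLin_mul, mul_assoc]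
    | add x y hx hy => rw [add_mul, map_add, map_add, add_mul, hx, hy])

@[simp]
theorem IsSmash.lift_left (h : IsSmash r u x g f) (hV : IsVectorAlg R' x)
    (h' : Crosses r u g' (fun i => f' (x i))) (a : H) : h.lift hV g' f' h' (g a) = g' a := by
  change h.liftLin g' f' (g a) = _
  simpa using h.liftLin_mul (g' := g') (f' := f') a 1

@[simp]
theorem IsSmash.lift_right (h : IsSmash r u x g f) (hV : IsVectorAlg R' x)
    (h' : Crosses r u g' (fun i => f' (x i))) (v : V) :
    h.lift hV g' f' h' (f v) = f' v := by
  change h.liftLin g' f' (f v) = _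
  simpa using h.liftLin_mul (g' := g') (f' := f') 1 v

end SmashLift

/-! ### Coproduct, counit and antipode of the smash product -/

section SmashHopf

open Coalgebra HopfAlgebra

variable {k : Type u} [Field k] {n : ℕ} {R R' : Mat2 k n} {H : Type v} [Ring H] [HopfAlgebra k H]
  {r : H →ₗ[k] H →ₗ[k] k} {u : Fin n → Fin n → H} {V : Type w} [Ring V] [Algebra k V]
  {x : Fin n → V} {E : Type*} [Ring E] [Algebra k E] {g : H →ₐ[k] E} {f : V →ₐ[k] E}

theorem IsVectorAlg.map_rel {B : Type*} [Ring B] [Algebra k B] (hV : IsVectorAlg R' x)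
    (f : V →ₐ[k] B) (i j : Fin n) :
    f (x i) * f (x j) = ∑ a, ∑ b, R' (i, j) (a, b) • (f (x b) * f (x a)) := by
  rw [← map_mul, hV.rel]
  simp

theorem IsVectorCoaction.map_rel {B : Type*} [Ring B] [Algebra k B]
    (hu : IsVectorCoaction R R' r u) (g : H →ₐ[k] B) (i j q p : Fin n) :
    ∑ c, ∑ d, R' (i, j) (c, d) • (g (u d q) * g (u c p)) =
      ∑ c, ∑ d, R' (c, d) (p, q) • (g (u i c) * g (u j d)) := by
  have := congrArg g (hu.rel i j q p)
  simpa only [map_sum, map_smul, map_mul] using this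

theorem IsCorep.hit_apply_coeff {ι : Type*} [Fintype ι] [DecidableEq ι] {U : ι → ι → H}
    (hU : IsCorep k U) (φ : H →ₗ[k] k) (i j : ι) : hit φ (U i j) = ∑ c, φ (U i c) • U c j := by
  simp [BraidedVectors.hit_apply, hU.comul_eq]

theorem IsCorep.hitLeft_apply_coeff {ι : Type*} [Fintype ι] [DecidableEq ι] {U : ι → ι → H}
    (hU : IsCorep k U) (φ : H →ₗ[k] k) (i j : ι) :
    hitLeft φ (U i j) = ∑ c, φ (U c j) • U i c := by
  simp [BraidedVectors.hitLeft_apply, hU.comul_eq]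

/-- The coproduct of the generators of `V(R')` in the bosonization. -/
def genComul (u : Fin n → Fin n → H) (x : Fin n → V) (g : H →ₐ[k] E) (f : V →ₐ[k] E) (i : Fin n) :
    E ⊗[k] E :=
  ∑ j, f (x j) ⊗ₜ g (u i j) + 1 ⊗ₜ f (x i)

/-- Put `Pᵢ = ∑ x^a ⊗ u i a` and `Qᵢ = 1 ⊗ x^i`. The products `P P` and `Q Q` satisfy the relations
separately, and `Pᵢ Qⱼ + Qᵢ Pⱼ` satisfies them by `sum_hecke`. -/
theorem genComul_rel (hR : IsBraidedVectorDatum R R') (hV : IsVectorAlg R' x)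
    (hu : IsVectorCoaction R R' r u) (h : Crosses r u g (fun i => f (x i))) (i j : Fin n) :
    genComul u x g f i * genComul u x g f j =
      ∑ a, ∑ b, R' (i, j) (a, b) • (genComul u x g f b * genComul u x g f a) := by
  let inl : E →ₐ[k] E ⊗[k] E := Algebra.TensorProduct.includeLeft
  let inr : E →ₐ[k] E ⊗[k] E := Algebra.TensorProduct.includeRight
  have hP := vecRel_twist (R' := R') (fun a => (inl.comp f) (x a))
    (fun a b => (inr.comp g) (u a b))
    (fun a b c => by simp [inl, inr, Commute, SemiconjBy])
    (hV.map_rel (inl.comp f)) (hu.map_rel (inr.comp g))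
  have hQ := hV.map_rel (inr.comp f)
  simp only [inl, inr, AlgHom.comp_apply, Algebra.TensorProduct.includeLeft_apply,
    Algebra.TensorProduct.includeRight_apply, Algebra.TensorProduct.tmul_mul_tmul, one_mul,
    mul_one] at hP hQ
  -- The mixed family: `Pᵢ Qⱼ` is `z i j`, and the cross relation together with `r(u, u) = R`
  -- expresses `Qᵢ Pⱼ` as `RP` applied to `z`.
  let z : Fin n → Fin n → E ⊗[k] E := fun i j => ∑ a, f (x a) ⊗ₜ (g (u i a) * f (x j))
  have hPQ : ∀ i j, (∑ a, f (x a) ⊗ₜ[k] g (u i a)) * (1 ⊗ₜ[k] f (x j)) = z i j := fun i j => by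
    simp [z, Finset.sum_mul]
  have hQP : ∀ i j, (1 ⊗ₜ[k] f (x i)) * (∑ a, f (x a) ⊗ₜ[k] g (u j a)) =
      ∑ d, ∑ c, R (i, j) (d, c) • z c d := fun i j => by
    have e : ∀ a, (1 ⊗ₜ[k] f (x i)) * (f (x a) ⊗ₜ[k] g (u j a)) =
        ∑ d, ∑ c, R (i, j) (d, c) • (f (x a) ⊗ₜ[k] (g (u c a) * f (x d))) := fun a => by
      have := h i (u j a)
      simp only at this
      simp [this, hu.hit_apply_coeff, hu.form_eq, tmul_sum, Finset.sum_mul]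
    simp only [z, Finset.mul_sum, e, Finset.smul_sum]
    rw [Finset.sum_comm]
    exact Finset.sum_congr rfl fun d _ => Finset.sum_comm
  have key : ∀ i j, genComul u x g f i * genComul u x g f j =
      (∑ a, f (x a) ⊗ₜ[k] g (u i a)) * (∑ a, f (x a) ⊗ₜ[k] g (u j a)) +
        (z i j + ∑ d, ∑ c, R (i, j) (d, c) • z c d) + 1 ⊗ₜ[k] (f (x i) * f (x j)) := fun i j => by
    rw [genComul, genComul, add_mul, mul_add, mul_add, hPQ, hQP,
      Algebra.TensorProduct.tmul_mul_tmul, one_mul]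
    abel
  simp only [key, smul_add _ (_ + _), smul_add (_ : k) (_ * _), Finset.sum_add_distrib (g := _)]
  rw [hP, hQ, hR.sum_hecke z i j]

/-- Moving `x^j` past `a₁` in `∑ x^j a₁ ⊗ u i j a₂` puts the functional between the two legs.
Coassociativity shifts it to the left of the second leg, and quasi-commutativity then moves the
matrix entry across. -/
theorem genComul_crosses (hr : IsDualQuasitriangular r) (hu : IsVectorCoaction R R' r u)
    (h : Crosses r u g (fun i => f (x i))) :
    Crosses r u ((Algebra.TensorProduct.map g g).comp (Bialgebra.comulAlgHom k H))
      (genComul u x g f) := by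
  intro i a
  have h1 : ∀ z : H ⊗[k] H, (∑ j, f (x j) ⊗ₜ[k] g (u i j)) * Algebra.TensorProduct.map g g z =
      ∑ m, Algebra.TensorProduct.map g g
        (∑ j, (1 ⊗ₜ u i j) * LinearMap.rTensor H (hit (r (u j m))) z) * (f (x m) ⊗ₜ 1) := by
    intro z
    induction z with
    | zero => simp
    | add y z hy hz => simp only [map_add, mul_add, add_mul, Finset.sum_add_distrib, hy, hz]
    | tmul y z =>
      have e : ∀ j, f (x j) * g y = ∑ m, g (hit (r (u j m)) y) * f (x m) := fun j => h j y
      simp [Finset.sum_mul, e, sum_tmul]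
      exact Finset.sum_comm
  have h2 : ∀ z : H ⊗[k] H, (1 ⊗ₜ[k] f (x i)) * Algebra.TensorProduct.map g g z =
      ∑ j, Algebra.TensorProduct.map g g (LinearMap.lTensor H (hit (r (u i j))) z) *
        (1 ⊗ₜ f (x j)) := by
    intro z
    induction z with
    | zero => simp
    | add y z hy hz => simp only [map_add, mul_add, add_mul, Finset.sum_add_distrib, hy, hz]
    | tmul y z =>
      have e : f (x i) * g z = ∑ m, g (hit (r (u i m)) z) * f (x m) := h i z
      simp [e, tmul_sum]
  have h3 : ∀ m, ∀ z : H ⊗[k] H, ∑ j, (1 ⊗ₜ u i j) * LinearMap.lTensor H (hitLeft (r (u j m))) z =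
      ∑ j, LinearMap.lTensor H (hit (r (u i j))) z * (1 ⊗ₜ u j m) := by
    intro m z
    induction z with
    | zero => simp
    | add y z hy hz => simp only [map_add, mul_add, add_mul, Finset.sum_add_distrib, hy, hz]
    | tmul y z =>
      simp only [LinearMap.lTensor_tmul, Algebra.TensorProduct.tmul_mul_tmul, one_mul, mul_one,
        ← tmul_sum, hu.quasi_comm hr]
  simp only [AlgHom.comp_apply, Bialgebra.comulAlgHom_apply]
  rw [genComul, add_mul, h1, h2]
  simp only [rTensor_hit_comul, h3, ← comul_hit, genComul, mul_add, Finset.sum_add_distrib]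
  congr 1
  simp only [map_sum, map_mul, Finset.sum_mul, Finset.mul_sum, mul_assoc]
  rw [Finset.sum_comm]
  simp

/-- The antipode of the generators of `V(R')` in the bosonization. -/
def genAntipode (u : Fin n → Fin n → H) (x : Fin n → V) (g : H →ₐ[k] E) (f : V →ₐ[k] E)
    (i : Fin n) : E :=
  -∑ m, f (x m) * g (antipode k (u i m))

/-- This is the cross relation read in the opposite algebra. `antipode_mul` carries `x^m` to the
left, leaving the antipode of the two sides of the quasi-commutativity identity. -/
theorem genAntipode_crosses (hr : IsDualQuasitriangular r) (hu : IsVectorCoaction R R' r u)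
    (h : Crosses r u g (fun i => f (x i))) (i : Fin n) (a : H) :
    g (antipode k a) * genAntipode u x g f i =
      ∑ j, genAntipode u x g f j * g (antipode k (hit (r (u i j)) a)) := by
  have h1 : ∀ m, g (antipode k a) * f (x m) =
    ∑ j, f (x j) * g (antipode k (hitLeft (r (u m j)) a)) := fun m => h.antipode_mul m a
  simp only [genAntipode, mul_neg, neg_mul, Finset.sum_neg_distrib, neg_inj, Finset.mul_sum,
    Finset.sum_mul, ← mul_assoc, h1]
  simp only [mul_assoc, ← map_mul, ← antipode_mul_antidistrib]
  rw [Finset.sum_comm]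
  conv_rhs => rw [Finset.sum_comm]
  refine Finset.sum_congr rfl fun j _ => ?_
  rw [← Finset.mul_sum, ← Finset.mul_sum, ← map_sum, ← map_sum, ← map_sum, ← map_sum,
    hu.quasi_comm hr]

/-- Moving the inner `S(u j b)` past `x^a` evaluates `r` on two entries of `u`, which is where `R`
appears. -/
theorem genAntipode_mul (hu : IsVectorCoaction R R' r u)
    (h : Crosses r u g (fun i => f (x i))) (i j : Fin n) :
    genAntipode u x g f j * genAntipode u x g f i =
      ∑ a, ∑ c, (∑ d, ∑ b, R (a, c) (d, b) • (f (x b) * f (x d))) *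
        g (antipode k (u i a * u j c)) := by
  have e : ∀ a b, g (antipode k (u j b)) * f (x a) =
      ∑ d, ∑ c, R (a, c) (d, b) • (f (x d) * g (antipode k (u j c))) := fun a b => by
    rw [h.antipode_mul a (u j b)]
    simp [hu.hitLeft_apply_coeff, hu.form_eq, Finset.mul_sum]
  have e' : ∀ a b, f (x b) * g (antipode k (u j b)) * (f (x a) * g (antipode k (u i a))) =
      ∑ d, ∑ c, R (a, c) (d, b) • (f (x b) * f (x d)) * g (antipode k (u i a * u j c)) :=
    fun a b => by
    rw [mul_assoc, ← mul_assoc (g _), e]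
    simp [Finset.mul_sum, Finset.sum_mul, mul_assoc, antipode_mul_antidistrib]
  rw [genAntipode, genAntipode, neg_mul_neg, Finset.sum_mul_sum, Finset.sum_comm]
  simp only [e', Finset.sum_mul]
  refine Finset.sum_congr rfl fun a _ => ?_
  rw [Finset.sum_comm]
  conv_rhs => rw [Finset.sum_comm]
  refine Finset.sum_congr rfl fun d _ => Finset.sum_comm

/-- The factors are reversed because `S` is antimultiplicative. The relation of `u` shifts `R'` onto
the family `∑ R x x`, which is fixed by `R'P` according to `sum_exchange`. -/
theorem genAntipode_rel (hR : IsBraidedVectorDatum R R') (hV : IsVectorAlg R' x)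
    (hu : IsVectorCoaction R R' r u) (h : Crosses r u g (fun i => f (x i))) (i j : Fin n) :
    genAntipode u x g f j * genAntipode u x g f i =
      ∑ a, ∑ b, R' (i, j) (a, b) • (genAntipode u x g f a * genAntipode u x g f b) := by
  have hy := hR.sum_exchange (fun i j => f (x i) * f (x j)) (hV.map_rel f)
  simp only [genAntipode_mul hu h]
  set y : Fin n → Fin n → E := fun a c => ∑ d, ∑ b, R (a, c) (d, b) • (f (x b) * f (x d))
  change ∀ i j, y i j = ∑ a, ∑ b, R' (i, j) (a, b) • y b a at hy
  change ∑ a, ∑ c, y a c * g (antipode k (u i a * u j c)) =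
    ∑ a, ∑ b, R' (i, j) (a, b) • ∑ p, ∑ q, y p q * g (antipode k (u b p * u a q))
  have l : ∑ a, ∑ b, R' (i, j) (a, b) • ∑ p, ∑ q, y p q * g (antipode k (u b p * u a q)) =
      ∑ p, ∑ q, y p q * g (antipode k (∑ a, ∑ b, R' (i, j) (a, b) • (u b p * u a q))) := by
    simp only [Finset.smul_sum, map_sum, Finset.mul_sum, map_smul, mul_smul_comm]
    exact sum_sum_comm _
  rw [l]
  simp only [hu.rel, map_sum, map_smul, Finset.mul_sum, mul_smul_comm]
  rw [sum_sum_comm]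
  refine Finset.sum_congr rfl fun c _ => Finset.sum_congr rfl fun d _ => ?_
  rw [hy c d, Finset.sum_comm]
  simp only [Finset.sum_mul, smul_mul_assoc]

variable (h : IsSmash r u x g f) (hR : IsBraidedVectorDatum R R') (hV : IsVectorAlg R' x)
  (hr : IsDualQuasitriangular r) (hu : IsVectorCoaction R R' r u)

/-- The coproduct of the bosonization. -/
def IsSmash.comulHom : E →ₐ[k] E ⊗[k] E :=
  h.lift hV ((Algebra.TensorProduct.map g g).comp (Bialgebra.comulAlgHom k H))
    (hV.lift (genComul u x g f) (genComul_rel hR hV hu h.crosses))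
    (by simpa using genComul_crosses hr hu h.crosses)

/-- The counit of the bosonization. -/
def IsSmash.counitHom : E →ₐ[k] k :=
  h.lift hV (Bialgebra.counitAlgHom k H) (hV.lift (fun _ => 0) (by simp)) (by
    intro i a
    simp)

/-- The antipode of the bosonization, as a homomorphism to the opposite algebra. -/
def IsSmash.antipodeHom : E →ₐ[k] Eᵐᵒᵖ :=
  h.lift hV ((AlgHom.op g).comp (antipodeAlgHomOp k H))
    (hV.lift (fun i => MulOpposite.op (genAntipode u x g f i)) (by
      intro i j
      rw [← MulOpposite.op_mul, genAntipode_rel hR hV hu h.crosses]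
      simp)) (by
    intro i a
    apply MulOpposite.unop_injective
    simpa using genAntipode_crosses hr hu h.crosses i a)

theorem IsSmash.comul_left (a : H) : h.comulHom hR hV hr hu (g a) =
    Algebra.TensorProduct.map g g (Coalgebra.comul a) := by
  simp [IsSmash.comulHom]

theorem IsSmash.comul_gen (i : Fin n) : h.comulHom hR hV hr hu (f (x i)) = genComul u x g f i := by
  simp [IsSmash.comulHom]

theorem IsSmash.counit_left (a : H) : h.counitHom hV (g a) = Coalgebra.counit a := by
  exact h.lift_left hV _ a

theorem IsSmash.counit_gen (i : Fin n) : h.counitHom hV (f (x i)) = 0 := by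
  exact (h.lift_right hV _ (x i)).trans (hV.lift_gen _ _ i)

theorem IsSmash.antipode_left (a : H) : h.antipodeHom hR hV hr hu (g a) =
    MulOpposite.op (g (HopfAlgebra.antipode k a)) := by
  exact h.lift_left hV _ a

theorem IsSmash.antipode_gen (i : Fin n) : h.antipodeHom hR hV hr hu (f (x i)) =
    MulOpposite.op (genAntipode u x g f i) := by
  exact (h.lift_right hV _ (x i)).trans (hV.lift_gen _ _ i)

end SmashHopf

/-! ### The Hopf algebra axioms, reduced to generators -/

section HopfStructure

open Coalgebra HopfAlgebra

variable {k : Type u} [Field k] {n : ℕ} {R R' : Mat2 k n} {H : Type v} [Ring H] [HopfAlgebra k H]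
  {r : H →ₗ[k] H →ₗ[k] k} {u : Fin n → Fin n → H} {V : Type w} [Ring V] [Algebra k V]
  {x : Fin n → V}

/-- The properties of the bosonization of `V(R')` in terms of the generators. -/
structure IsGenBosonization {E : Type*} [Ring E] [HopfAlgebra k E] (r : H →ₗ[k] H →ₗ[k] k)
    (u : Fin n → Fin n → H) (x : Fin n → V) (g : H →ₐ[k] E) (f : V →ₐ[k] E) : Prop
    extends IsSmash r u x g f where
  comul_left : ∀ a, comul (R := k) (g a) = Algebra.TensorProduct.map g g (comul a)
  comul_gen : ∀ i, comul (R := k) (f (x i)) = genComul u x g f i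
  counit_left : ∀ a, counit (R := k) (g a) = counit (R := k) a
  counit_gen : ∀ i, counit (R := k) (f (x i)) = 0
  antipode_left : ∀ a, antipode k (g a) = g (antipode k a)
  antipode_gen : ∀ i, antipode k (f (x i)) = genAntipode u x g f i

section Bialgebra

variable {E : Type*} [Ring E] [Algebra k E] {g : H →ₐ[k] E} {f : V →ₐ[k] E}
  (h : IsSmash r u x g f) (hR : IsBraidedVectorDatum R R') (hV : IsVectorAlg R' x)
  (hr : IsDualQuasitriangular r) (hu : IsVectorCoaction R R' r u)

theorem IsSmash.coassoc : (Algebra.TensorProduct.assoc k k k E E E).toAlgHom.comp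
      ((Algebra.TensorProduct.map (h.comulHom hR hV hr hu) (.id k E)).comp (h.comulHom hR hV hr hu))
          =
    (Algebra.TensorProduct.map (.id k E) (h.comulHom hR hV hr hu)).comp (h.comulHom hR hV hr hu) :=
        by
  refine h.hom_ext hV (fun a => ?_) fun i => ?_
  · simp only [AlgHom.comp_apply, h.comul_left hR hV hr hu]
    have e1 : ∀ z : H ⊗[k] H, (Algebra.TensorProduct.assoc k k k E E E).toAlgHom
        (Algebra.TensorProduct.map (h.comulHom hR hV hr hu) (.id k E)
          (Algebra.TensorProduct.map g g z)) = Algebra.TensorProduct.map g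
            (Algebra.TensorProduct.map g g) (TensorProduct.assoc k H H H
              (LinearMap.rTensor H Coalgebra.comul z)) := by
      intro z
      induction z with
      | zero => simp
      | add y z hy hz => simp only [map_add, hy, hz]
      | tmul y z =>
        simp only [Algebra.TensorProduct.map_tmul, h.comul_left hR hV hr hu,
          LinearMap.rTensor_tmul]
        induction Coalgebra.comul (R := k) y with
        | zero => simp
        | add y z hy hz => simp only [add_tmul, map_add, hy, hz]
        | tmul y z => rfl
    have e2 : ∀ z : H ⊗[k] H, Algebra.TensorProduct.map (.id k E) (h.comulHom hR hV hr hu)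
          (Algebra.TensorProduct.map g g z) = Algebra.TensorProduct.map g
            (Algebra.TensorProduct.map g g) (LinearMap.lTensor H Coalgebra.comul z) := by
      intro z
      induction z with
      | zero => simp
      | add y z hy hz => simp only [map_add, hy, hz]
      | tmul y z => simp [h.comul_left hR hV hr hu]
    rw [e1, e2, coassoc_apply]
  · have hg : ∀ i j, h.comulHom hR hV hr hu (g (u i j)) = ∑ a, g (u a j) ⊗ₜ[k] g (u i a) := by
      intro i j
      simp [h.comul_left hR hV hr hu, hu.comul_eq]
    simp only [AlgHom.comp_apply, h.comul_gen hR hV hr hu]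
    simp only [genComul, map_add, map_sum, Algebra.TensorProduct.map_tmul, AlgHom.id_apply, hg,
      h.comul_gen hR hV hr hu, map_one, add_tmul, sum_tmul, tmul_add, tmul_sum,
      Finset.sum_add_distrib, Algebra.TensorProduct.one_def]
    rw [Finset.sum_comm, ← add_assoc]
    rfl

theorem IsSmash.rTensor_counit_comul :
    (Algebra.TensorProduct.map (h.counitHom hV) (.id k E)).comp (h.comulHom hR hV hr hu) =
      (Algebra.TensorProduct.lid k E).symm := by
  refine h.hom_ext hV (fun a => ?_) fun i => ?_
  · have e : ∀ z : H ⊗[k] H, Algebra.TensorProduct.map (h.counitHom hV) (.id k E)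
          (Algebra.TensorProduct.map g g z) = LinearMap.lTensor k g.toLinearMap
            (LinearMap.rTensor H Coalgebra.counit z) := by
      intro z
      induction z with
      | zero => simp
      | add y z hy hz => simp only [map_add, hy, hz]
      | tmul y z => simp [h.counit_left]
    rw [AlgHom.comp_apply, h.comul_left, e]
    simp
  · rw [AlgHom.comp_apply, h.comul_gen]
    simp [genComul, h.counit_gen]

theorem IsSmash.lTensor_counit_comul (hu : IsVectorCoaction R R' r u) :
    (Algebra.TensorProduct.map (.id k E) (h.counitHom hV)).comp (h.comulHom hR hV hr hu) =
      (Algebra.TensorProduct.rid k k E).symm := by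
  refine h.hom_ext hV (fun a => ?_) fun i => ?_
  · have e : ∀ z : H ⊗[k] H, Algebra.TensorProduct.map (.id k E) (h.counitHom hV)
          (Algebra.TensorProduct.map g g z) = LinearMap.rTensor k g.toLinearMap
            (LinearMap.lTensor H Coalgebra.counit z) := by
      intro z
      induction z with
      | zero => simp
      | add y z hy hz => simp only [map_add, hy, hz]
      | tmul y z => simp [h.counit_left]
    rw [AlgHom.comp_apply, h.comul_left, e]
    simp
  · rw [AlgHom.comp_apply, h.comul_gen]
    simp [genComul, h.counit_gen, h.counit_left, hu.counit_eq, tmul_ite]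

/-- The bialgebra structure of the bosonization. -/
abbrev IsSmash.bialgebra : Bialgebra k E :=
  Bialgebra.ofAlgHom (h.comulHom hR hV hr hu) (h.counitHom hV) (h.coassoc hR hV hr hu)
    (h.rTensor_counit_comul hR hV hr hu) (h.lTensor_counit_comul hR hV hr hu)

end Bialgebra

/-- An anti-homomorphism satisfies the left antipode axiom on a product if it does on the
factors. -/
theorem antipode_left_mul {E : Type*} [Ring E] [Bialgebra k E] (S : E →ₐ[k] Eᵐᵒᵖ)
    {S' : E →ₗ[k] E} (hS : ∀ e, S' e = (S e).unop) {a b : E}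
    (ha : LinearMap.mul' k E (LinearMap.rTensor E S' (comul a)) = algebraMap k E (counit a))
    (hb : LinearMap.mul' k E (LinearMap.rTensor E S' (comul b)) = algebraMap k E (counit b)) :
    LinearMap.mul' k E (LinearMap.rTensor E S' (comul (a * b))) =
      algebraMap k E (counit (a * b)) := by
  have e : ∀ y z : E ⊗[k] E, LinearMap.mul' k E (LinearMap.rTensor E S' y) =
      algebraMap k E (counit a) → LinearMap.mul' k E (LinearMap.rTensor E S' (y * z)) =
      (counit a : k) • LinearMap.mul' k E (LinearMap.rTensor E S' z) := by
    intro y z hy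
    induction z with
    | zero => simp
    | add z w hz hw => simp only [mul_add, map_add, smul_add, hz, hw]
    | tmul z w =>
      -- Antimultiplicativity of `S'` nests the contraction of `y` between the legs of `z ⊗ w`,
      -- where it becomes a scalar.
      have e' : LinearMap.mul' k E (LinearMap.rTensor E S' (y * (z ⊗ₜ w))) =
          S' z * LinearMap.mul' k E (LinearMap.rTensor E S' y) * w := by
        clear hy
        induction y with
        | zero => simp
        | add y y' hy hy' => simp only [add_mul, mul_add, map_add, hy, hy']
        | tmul y y' => simp [hS, mul_assoc]
      rw [e', hy, ← Algebra.commutes, ← Algebra.smul_def]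
      simp
  rw [Bialgebra.comul_mul, e _ _ ha, hb, Bialgebra.counit_mul, map_mul, Algebra.smul_def]

/-- An anti-homomorphism satisfies the right antipode axiom on a product if it does on the
factors. -/
theorem antipode_right_mul {E : Type*} [Ring E] [Bialgebra k E] (S : E →ₐ[k] Eᵐᵒᵖ)
    {S' : E →ₗ[k] E} (hS : ∀ e, S' e = (S e).unop) {a b : E}
    (ha : LinearMap.mul' k E (LinearMap.lTensor E S' (comul a)) = algebraMap k E (counit a))
    (hb : LinearMap.mul' k E (LinearMap.lTensor E S' (comul b)) = algebraMap k E (counit b)) :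
    LinearMap.mul' k E (LinearMap.lTensor E S' (comul (a * b))) =
      algebraMap k E (counit (a * b)) := by
  have e : ∀ y z : E ⊗[k] E, LinearMap.mul' k E (LinearMap.lTensor E S' z) =
      algebraMap k E (counit b) → LinearMap.mul' k E (LinearMap.lTensor E S' (y * z)) =
      (counit b : k) • LinearMap.mul' k E (LinearMap.lTensor E S' y) := by
    intro y z hz
    induction y with
    | zero => simp
    | add y w hy hw => simp only [add_mul, map_add, smul_add, hy, hw]
    | tmul y w =>
      have e' : LinearMap.mul' k E (LinearMap.lTensor E S' ((y ⊗ₜ w) * z)) =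
          y * LinearMap.mul' k E (LinearMap.lTensor E S' z) * S' w := by
        clear hz
        induction z with
        | zero => simp
        | add z z' hz hz' => simp only [add_mul, mul_add, map_add, hz, hz']
        | tmul z z' => simp [hS, mul_assoc]
      rw [e', hz, ← Algebra.commutes, mul_assoc, ← Algebra.smul_def]
      simp
  rw [Bialgebra.comul_mul, e _ _ hb, ha, Bialgebra.counit_mul, map_mul, Algebra.smul_def,
    Algebra.commutes]

theorem exists_isGenBosonization (hR : IsBraidedVectorDatum R R') (hV : IsVectorAlg R' x)
    (hr : IsDualQuasitriangular r) (hu : IsVectorCoaction R R' r u) :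
    ∃ (E : Type (max v w)) (_ : Ring E) (_ : HopfAlgebra k E) (g : H →ₐ[k] E) (f : V →ₐ[k] E),
      IsGenBosonization r u x g f := by
  obtain ⟨E, _, _, g, f, h⟩ := exists_isSmash hr hV hu
  let bialg : Bialgebra k E := h.bialgebra hR hV hr hu
  have comul_left : ∀ a, comul (R := k) (g a) = Algebra.TensorProduct.map g g (comul a) :=
    h.comul_left hR hV hr hu
  have comul_gen : ∀ i, comul (R := k) (f (x i)) = genComul u x g f i := h.comul_gen hR hV hr hu
  have counit_left : ∀ a, counit (R := k) (g a) = counit (R := k) a := h.counit_left hV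
  have counit_gen : ∀ i, counit (R := k) (f (x i)) = 0 := h.counit_gen hV
  let S := h.antipodeHom hR hV hr hu
  let S' : E →ₗ[k] E := (MulOpposite.opLinearEquiv k).symm.toLinearMap ∘ₗ S.toLinearMap
  have hS : ∀ e, S' e = (S e).unop := fun e => rfl
  have antipode_left : ∀ a, S' (g a) = g (antipode k a) := fun a =>
    congrArg MulOpposite.unop (h.antipode_left hR hV hr hu a)
  have antipode_gen : ∀ i, S' (f (x i)) = genAntipode u x g f i := fun i =>
    congrArg MulOpposite.unop (h.antipode_gen hR hV hr hu i)
  have S_one : S' 1 = 1 := by rw [hS, map_one, MulOpposite.unop_one]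
  have hl : ∀ e, LinearMap.mul' k E (LinearMap.rTensor E S' (comul e)) =
      algebraMap k E (counit e) := by
    intro e
    induction e using h.induction with
    | mul a v =>
      apply antipode_left_mul S hS
      · have e : ∀ z : H ⊗[k] H, LinearMap.mul' k E (LinearMap.rTensor E S'
            (Algebra.TensorProduct.map g g z)) =
            g (LinearMap.mul' k H (LinearMap.rTensor H (antipode k) z)) := by
          intro z
          induction z with
          | zero => simp
          | add y z hy hz => simp only [map_add, hy, hz]
          | tmul y z => simp [antipode_left]
        rw [comul_left, e, mul_antipode_rTensor_comul_apply, AlgHom.commutes, counit_left]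
      · induction v using hV.induction with
        | one => simp [Algebra.TensorProduct.one_def, S_one]
        | gen_mul i v hv =>
          rw [map_mul]
          apply antipode_left_mul S hS _ hv
          rw [comul_gen, counit_gen, genComul]
          simp only [map_add, map_sum, LinearMap.rTensor_tmul, LinearMap.mul'_apply, antipode_gen,
            S_one, one_mul, map_zero, genAntipode, neg_mul, Finset.sum_neg_distrib,
            Finset.sum_mul, mul_assoc, ← map_mul g]
          -- Summing over the coaction index first contracts `S(u) u` to a Kronecker delta; the
          -- remaining `-f (x i)` cancels the contribution of `1 ⊗ x i`.
          rw [Finset.sum_comm]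
          simp only [← Finset.mul_sum, ← map_sum, hu.sum_antipode_mul]
          simp [apply_ite]
        | add v w hv hw => simp only [map_add, hv, hw]
        | smul c v hv =>
          simp only [map_smul, hv]
          rw [smul_eq_mul, map_mul, Algebra.smul_def]
    | add y z hy hz => simp only [map_add, hy, hz]
  have hrr : ∀ e, LinearMap.mul' k E (LinearMap.lTensor E S' (comul e)) =
      algebraMap k E (counit e) := by
    intro e
    induction e using h.induction with
    | mul a v =>
      apply antipode_right_mul S hS
      · have e : ∀ z : H ⊗[k] H, LinearMap.mul' k E (LinearMap.lTensor E S'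
            (Algebra.TensorProduct.map g g z)) =
            g (LinearMap.mul' k H (LinearMap.lTensor H (antipode k) z)) := by
          intro z
          induction z with
          | zero => simp
          | add y z hy hz => simp only [map_add, hy, hz]
          | tmul y z => simp [antipode_left]
        rw [comul_left, e, mul_antipode_lTensor_comul_apply, AlgHom.commutes, counit_left]
      · induction v using hV.induction with
        | one => simp [Algebra.TensorProduct.one_def, S_one]
        | gen_mul i v hv =>
          rw [map_mul]
          apply antipode_right_mul S hS _ hv
          rw [comul_gen, counit_gen, genComul]
          simp [antipode_left, antipode_gen, genAntipode]
        | add v w hv hw => simp only [map_add, hv, hw]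
        | smul c v hv =>
          simp only [map_smul, hv]
          rw [smul_eq_mul, map_mul, Algebra.smul_def]
    | add y z hy hz => simp only [map_add, hy, hz]
  let hopf : HopfAlgebra k E :=
    { bialg with
      antipode := S'
      mul_antipode_rTensor_comul := by
        ext e
        exact hl e
      mul_antipode_lTensor_comul := by
        ext e
        exact hrr e }
  exact ⟨E, _, hopf, g, f, { h with
    comul_left, comul_gen, counit_left, counit_gen, antipode_left, antipode_gen }⟩

end HopfStructure

/-! ### Monomials and their corepresentations -/

section Words

open Coalgebra HopfAlgebra

variable {k : Type u} [Field k] {n : ℕ} {R R' : Mat2 k n} {H : Type v} [Ring H] [HopfAlgebra k H]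
  {r : H →ₗ[k] H →ₗ[k] k} {u : Fin n → Fin n → H} {V : Type w} [Ring V] [Algebra k V]
  {x : Fin n → V}

/-- Words of length `d` in `n` letters. -/
def Word (n : ℕ) : ℕ → Type
  | 0 => Unit
  | d + 1 => Word n d × Fin n

instance Word.fintype (n : ℕ) : ∀ d, Fintype (Word n d)
  | 0 => inferInstanceAs (Fintype Unit)
  | d + 1 => by
    have := Word.fintype n d
    exact inferInstanceAs (Fintype (Word n d × Fin n))

instance Word.decidableEq (n : ℕ) : ∀ d, DecidableEq (Word n d)
  | 0 => inferInstanceAs (DecidableEq Unit)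
  | d + 1 => by
    have := Word.decidableEq n d
    exact inferInstanceAs (DecidableEq (Word n d × Fin n))

/-- Append a letter to a word. -/
def Word.snoc {d : ℕ} (w : Word n d) (i : Fin n) : Word n (d + 1) := (w, i)

theorem Word.exists_snoc {d : ℕ} (w : Word n (d + 1)) : ∃ w' i, w = Word.snoc w' i :=
  ⟨w.1, w.2, rfl⟩

theorem Word.snoc_inj {d : ℕ} {w w' : Word n d} {i j : Fin n} :
    w.snoc i = w'.snoc j ↔ w = w' ∧ i = j :=
  Prod.mk_inj

theorem Word.sum_succ {M : Type*} [AddCommMonoid M] {d : ℕ} (F : Word n (d + 1) → M) :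
    ∑ w, F w = ∑ w : Word n d, ∑ i, F (w.snoc i) :=
  Fintype.sum_prod_type F

/-- The monomial of a word. -/
def wordVec (x : Fin n → V) : ∀ d, Word n d → V
  | 0, _ => 1
  | d + 1, w => wordVec x d w.1 * x w.2

/-- The matrix of the coaction on monomials. -/
def wordMat (u : Fin n → Fin n → H) : ∀ d, Word n d → Word n d → H
  | 0, _, _ => 1
  | d + 1, w, w' => wordMat u d w.1 w'.1 * u w.2 w'.2

theorem wordVec_snoc {d : ℕ} (w : Word n d) (i : Fin n) :
    wordVec x (d + 1) (w.snoc i) = wordVec x d w * x i := rfl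

theorem wordMat_snoc {d : ℕ} (w w' : Word n d) (i j : Fin n) :
    wordMat u (d + 1) (w.snoc i) (w'.snoc j) = wordMat u d w w' * u i j := rfl

/-- Products of matrix coefficients are again matrix coefficients, so every lemma about a
corepresentation applies in each degree. -/
theorem IsCorep.word (hu : IsCorep k u) (d : ℕ) : IsCorep k (wordMat u d) := by
  induction d with
  | zero =>
    refine ⟨fun i j => ?_, fun i j => ?_⟩
    · change comul (R := k) (1 : H) = ∑ a : Unit, 1 ⊗ₜ 1
      simp [Algebra.TensorProduct.one_def]
    · change counit (R := k) (1 : H) = if (i : Unit) = (j : Unit) then 1 else 0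
      exact Bialgebra.counit_one.trans (if_pos rfl).symm
  | succ d ih =>
    refine ⟨fun w w' => ?_, fun w w' => ?_⟩
    · obtain ⟨w, i, rfl⟩ := w.exists_snoc
      obtain ⟨w', j, rfl⟩ := w'.exists_snoc
      simp only [wordMat_snoc, Word.sum_succ, Bialgebra.comul_mul, ih.comul_eq, hu.comul_eq,
        Finset.sum_mul_sum, Algebra.TensorProduct.tmul_mul_tmul]
    · obtain ⟨w, i, rfl⟩ := w.exists_snoc
      obtain ⟨w', j, rfl⟩ := w'.exists_snoc
      simp only [wordMat_snoc, Bialgebra.counit_mul, ih.counit_eq, hu.counit_eq]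
      rw [ite_mul, one_mul, zero_mul, ← ite_and]
      exact (if_congr Word.snoc_inj rfl rfl).symm

/-- Monomials span `V` but may be dependent: they serve to check linear identities, not to define
maps. -/
theorem IsVectorAlg.word_induction (hV : IsVectorAlg R' x) {P : V → Prop}
    (word : ∀ d w, P (wordVec x d w)) (add : ∀ v w, P v → P w → P (v + w))
    (smul : ∀ (c : k) v, P v → P (c • v)) (v : V) : P v := by
  have h : v ∈ Submodule.span k (Set.range fun w : Σ d, Word n d => wordVec x w.1 w.2) := by
    induction v using hV.induction_right with
    | one => exact Submodule.subset_span ⟨⟨0, ()⟩, rfl⟩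
    | mul_gen v i hv =>
      induction hv using Submodule.span_induction with
      | mem v hv =>
        obtain ⟨⟨d, w⟩, rfl⟩ := hv
        exact Submodule.subset_span ⟨⟨d + 1, w.snoc i⟩, rfl⟩
      | zero => simp
      | add v w _ _ hv hw => rw [add_mul]; exact add_mem hv hw
      | smul c v _ hv => rw [smul_mul_assoc]; exact Submodule.smul_mem _ _ hv
    | add v w hv hw => exact add_mem hv hw
    | smul c v hv => exact Submodule.smul_mem _ _ hv
  induction h using Submodule.span_induction with
  | mem v hv =>
    obtain ⟨⟨d, w⟩, rfl⟩ := hv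
    exact word d w
  | zero => simpa using smul 0 _ (word 0 ())
  | add v w _ _ hv hw => exact add v w hv hw
  | smul c v _ hv => exact smul c v hv

/-- Moving letters past `a` one at a time composes the operators `hit`, and multiplicativity of `r`
in its first argument combines them. -/
theorem crosses_word {E : Type*} [Ring E] [Algebra k E] {g : H →ₐ[k] E} {f : V →ₐ[k] E}
    (hr : IsDualQuasitriangular r)
    (h : Crosses r u g (fun i => f (x i))) (d : ℕ) :
    Crosses r (wordMat u d) g (fun w => f (wordVec x d w)) := by
  induction d with
  | zero =>
    intro w a
    change f 1 * g a = ∑ j : Unit, g (hit (r 1) a) * f 1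
    simp [hr.one_left]
  | succ d ih =>
    intro w a
    obtain ⟨w, i, rfl⟩ := w.exists_snoc
    have h1 : f (x i) * g a = _ := h i a
    have h2 : ∀ j, f (wordVec x d w) * g (hit (r (u i j)) a) = _ := fun j => ih w _
    simp only [wordVec_snoc, map_mul, Word.sum_succ, wordMat_snoc]
    rw [mul_assoc, h1, Finset.mul_sum]
    simp only [← mul_assoc, h2, Finset.sum_mul, hit_hit, hr.convMul_eq]
    exact Finset.sum_comm

/-- The coaction on `V(R')`. -/
def vecCoact (hV : IsVectorAlg R' x) (hu : IsVectorCoaction R R' r u) : V →ₐ[k] V ⊗[k] H :=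
  hV.lift (fun i => ∑ j, x j ⊗ₜ u i j) (by
    have hP := vecRel_twist (R' := R')
      (fun a => (Algebra.TensorProduct.includeLeft : V →ₐ[k] V ⊗[k] H) (x a))
      (fun a b => (Algebra.TensorProduct.includeRight : H →ₐ[k] V ⊗[k] H) (u a b))
      (fun a b c => by simp [Commute, SemiconjBy])
      (hV.map_rel _) (hu.map_rel _)
    simpa using hP)

theorem vecCoact_gen (hV : IsVectorAlg R' x) (hu : IsVectorCoaction R R' r u) (i : Fin n) :
    vecCoact hV hu (x i) = ∑ j, x j ⊗ₜ u i j :=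
  hV.lift_gen _ _ i

theorem vecCoact_word (hV : IsVectorAlg R' x) (hu : IsVectorCoaction R R' r u) (d : ℕ)
    (w : Word n d) :
    vecCoact hV hu (wordVec x d w) = ∑ w', wordVec x d w' ⊗ₜ wordMat u d w w' := by
  induction d with
  | zero =>
    change vecCoact hV hu 1 = ∑ w : Unit, 1 ⊗ₜ 1
    simp [Algebra.TensorProduct.one_def]
  | succ d ih =>
    obtain ⟨w, i, rfl⟩ := w.exists_snoc
    simp only [wordVec_snoc, wordMat_snoc, map_mul, ih, vecCoact_gen, Word.sum_succ,
        Finset.sum_mul_sum,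
      Algebra.TensorProduct.tmul_mul_tmul]

theorem vecCoact_coassoc (hV : IsVectorAlg R' x) (hu : IsVectorCoaction R R' r u) (v : V) :
    TensorProduct.assoc k V H H (LinearMap.rTensor H (vecCoact hV hu).toLinearMap
      (vecCoact hV hu v)) = LinearMap.lTensor V comul (vecCoact hV hu v) := by
  induction v using hV.word_induction with
  | word d w =>
    simp only [vecCoact_word, map_sum, LinearMap.rTensor_tmul, AlgHom.toLinearMap_apply, sum_tmul,
      assoc_tmul, LinearMap.lTensor_tmul, (hu.word d).comul_eq, tmul_sum]
    exact Finset.sum_comm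
  | add v w hv hw => simp only [map_add, hv, hw]
  | smul c v hv => simp only [map_smul, hv]

theorem vecCoact_counit (hV : IsVectorAlg R' x) (hu : IsVectorCoaction R R' r u) (v : V) :
    TensorProduct.rid k V (LinearMap.lTensor V counit (vecCoact hV hu v)) = v := by
  induction v using hV.word_induction with
  | word d w => simp [vecCoact_word, (hu.word d).counit_eq]
  | add v w hv hw => simp only [map_add, hv, hw]
  | smul c v hv => simp only [map_smul, hv]

theorem braiding_word (hV : IsVectorAlg R' x) (hu : IsVectorCoaction R R' r u) (d e : ℕ)
    (w : Word n d) (w' : Word n e) :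
    braiding r (vecCoact hV hu).toLinearMap (wordVec x d w ⊗ₜ wordVec x e w') =
      ∑ a, ∑ b, r (wordMat u d w a) (wordMat u e w' b) • (wordVec x e b ⊗ₜ wordVec x d a) := by
  simp [braiding, vecCoact_word, sum_tmul, tmul_sum]
  exact Finset.sum_comm

theorem braiding_gen (hV : IsVectorAlg R' x) (hu : IsVectorCoaction R R' r u) (i j : Fin n) :
    braiding r (vecCoact hV hu).toLinearMap (x i ⊗ₜ x j) =
      ∑ a, ∑ b, R (i, j) (a, b) • (x b ⊗ₜ x a) := by
  simp [braiding, vecCoact_gen, sum_tmul, tmul_sum, hu.form_eq]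
  exact Finset.sum_comm

theorem braidedMul_word (hV : IsVectorAlg R' x) (hu : IsVectorCoaction R R' r u) (d e : ℕ)
    (v v' : V) (w : Word n d) (w' : Word n e) :
    braidedMul (braiding r (vecCoact hV hu).toLinearMap)
        ((v ⊗ₜ wordVec x d w) ⊗ₜ (wordVec x e w' ⊗ₜ v')) =
      ∑ a, ∑ b, r (wordMat u d w a) (wordMat u e w' b) •
        ((v * wordVec x e b) ⊗ₜ (wordVec x d a * v')) := by
  simp [braidedMul, braiding_word, sum_tmul, tmul_sum, tmul_smul, ← smul_tmul']

theorem actOf_word (hV : IsVectorAlg R' x) (hu : IsVectorCoaction R R' r u) (d : ℕ)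
    (w : Word n d) (a : H) :
    actOf r (vecCoact hV hu).toLinearMap (wordVec x d w) a =
      ∑ w', r (wordMat u d w w') a • wordVec x d w' := by
  simp [actOf, vecCoact_word, sum_tmul]

theorem coactTensor_word (hV : IsVectorAlg R' x) (hu : IsVectorCoaction R R' r u) (d e : ℕ)
    (w : Word n d) (w' : Word n e) :
    coactTensor (vecCoact hV hu).toLinearMap (wordVec x d w ⊗ₜ wordVec x e w') =
      ∑ a, ∑ b, (wordVec x d a ⊗ₜ wordVec x e b) ⊗ₜ (wordMat u d w a * wordMat u e w' b) := by
  simp [coactTensor, vecCoact_word, sum_tmul, tmul_sum]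
  exact Finset.sum_comm

end Words

/-! ### The braided coproduct, extracted from the bosonization -/

section BraidedCoproduct

open Coalgebra HopfAlgebra

variable {k : Type u} [Field k] {n : ℕ} {R R' : Mat2 k n} {H : Type v} [Ring H] [HopfAlgebra k H]
  {r : H →ₗ[k] H →ₗ[k] k} {u : Fin n → Fin n → H} {V : Type w} [Ring V] [Algebra k V]
  {x : Fin n → V} {E : Type*} [Ring E] [HopfAlgebra k E] {g : H →ₐ[k] E} {f : V →ₐ[k] E}

/-- The projection `a v ↦ ε(a) v`. -/
def IsSmash.proj (h : IsSmash r u x g f) : E →ₗ[k] V :=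
  (TensorProduct.lid k V).toLinearMap ∘ₗ LinearMap.rTensor V counit ∘ₗ h.equiv.symm.toLinearMap

theorem IsSmash.proj_mul (h : IsSmash r u x g f) (a : H) (v : V) :
    h.proj (g a * f v) = counit (R := k) a • v := by
  simp [IsSmash.proj]

theorem IsSmash.proj_left_mul (h : IsSmash r u x g f) (a : H) (e : E) :
    h.proj (g a * e) = counit (R := k) a • h.proj e := by
  induction e using h.induction with
  | mul b v => rw [← mul_assoc, ← map_mul, h.proj_mul, h.proj_mul, Bialgebra.counit_mul, mul_smul]
  | add y z hy hz => simp only [mul_add, map_add, smul_add, hy, hz]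

@[simp]
theorem IsSmash.proj_right (h : IsSmash r u x g f) (v : V) : h.proj (f v) = v := by
  simpa using h.proj_mul 1 v

theorem IsSmash.right_injective (h : IsSmash r u x g f) : Function.Injective f :=
  Function.LeftInverse.injective h.proj_right

/-- The map `v ⊗ w ↦ ∑ v⁽¹⁾ ⊗ v⁽²⁾ w`. -/
def cosmash (g : H →ₐ[k] E) (f : V →ₐ[k] E) (β : V →ₐ[k] V ⊗[k] H) : V ⊗[k] V →ₗ[k] E ⊗[k] E :=
  TensorProduct.map f.toLinearMap
    (LinearMap.mul' k E ∘ₗ TensorProduct.map g.toLinearMap f.toLinearMap) ∘ₗ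
    (TensorProduct.assoc k V H V).toLinearMap ∘ₗ LinearMap.rTensor V β.toLinearMap

theorem tensor_word_induction (hV : IsVectorAlg R' x) {P : V ⊗[k] V → Prop}
    (word : ∀ d w e w', P (wordVec x d w ⊗ₜ wordVec x e w'))
    (add : ∀ y z, P y → P z → P (y + z)) (smul : ∀ (c : k) z, P z → P (c • z))
    (z : V ⊗[k] V) : P z := by
  induction z with
  | zero => simpa using smul 0 _ (word 0 () 0 ())
  | add y z hy hz => exact add y z hy hz
  | tmul v w =>
    induction v using hV.word_induction with
    | word d v =>
      induction w using hV.word_induction with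
      | word e w => exact word d v e w
      | add v w hv hw => rw [tmul_add]; exact add _ _ hv hw
      | smul c v hv => rw [tmul_smul]; exact smul c _ hv
    | add v w hv hw => rw [add_tmul]; exact add _ _ hv hw
    | smul c v hv => rw [← smul_tmul']; exact smul c _ hv

theorem cosmash_word (hV : IsVectorAlg R' x) (hu : IsVectorCoaction R R' r u) (d : ℕ)
    (w : Word n d) (v : V) : cosmash g f (vecCoact hV hu) (wordVec x d w ⊗ₜ v) =
      ∑ a, f (wordVec x d a) ⊗ₜ (g (wordMat u d w a) * f v) := by
  simp [cosmash, vecCoact_word, sum_tmul]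

/-- In the second tensor leg the product requires moving an element of `V` past a coaction
coefficient. The cross relation does this at the cost of exactly the factor `r` in the braiding. -/
theorem cosmash_mul (hV : IsVectorAlg R' x) (hr : IsDualQuasitriangular r)
    (hu : IsVectorCoaction R R' r u)
    (h : Crosses r u g (fun i => f (x i))) (y z : V ⊗[k] V) :
    cosmash g f (vecCoact hV hu) y * cosmash g f (vecCoact hV hu) z =
      cosmash g f (vecCoact hV hu)
        (braidedMul (braiding r (vecCoact hV hu).toLinearMap) (y ⊗ₜ z)) := by
  induction y using tensor_word_induction hV with
  | word d w e w' =>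
    induction z using tensor_word_induction hV with
    | word d' v e' v' =>
      have h1 : ∀ b, f (wordVec x e w') * g (wordMat u d' v b) = ∑ m, ∑ c,
          r (wordMat u e w' m) (wordMat u d' v c) • (g (wordMat u d' c b) * f (wordVec x e m)) :=
        fun b => by
        have := crosses_word hr h e w' (wordMat u d' v b)
        simp only at this
        rw [this]
        simp [(hu.word d').hit_apply_coeff, Finset.sum_mul]
      have h2 : ∀ c m, cosmash g f (vecCoact hV hu)
          ((wordVec x d w * wordVec x d' c) ⊗ₜ (wordVec x e m * wordVec x e' v')) =
          ∑ a, ∑ b, (f (wordVec x d a) * f (wordVec x d' b)) ⊗ₜ (g (wordMat u d w a) *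
            (g (wordMat u d' c b) * f (wordVec x e m)) * f (wordVec x e' v')) := fun c m => by
        simp [cosmash, vecCoact_word, sum_tmul, Finset.sum_mul_sum, mul_assoc]
      rw [braidedMul_word, cosmash_word, cosmash_word, Finset.sum_mul_sum]
      simp only [map_sum, map_smul, h2, Algebra.TensorProduct.tmul_mul_tmul]
      have h3 : ∀ a b, g (wordMat u d w a) * f (wordVec x e w') *
          (g (wordMat u d' v b) * f (wordVec x e' v')) = ∑ m, ∑ c,
          r (wordMat u e w' m) (wordMat u d' v c) • (g (wordMat u d w a) *
            (g (wordMat u d' c b) * f (wordVec x e m)) * f (wordVec x e' v')) := fun a b => by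
        rw [mul_assoc, ← mul_assoc (f _), h1]
        simp [Finset.mul_sum, Finset.sum_mul, mul_assoc]
      simp only [h3, tmul_sum, tmul_smul, Finset.smul_sum]
      exact sum_sum_comm _
    | add y z hy hz => simp only [map_add, mul_add, tmul_add, hy, hz]
    | smul c z hz => simp only [map_smul, mul_smul_comm, tmul_smul, hz]
  | add y z hy hz => simp only [map_add, add_mul, add_tmul, hy, hz]
  | smul c z hz => simp only [map_smul, smul_mul_assoc, ← smul_tmul', hz]

/-- The projection replaces `v⁽²⁾` by its counit, so `cosmash` has a left inverse and is injective.
-/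
theorem IsSmash.proj_cosmash (h : IsSmash r u x g f) (hV : IsVectorAlg R' x)
    (hu : IsVectorCoaction R R' r u) (z : V ⊗[k] V) :
    TensorProduct.map h.proj h.proj (cosmash g f (vecCoact hV hu) z) = z := by
  induction z using tensor_word_induction hV with
  | word d w e w' =>
    simp [cosmash_word, h.proj_mul, (hu.word d).counit_eq, ite_smul, tmul_ite]
  | add y z hy hz => simp only [map_add, hy, hz]
  | smul c z hz => simp only [map_smul, hz]

/-- The braided coproduct on `V(R')`. -/
def IsSmash.braidedComul (h : IsSmash r u x g f) : V →ₗ[k] V ⊗[k] V :=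
  TensorProduct.map h.proj h.proj ∘ₗ comul ∘ₗ f.toLinearMap

variable (h : IsGenBosonization r u x g f)
include h

/-- The kernel of the projection is respected by `Δ` because both legs of `Δ a` are sent to their
counits. Thus coassociativity and the counit laws descend to `V`. -/
theorem IsGenBosonization.comul_proj (e : E) :
    h.braidedComul (h.proj e) = TensorProduct.map h.proj h.proj (comul e) := by
  induction e using h.induction with
  | mul a v =>
    rw [h.proj_mul, map_smul, Bialgebra.comul_mul, h.comul_left]
    change (_ : k) • TensorProduct.map h.proj h.proj (comul (f v)) = _
    generalize comul (R := k) (f v) = z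
    have e : ∀ y : H ⊗[k] H, TensorProduct.map h.proj h.proj
        (Algebra.TensorProduct.map g g y * z) =
        LinearMap.mul' k k (TensorProduct.map counit counit y) •
          TensorProduct.map h.proj h.proj z := by
      intro y
      induction y with
      | zero => simp
      | add y y' hy hy' => simp only [map_add, add_mul, add_smul, hy, hy']
      | tmul a b =>
        induction z with
        | zero => simp
        | add z z' hz hz' => simp only [map_add, mul_add, smul_add, hz, hz']
        | tmul c d => simp [h.proj_left_mul, smul_tmul', tmul_smul, smul_smul, mul_comm]
    rw [e]
    congr 1
    rw [← LinearMap.rTensor_comp_lTensor, LinearMap.comp_apply, lTensor_counit_comul]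
    simp
  | add y z hy hz => simp only [map_add, hy, hz]

theorem IsGenBosonization.counit_proj (e : E) :
    counit (R := k) (f (h.proj e)) = counit (R := k) e := by
  induction e using h.induction with
  | mul a v => simp [h.proj_mul, h.counit_left]
  | add y z hy hz => simp only [map_add, hy, hz]

theorem IsGenBosonization.cosmash_braidedComul (hV : IsVectorAlg R' x)
    (hr : IsDualQuasitriangular r) (hu : IsVectorCoaction R R' r u) (v : V) :
    cosmash g f (vecCoact hV hu) (h.braidedComul v) = comul (f v) := by
  -- By `proj_cosmash` it suffices that `Δ(f v)` lies in the range of `cosmash`, which contains the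
  -- coproducts of the generators and is closed under products by `cosmash_mul`.
  suffices hs : ∃ z, comul (R := k) (f v) = cosmash g f (vecCoact hV hu) z by
    obtain ⟨z, hz⟩ := hs
    change cosmash g f _ (TensorProduct.map h.proj h.proj (comul (f v))) = _
    rw [hz, h.proj_cosmash hV hu]
  have h1 : ∀ v, cosmash g f (vecCoact hV hu) (1 ⊗ₜ v) = 1 ⊗ₜ f v := fun v => by
    simp [cosmash, Algebra.TensorProduct.one_def]
  have hx : ∀ i, genComul u x g f i =
      cosmash g f (vecCoact hV hu) (x i ⊗ₜ 1 + 1 ⊗ₜ x i) := fun i => by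
    rw [map_add, h1]
    simp [genComul, cosmash, vecCoact_gen, sum_tmul]
  induction v using hV.induction with
  | one => exact ⟨1 ⊗ₜ 1, by simp [h1, Algebra.TensorProduct.one_def]⟩
  | gen_mul i v hv =>
    obtain ⟨z, hz⟩ := hv
    exact ⟨_, by rw [map_mul, Bialgebra.comul_mul, h.comul_gen, hz, hx,
      cosmash_mul hV hr hu h.crosses]⟩
  | add v w hv hw =>
    obtain ⟨y, hy⟩ := hv
    obtain ⟨z, hz⟩ := hw
    exact ⟨y + z, by simp only [map_add, hy, hz]⟩
  | smul c v hv =>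
    obtain ⟨z, hz⟩ := hv
    exact ⟨c • z, by simp only [map_smul, hz]⟩

theorem IsGenBosonization.braidedComul_gen (hu : IsVectorCoaction R R' r u) (i : Fin n) :
    h.braidedComul (x i) = x i ⊗ₜ 1 + 1 ⊗ₜ x i := by
  have e : ∀ a, h.proj (g a) = counit (R := k) a • 1 := fun a => by simpa using h.proj_mul a 1
  have e1 : h.proj 1 = 1 := by simpa using h.proj_right 1
  change TensorProduct.map h.proj h.proj (comul (f (x i))) = _
  rw [h.comul_gen, genComul]
  simp [e, e1, hu.counit_eq, ite_smul, tmul_ite]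

theorem IsGenBosonization.braidedComul_one : h.braidedComul 1 = 1 ⊗ₜ 1 := by
  have e1 : h.proj 1 = 1 := by simpa using h.proj_right 1
  change TensorProduct.map h.proj h.proj (comul (f 1)) = _
  simp [Algebra.TensorProduct.one_def, e1]

theorem IsGenBosonization.braidedComul_mul (hV : IsVectorAlg R' x)
    (hr : IsDualQuasitriangular r) (hu : IsVectorCoaction R R' r u) (v w : V) :
    h.braidedComul (v * w) = braidedMul (braiding r (vecCoact hV hu).toLinearMap)
      (h.braidedComul v ⊗ₜ h.braidedComul w) := by
  rw [← h.proj_cosmash hV hu (braidedMul _ _), ← cosmash_mul hV hr hu h.crosses,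
    h.cosmash_braidedComul hV hr hu, h.cosmash_braidedComul hV hr hu, ← Bialgebra.comul_mul,
    ← map_mul]
  rfl

theorem IsGenBosonization.braided_coassoc (v : V) :
    TensorProduct.assoc k V V V (LinearMap.rTensor V h.braidedComul (h.braidedComul v)) =
      LinearMap.lTensor V h.braidedComul (h.braidedComul v) := by
  have e1 : ∀ z : E ⊗[k] E, TensorProduct.assoc k V V V (LinearMap.rTensor V h.braidedComul
      (TensorProduct.map h.proj h.proj z)) = TensorProduct.map h.proj
        (TensorProduct.map h.proj h.proj)
          (TensorProduct.assoc k E E E (LinearMap.rTensor E comul z)) := by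
    intro z
    induction z with
    | zero => simp
    | add y z hy hz => simp only [map_add, hy, hz]
    | tmul y z =>
      simp only [map_tmul, LinearMap.rTensor_tmul, h.comul_proj]
      induction comul (R := k) y with
      | zero => simp
      | add y z hy hz => simp only [map_add, add_tmul, hy, hz]
      | tmul y z => simp
  have e2 : ∀ z : E ⊗[k] E, LinearMap.lTensor V h.braidedComul
      (TensorProduct.map h.proj h.proj z) = TensorProduct.map h.proj
        (TensorProduct.map h.proj h.proj) (LinearMap.lTensor E comul z) := by
    intro z
    induction z with
    | zero => simp
    | add y z hy hz => simp only [map_add, hy, hz]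
    | tmul y z => simp [h.comul_proj]
  change TensorProduct.assoc k V V V (LinearMap.rTensor V h.braidedComul
    (TensorProduct.map h.proj h.proj (comul (f v)))) =
      LinearMap.lTensor V h.braidedComul (TensorProduct.map h.proj h.proj (comul (f v)))
  rw [e1, e2, coassoc_apply]

theorem IsGenBosonization.counit_braidedComul (v : V) :
    TensorProduct.lid k V (LinearMap.rTensor V ((Bialgebra.counitAlgHom k E).comp f).toLinearMap
      (h.braidedComul v)) = v := by
  have e : ∀ z : E ⊗[k] E, LinearMap.rTensor V
      ((Bialgebra.counitAlgHom k E).comp f).toLinearMap (TensorProduct.map h.proj h.proj z) =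
        LinearMap.lTensor k h.proj (LinearMap.rTensor E counit z) := by
    intro z
    induction z with
    | zero => simp
    | add y z hy hz => simp only [map_add, hy, hz]
    | tmul y z => simp [h.counit_proj]
  change TensorProduct.lid k V (LinearMap.rTensor V _
    (TensorProduct.map h.proj h.proj (comul (f v)))) = v
  rw [e]
  simp

theorem IsGenBosonization.braidedComul_counit (v : V) :
    TensorProduct.rid k V (LinearMap.lTensor V ((Bialgebra.counitAlgHom k E).comp f).toLinearMap
      (h.braidedComul v)) = v := by
  have e : ∀ z : E ⊗[k] E, LinearMap.lTensor V
      ((Bialgebra.counitAlgHom k E).comp f).toLinearMap (TensorProduct.map h.proj h.proj z) =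
        LinearMap.rTensor k h.proj (LinearMap.lTensor E counit z) := by
    intro z
    induction z with
    | zero => simp
    | add y z hy hz => simp only [map_add, hy, hz]
    | tmul y z => simp [h.counit_proj]
  change TensorProduct.rid k V (LinearMap.lTensor V _
    (TensorProduct.map h.proj h.proj (comul (f v)))) = v
  rw [e]
  simp

end BraidedCoproduct

/-! ### The braided antipode -/

section BraidedAntipode

open Coalgebra HopfAlgebra

variable {k : Type u} [Field k] {n : ℕ} {R R' : Mat2 k n} {H : Type v} [Ring H] [HopfAlgebra k H]
  {r : H →ₗ[k] H →ₗ[k] k} {u : Fin n → Fin n → H} {V : Type w} [Ring V] [Algebra k V]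
  {x : Fin n → V}

theorem actOf_apply_of_coact {β : V →ₗ[k] V ⊗[k] H} {ι : Type*} {s : Finset ι} {v : V}
    {y : ι → V} {b : ι → H} (hv : β v = ∑ i ∈ s, y i ⊗ₜ b i) (a : H) :
    actOf r β v a = ∑ i ∈ s, r (b i) a • y i := by
  simp [actOf, hv, sum_tmul]

theorem smash_cross {E : Type*} [Ring E] [Algebra k E] {g : H →ₐ[k] E} {f : V →ₐ[k] E}
    (h : Crosses r u g (fun i => f (x i))) (hV : IsVectorAlg R' x)
    (hr : IsDualQuasitriangular r) (hu : IsVectorCoaction R R' r u) (v : V) (a : H) :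
    f v * g a = LinearMap.mul' k E (TensorProduct.map g.toLinearMap
      (f.toLinearMap ∘ₗ actOf r (vecCoact hV hu).toLinearMap v) (comul a)) := by
  induction v using hV.word_induction with
  | word d w =>
    have e : ∀ z : H ⊗[k] H, LinearMap.mul' k E (TensorProduct.map g.toLinearMap
        (f.toLinearMap ∘ₗ actOf r (vecCoact hV hu).toLinearMap (wordVec x d w)) z) =
        ∑ w', g (TensorProduct.rid k H (LinearMap.lTensor H (r (wordMat u d w w')) z)) *
          f (wordVec x d w') := by
      intro z
      induction z with
      | zero => simp
      | add y z hy hz => simp only [map_add, add_mul, Finset.sum_add_distrib, hy, hz]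
      | tmul y z => simp [actOf_word, Finset.mul_sum]
    rw [e]
    exact crosses_word hr h d w a
  | add v w hv hw =>
    simp only [map_add, add_mul, hv, hw, LinearMap.comp_add, TensorProduct.map_add_right,
      LinearMap.add_apply]
  | smul c v hv =>
    simp only [map_smul, smul_mul_assoc, hv, LinearMap.comp_smul, TensorProduct.map_smul_right,
      LinearMap.smul_apply]

/-- The action is the adjoint one inside `E`: `∑ S(a₁) v a₂ = ∑ S(a₁) a₂ (v ◁ a₃) = v ◁ a`. -/
theorem IsCorep.antipode_conj {E : Type*} [Ring E] [Algebra k E] {g : H →ₐ[k] E} {f : V →ₐ[k] E}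
    (h : Crosses r u g (fun i => f (x i))) (hV : IsVectorAlg R' x)
    (hr : IsDualQuasitriangular r) (hu : IsVectorCoaction R R' r u) (v : V) (i m : Fin n) :
    ∑ j, g (antipode k (u j m)) * f v * g (u i j) =
      f (actOf r (vecCoact hV hu).toLinearMap v (u i m)) := by
  simp only [mul_assoc, smash_cross h hV hr hu, hu.comul_eq, map_sum, TensorProduct.map_tmul,
    LinearMap.mul'_apply, AlgHom.toLinearMap_apply, LinearMap.comp_apply, Finset.mul_sum]
  rw [Finset.sum_comm]
  simp only [← mul_assoc, ← map_mul, ← Finset.sum_mul, ← map_sum, hu.sum_antipode_mul]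
  simp [apply_ite]

variable {E : Type*} [Ring E] [HopfAlgebra k E] {g : H →ₐ[k] E} {f : V →ₐ[k] E}

/-- The map `v ↦ ∑ S(v⁽¹⁾) v⁽²⁾`. -/
def cosmashAntipode (g : H →ₐ[k] E) (f : V →ₐ[k] E) (β : V →ₐ[k] V ⊗[k] H) : V →ₗ[k] E :=
  LinearMap.mul' k E ∘ₗ TensorProduct.map (antipode k ∘ₗ f.toLinearMap) g.toLinearMap ∘ₗ
    β.toLinearMap

theorem cosmashAntipode_word (hV : IsVectorAlg R' x) (hu : IsVectorCoaction R R' r u) (d : ℕ)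
    (w : Word n d) : cosmashAntipode g f (vecCoact hV hu) (wordVec x d w) =
      ∑ w', antipode k (f (wordVec x d w')) * g (wordMat u d w w') := by
  simp [cosmashAntipode, vecCoact_word]

/-- The braided antipode on `V(R')`. -/
def IsSmash.braidedAntipode (h : IsSmash r u x g f) (β : V →ₐ[k] V ⊗[k] H) : V →ₗ[k] V :=
  h.proj ∘ₗ cosmashAntipode g f β

variable (h : IsGenBosonization r u x g f)
include h

/-- The recursion for the braided antipode: `S` reverses the word, so `S(x^j)` and `u i j` enclose
the value `f v` on the shorter word, and conjugation turns this into the action. -/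
theorem IsGenBosonization.cosmashAntipode_mul_gen (hV : IsVectorAlg R' x)
    (hr : IsDualQuasitriangular r) (hu : IsVectorCoaction R R' r u) (d : ℕ) (w : Word n d)
    (i : Fin n) (v : V) (hv : cosmashAntipode g f (vecCoact hV hu) (wordVec x d w) = f v) :
    cosmashAntipode g f (vecCoact hV hu) (wordVec x (d + 1) (w.snoc i)) =
      f (-∑ m, x m * actOf r (vecCoact hV hu).toLinearMap v (u i m)) := by
  rw [cosmashAntipode_word, Word.sum_succ, Finset.sum_comm]
  have e : ∀ j, ∑ w' : Word n d, antipode k (f (wordVec x (d + 1) (w'.snoc j))) *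
      g (wordMat u (d + 1) (w.snoc i) (w'.snoc j)) = genAntipode u x g f j * f v * g (u i j) := fun
          j => by
    rw [← hv, cosmashAntipode_word]
    simp only [wordVec_snoc, wordMat_snoc, map_mul, antipode_mul_antidistrib, h.antipode_gen,
      Finset.mul_sum, Finset.sum_mul, mul_assoc]
  rw [Finset.sum_congr rfl fun j _ => e j]
  simp only [genAntipode, map_neg, map_sum, map_mul, ← IsCorep.antipode_conj h.crosses hV hr hu,
    neg_mul, Finset.sum_neg_distrib, Finset.sum_mul, Finset.mul_sum, mul_assoc]
  rw [Finset.sum_comm]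

/-- The two claims are proved together: the recursion acts on the value at a shorter word, and
equivariance expands that action in values at words of the same length. -/
theorem IsGenBosonization.braidedAntipode_word (hV : IsVectorAlg R' x)
    (hr : IsDualQuasitriangular r) (hu : IsVectorCoaction R R' r u) (d : ℕ) (w : Word n d) :
    f (h.braidedAntipode (vecCoact hV hu) (wordVec x d w)) =
      cosmashAntipode g f (vecCoact hV hu) (wordVec x d w) ∧
    vecCoact hV hu (h.braidedAntipode (vecCoact hV hu) (wordVec x d w)) =
      ∑ w', h.braidedAntipode (vecCoact hV hu) (wordVec x d w') ⊗ₜ wordMat u d w w' := by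
  induction d with
  | zero =>
    have e : cosmashAntipode g f (vecCoact hV hu) 1 = 1 := by
      simp [cosmashAntipode, Algebra.TensorProduct.one_def]
    have e' : h.braidedAntipode (vecCoact hV hu) 1 = 1 := by
      rw [IsSmash.braidedAntipode, LinearMap.comp_apply, e]
      simpa using h.proj_right 1
    change f (h.braidedAntipode (vecCoact hV hu) 1) = cosmashAntipode g f (vecCoact hV hu) 1 ∧
      vecCoact hV hu (h.braidedAntipode (vecCoact hV hu) 1) =
        ∑ w' : Unit, h.braidedAntipode (vecCoact hV hu) 1 ⊗ₜ 1
    simp [e, e', Algebra.TensorProduct.one_def]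
  | succ d ih =>
    have e1 : ∀ (w : Word n d) i, cosmashAntipode g f (vecCoact hV hu)
        (wordVec x (d + 1) (w.snoc i)) = _ :=
      fun w i => h.cosmashAntipode_mul_gen hV hr hu d w i _ (ih w).1.symm
    have e2 : ∀ (w : Word n d) i, h.braidedAntipode (vecCoact hV hu) (wordVec x (d + 1) (w.snoc i))
        =
        -∑ m, ∑ w', r (wordMat u d w w') (u i m) •
          (x m * h.braidedAntipode (vecCoact hV hu) (wordVec x d w')) := fun w i => by
      have e3 := fun a => actOf_apply_of_coact (r := r) (β := (vecCoact hV hu).toLinearMap)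
        (ih w).2 a
      rw [IsSmash.braidedAntipode, LinearMap.comp_apply, e1, h.proj_right]
      simp only [e3, Finset.mul_sum, mul_smul_comm]
      rfl
    obtain ⟨w, i, rfl⟩ := w.exists_snoc
    constructor
    · change f (h.proj (cosmashAntipode g f (vecCoact hV hu) (wordVec x (d + 1) (w.snoc i)))) = _
      rw [e1, h.proj_right]
    · rw [e2]
      simp only [Word.sum_succ, e2, map_neg, map_sum, map_smul, map_mul, vecCoact_gen, (ih _).2,
        neg_tmul, Finset.sum_neg_distrib, neg_inj, sum_tmul, wordMat_snoc, Finset.sum_mul_sum,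
        Algebra.TensorProduct.tmul_mul_tmul, Finset.smul_sum, ← smul_tmul']
      -- Quasi-commutativity of `r` between the word matrix and `u` reconciles the orders in which
      -- the last letter and the shorter word coact.
      have q : ∀ w'' l, ∑ m, ∑ w', r (wordMat u d w w') (u i m) • (u m l * wordMat u d w' w'') =
          ∑ w', ∑ m, r (wordMat u d w' w'') (u m l) • (wordMat u d w w' * u i m) :=
        fun w'' l => by
        have := (hu.word d).quasi_comm hr w w'' (u i l)
        simp only [hu.hit_apply_coeff, hu.hitLeft_apply_coeff, Finset.mul_sum, Finset.sum_mul,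
          mul_smul_comm, smul_mul_assoc] at this
        rw [this, Finset.sum_comm]
      calc ∑ m, ∑ w', ∑ l, ∑ w'', r (wordMat u d w w') (u i m) •
            (x l * h.braidedAntipode (vecCoact hV hu) (wordVec x d w'')) ⊗ₜ[k]
              (u m l * wordMat u d w' w'')
          = ∑ l, ∑ w'', (x l * h.braidedAntipode (vecCoact hV hu) (wordVec x d w'')) ⊗ₜ[k]
              ∑ m, ∑ w', r (wordMat u d w w') (u i m) • (u m l * wordMat u d w' w'') := by
            rw [sum_sum_comm]
            simp only [tmul_sum, tmul_smul]
        _ = ∑ w', ∑ m, ∑ l, ∑ w'', r (wordMat u d w' w'') (u m l) •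
              (x l * h.braidedAntipode (vecCoact hV hu) (wordVec x d w'')) ⊗ₜ[k]
                (wordMat u d w w' * u i m) := by
            rw [sum_sum_comm]
            simp only [q, tmul_sum, tmul_smul]

end BraidedAntipode

/-! ### The braided Hopf algebra axioms -/

section BraidedHopf

open Coalgebra HopfAlgebra

variable {k : Type u} [Field k] {n : ℕ} {R R' : Mat2 k n} {H : Type v} [Ring H] [HopfAlgebra k H]
  {r : H →ₗ[k] H →ₗ[k] k} {u : Fin n → Fin n → H} {V : Type w} [Ring V] [Algebra k V]
  {x : Fin n → V} {E : Type*} [Ring E] [HopfAlgebra k E] {g : H →ₐ[k] E} {f : V →ₐ[k] E}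
  (h : IsGenBosonization r u x g f)
include h

theorem IsGenBosonization.map_braidedAntipode (hV : IsVectorAlg R' x)
    (hr : IsDualQuasitriangular r) (hu : IsVectorCoaction R R' r u) (v : V) :
    f (h.braidedAntipode (vecCoact hV hu) v) = cosmashAntipode g f (vecCoact hV hu) v := by
  induction v using hV.word_induction with
  | word d w => exact (h.braidedAntipode_word hV hr hu d w).1
  | add v w hv hw => simp only [map_add, hv, hw]
  | smul c v hv => simp only [map_smul, hv]

theorem IsGenBosonization.coact_braidedAntipode (hV : IsVectorAlg R' x)
    (hr : IsDualQuasitriangular r) (hu : IsVectorCoaction R R' r u) (v : V) :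
    vecCoact hV hu (h.braidedAntipode (vecCoact hV hu) v) =
      LinearMap.rTensor H (h.braidedAntipode (vecCoact hV hu)) (vecCoact hV hu v) := by
  induction v using hV.word_induction with
  | word d w => rw [(h.braidedAntipode_word hV hr hu d w).2, vecCoact_word]; simp
  | add v w hv hw => simp only [map_add, hv, hw]
  | smul c v hv => simp only [map_smul, hv]

theorem IsGenBosonization.braidedAntipode_gen (hV : IsVectorAlg R' x)
    (hr : IsDualQuasitriangular r) (hu : IsVectorCoaction R R' r u) (i : Fin n) :
    h.braidedAntipode (vecCoact hV hu) (x i) = -x i := by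
  apply h.right_injective
  rw [h.map_braidedAntipode hV hr hu, cosmashAntipode]
  simp only [LinearMap.comp_apply, AlgHom.toLinearMap_apply, vecCoact_gen, map_sum,
    TensorProduct.map_tmul, LinearMap.mul'_apply, h.antipode_gen, genAntipode, neg_mul,
    Finset.sum_mul, Finset.sum_neg_distrib, mul_assoc, map_neg, ← map_mul g]
  rw [Finset.sum_comm]
  simp only [← Finset.mul_sum, ← map_sum, hu.sum_antipode_mul]
  simp [apply_ite]

/-- On `cosmash (v ⊗ w) = ∑ v⁽¹⁾ ⊗ v⁽²⁾ w` the left antipode contraction of `E` gives `∑ S(v⁽¹⁾)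
v⁽²⁾ w`, the braided antipode of `v` times `w`. The axiom of `E` thus becomes the braided one. -/
theorem IsGenBosonization.braidedAntipode_left (hV : IsVectorAlg R' x)
    (hr : IsDualQuasitriangular r) (hu : IsVectorCoaction R R' r u) (v : V) :
    LinearMap.mul' k V (LinearMap.rTensor V (h.braidedAntipode (vecCoact hV hu))
      (h.braidedComul v)) = algebraMap k V (counit (f v)) := by
  have e : ∀ z : V ⊗[k] V, f (LinearMap.mul' k V
      (LinearMap.rTensor V (h.braidedAntipode (vecCoact hV hu)) z)) =
      LinearMap.mul' k E (LinearMap.rTensor E (antipode k) (cosmash g f (vecCoact hV hu) z)) := by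
    intro z
    induction z using tensor_word_induction hV with
    | word d w e w' =>
      rw [cosmash_word]
      simp [h.map_braidedAntipode hV hr hu, cosmashAntipode_word, Finset.sum_mul, mul_assoc]
    | add y z hy hz => simp only [map_add, hy, hz]
    | smul c z hz => simp only [map_smul, hz]
  apply h.right_injective
  rw [e, h.cosmash_braidedComul hV hr hu, mul_antipode_rTensor_comul_apply, AlgHom.commutes]

/-- The homomorphism `a v ↦ a ε(v)`. -/
def IsGenBosonization.projLeft (hV : IsVectorAlg R' x) : E →ₐ[k] H :=
  h.lift hV (AlgHom.id k H) ((Algebra.ofId k H).comp ((Bialgebra.counitAlgHom k E).comp f)) (by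
    intro i a
    simp [h.counit_gen])

theorem IsGenBosonization.projLeft_left (hV : IsVectorAlg R' x) (a : H) :
    h.projLeft hV (g a) = a :=
  h.lift_left hV _ a

theorem IsGenBosonization.projLeft_right (hV : IsVectorAlg R' x) (v : V) :
    h.projLeft hV (f v) = algebraMap k H (counit (f v)) :=
  h.lift_right hV _ v

/-- The coaction of `H` on `E` along the projection `E → H`. -/
def IsGenBosonization.smashCoact (hV : IsVectorAlg R' x) : E →ₐ[k] E ⊗[k] H :=
  (Algebra.TensorProduct.map (AlgHom.id k E) (h.projLeft hV)).comp (Bialgebra.comulAlgHom k E)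

theorem IsGenBosonization.smashCoact_apply (hV : IsVectorAlg R' x) (e : E) :
    h.smashCoact hV e = LinearMap.lTensor E (h.projLeft hV).toLinearMap (comul e) := rfl

theorem IsGenBosonization.smashCoact_left (hV : IsVectorAlg R' x) (a : H) :
    h.smashCoact hV (g a) = LinearMap.rTensor H g.toLinearMap (comul a) := by
  rw [h.smashCoact_apply, h.comul_left]
  generalize comul (R := k) a = z
  induction z with
  | zero => simp
  | add y z hy hz => simp only [map_add, hy, hz]
  | tmul y z => simp [h.projLeft_left]

theorem IsGenBosonization.smashCoact_right (hV : IsVectorAlg R' x)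
    (hu : IsVectorCoaction R R' r u) (v : V) :
    h.smashCoact hV (f v) = LinearMap.rTensor H f.toLinearMap (vecCoact hV hu v) := by
  have e : (h.smashCoact hV).comp f =
      (Algebra.TensorProduct.map f (AlgHom.id k H)).comp (vecCoact hV hu) := by
    refine hV.hom_ext fun i => ?_
    rw [AlgHom.comp_apply, AlgHom.comp_apply, h.smashCoact_apply, h.comul_gen, vecCoact_gen]
    simp [genComul, h.projLeft_left, h.projLeft_right, h.counit_gen]
  exact DFunLike.congr_fun e v

/-- This is coassociativity of `Δ` with the last leg projected to `H`; restricted to `V` it yields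
the equivariance of the braided coproduct. -/
theorem IsGenBosonization.smashCoact_comul (hV : IsVectorAlg R' x) (e : E) :
    TensorProduct.assoc k E E H (LinearMap.rTensor H comul (h.smashCoact hV e)) =
      LinearMap.lTensor E (h.smashCoact hV).toLinearMap (comul e) := by
  have e1 : ∀ z : E ⊗[k] E, TensorProduct.assoc k E E H (LinearMap.rTensor H comul
      (LinearMap.lTensor E (h.projLeft hV).toLinearMap z)) =
      LinearMap.lTensor E (LinearMap.lTensor E (h.projLeft hV).toLinearMap)
        (TensorProduct.assoc k E E E (LinearMap.rTensor E comul z)) := by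
    intro z
    induction z with
    | zero => simp
    | add y z hy hz => simp only [map_add, hy, hz]
    | tmul y z =>
      simp only [LinearMap.lTensor_tmul, LinearMap.rTensor_tmul]
      induction comul (R := k) y with
      | zero => simp
      | add y z hy hz => simp only [map_add, add_tmul, hy, hz]
      | tmul y z => simp
  rw [h.smashCoact_apply, e1, coassoc_apply, ← LinearMap.comp_apply, ← LinearMap.lTensor_comp]
  rfl

/-- Under `cosmash`, the coaction on the second leg of `E ⊗ E` corresponds to the codiagonal
coaction on `V ⊗ V`. So `smashCoact_comul` is the claim after `cosmash`, and `proj_cosmash` removes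
that map. -/
theorem IsGenBosonization.coact_braidedComul (hV : IsVectorAlg R' x)
    (hr : IsDualQuasitriangular r) (hu : IsVectorCoaction R R' r u) (v : V) :
    coactTensor (vecCoact hV hu).toLinearMap (h.braidedComul v) =
      LinearMap.rTensor H h.braidedComul (vecCoact hV hu v) := by
  have e1 : ∀ z : V ⊗[k] V, LinearMap.lTensor E (h.smashCoact hV).toLinearMap
      (cosmash g f (vecCoact hV hu) z) = TensorProduct.assoc k E E H
        (LinearMap.rTensor H (cosmash g f (vecCoact hV hu))
          (coactTensor (vecCoact hV hu).toLinearMap z)) := by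
    intro z
    induction z using tensor_word_induction hV with
    | word d w e w' =>
      simp only [cosmash_word, coactTensor_word, map_sum, LinearMap.lTensor_tmul,
        LinearMap.rTensor_tmul, AlgHom.toLinearMap_apply, map_mul, h.smashCoact_left,
        h.smashCoact_right hV hu, (hu.word d).comul_eq, vecCoact_word, Finset.sum_mul_sum,
        Algebra.TensorProduct.tmul_mul_tmul, sum_tmul, tmul_sum, assoc_tmul]
      rw [Finset.sum_comm]
      exact Finset.sum_congr rfl fun a _ => Finset.sum_comm
    | add y z hy hz => simp only [map_add, hy, hz]
    | smul c z hz => simp only [map_smul, hz]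
  have e2 := h.smashCoact_comul hV (f v)
  rw [h.smashCoact_right hV hu, ← h.cosmash_braidedComul hV hr hu, e1] at e2
  have e3 := congrArg (LinearMap.rTensor H (TensorProduct.map h.proj h.proj))
    ((TensorProduct.assoc k E E H).injective e2)
  have e4 : TensorProduct.map h.proj h.proj ∘ₗ cosmash g f (vecCoact hV hu) = LinearMap.id :=
    LinearMap.ext fun z => h.proj_cosmash hV hu z
  rw [← LinearMap.comp_apply (LinearMap.rTensor H (TensorProduct.map h.proj h.proj))
      (LinearMap.rTensor H (cosmash g f (vecCoact hV hu))), ← LinearMap.rTensor_comp, e4,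
    LinearMap.rTensor_id] at e3
  simp only [← LinearMap.comp_apply, ← LinearMap.rTensor_comp] at e3
  exact e3.symm

theorem IsGenBosonization.coact_counit_eq (hV : IsVectorAlg R' x)
    (hu : IsVectorCoaction R R' r u) (v : V) :
    TensorProduct.lid k H (LinearMap.rTensor H
      ((Bialgebra.counitAlgHom k E).comp f).toLinearMap (vecCoact hV hu v)) =
        algebraMap k H (counit (f v)) := by
  have e : (Algebra.TensorProduct.lid k H).toAlgHom.comp ((Algebra.TensorProduct.map
      ((Bialgebra.counitAlgHom k E).comp f) (AlgHom.id k H)).comp (vecCoact hV hu)) =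
      (Algebra.ofId k H).comp ((Bialgebra.counitAlgHom k E).comp f) := by
    refine hV.hom_ext fun i => ?_
    simp [vecCoact_gen, h.counit_gen]
  exact DFunLike.congr_fun e v

/-- The definition of the braided antipode, solved for `S` by contracting with the antipodes of the
coaction coefficients. -/
theorem IsGenBosonization.antipode_word (hV : IsVectorAlg R' x)
    (hr : IsDualQuasitriangular r) (hu : IsVectorCoaction R R' r u) (d : ℕ) (w : Word n d) :
    antipode k (f (wordVec x d w)) = ∑ b, f (h.braidedAntipode (vecCoact hV hu) (wordVec x d b)) *
      g (antipode k (wordMat u d w b)) := by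
  simp only [h.map_braidedAntipode hV hr hu, cosmashAntipode_word, Finset.sum_mul, mul_assoc,
    ← map_mul]
  rw [Finset.sum_comm]
  simp only [← Finset.mul_sum, ← map_sum, (hu.word d).sum_mul_antipode]
  simp [apply_ite]

/-- With `K` the right contraction of the braided coproduct, the antipode axiom of `E` gives only `∑
K(v⁽¹⁾) S(v⁽²⁾) = ε(v)`. Multiplying by the coaction coefficients cancels `S`, and invariance of the
counit finishes. -/
theorem IsGenBosonization.braidedAntipode_right (hV : IsVectorAlg R' x)
    (hr : IsDualQuasitriangular r) (hu : IsVectorCoaction R R' r u) (v : V) :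
    LinearMap.mul' k V (LinearMap.lTensor V (h.braidedAntipode (vecCoact hV hu))
      (h.braidedComul v)) = algebraMap k V (counit (f v)) := by
  let K : V →ₗ[k] V := LinearMap.mul' k V ∘ₗ
    LinearMap.lTensor V (h.braidedAntipode (vecCoact hV hu)) ∘ₗ h.braidedComul
  have e1 : ∀ z : V ⊗[k] V, LinearMap.mul' k E (LinearMap.lTensor E (antipode k)
      (cosmash g f (vecCoact hV hu) z)) = LinearMap.mul' k E (TensorProduct.map
        (f.toLinearMap ∘ₗ LinearMap.mul' k V ∘ₗ
          LinearMap.lTensor V (h.braidedAntipode (vecCoact hV hu)))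
        (g.toLinearMap ∘ₗ antipode k) (coactTensor (vecCoact hV hu).toLinearMap z)) := by
    intro z
    induction z using tensor_word_induction hV with
    | word d w e w' =>
      rw [cosmash_word, coactTensor_word]
      simp [antipode_mul_antidistrib, h.antipode_word hV hr hu, h.antipode_left, Finset.sum_mul,
        Finset.mul_sum, mul_assoc]
    | add y z hy hz => simp only [map_add, hy, hz]
    | smul c z hz => simp only [map_smul, hz]
  have e2 : ∀ d (w : Word n d), ∑ w', f (K (wordVec x d w')) * g (antipode k (wordMat u d w w')) =
      algebraMap k E (counit (f (wordVec x d w))) := fun d w => by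
    rw [← mul_antipode_lTensor_comul_apply, ← h.cosmash_braidedComul hV hr hu, e1,
      h.coact_braidedComul hV hr hu, vecCoact_word]
    simp [K]
  change K v = algebraMap k V (counit (f v))
  induction v using hV.word_induction with
  | word d w =>
    apply h.right_injective
    have e3 : ∑ w'', algebraMap k E (counit (f (wordVec x d w''))) * g (wordMat u d w w'') =
        f (K (wordVec x d w)) := by
      simp only [← e2, Finset.sum_mul, mul_assoc, ← map_mul]
      rw [Finset.sum_comm]
      simp only [← Finset.mul_sum, ← map_sum, (hu.word d).sum_antipode_mul]
      simp [apply_ite]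
    have e4 := congrArg g (h.coact_counit_eq hV hu (wordVec x d w))
    rw [← e3, AlgHom.commutes, ← AlgHom.commutes g, ← e4, vecCoact_word]
    simp [Algebra.smul_def]
  | add v w hv hw => simp only [map_add, hv, hw]
  | smul c v hv =>
    simp only [map_smul, hv]
    rw [smul_eq_mul, map_mul, Algebra.smul_def]

/-- The braided Hopf algebra structure on the algebra of braided vectors. -/
def IsGenBosonization.braidedHopf (hV : IsVectorAlg R' x)
    (hr : IsDualQuasitriangular r) (hu : IsVectorCoaction R R' r u) : BraidedHopfAlgebra r V where
  coact := vecCoact hV hu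
  coact_coassoc := LinearMap.ext (vecCoact_coassoc hV hu)
  coact_counit := LinearMap.ext (vecCoact_counit hV hu)
  comul := h.braidedComul
  counit := (Bialgebra.counitAlgHom k E).comp f
  antipode := h.braidedAntipode (vecCoact hV hu)
  coassoc := LinearMap.ext h.braided_coassoc
  counit_comul := LinearMap.ext h.counit_braidedComul
  comul_counit := LinearMap.ext h.braidedComul_counit
  comul_one := h.braidedComul_one
  comul_mul := h.braidedComul_mul hV hr hu
  antipode_left := LinearMap.ext (h.braidedAntipode_left hV hr hu)
  antipode_right := LinearMap.ext (h.braidedAntipode_right hV hr hu)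
  coact_comul := LinearMap.ext (h.coact_braidedComul hV hr hu)
  coact_counit_eq := h.coact_counit_eq hV hu
  coact_antipode := LinearMap.ext (h.coact_braidedAntipode hV hr hu)

end BraidedHopf

/-! ### Multiplication in the other order and the bosonization -/

section Bosonization

open Coalgebra HopfAlgebra

variable {k : Type u} [Field k] {n : ℕ} {R R' : Mat2 k n} {H : Type v} [Ring H] [HopfAlgebra k H]
  {r : H →ₗ[k] H →ₗ[k] k} {u : Fin n → Fin n → H} {V : Type w} [Ring V] [Algebra k V]
  {x : Fin n → V}

/-- The map `v ⊗ a ↦ ∑ v⁽¹⁾ ⊗ a₁ φ(v⁽²⁾, a₂)`. -/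
def crossMap (β : V →ₐ[k] V ⊗[k] H) (φ : H ⊗[k] H →ₗ[k] k) : V ⊗[k] H →ₗ[k] V ⊗[k] H :=
  LinearMap.lTensor V (TensorProduct.lift (hitLin ∘ₗ TensorProduct.curry φ)) ∘ₗ
    (TensorProduct.assoc k V H H).toLinearMap ∘ₗ LinearMap.rTensor H β.toLinearMap

theorem crossMap_word (hV : IsVectorAlg R' x) (hu : IsVectorCoaction R R' r u)
    (φ : H ⊗[k] H →ₗ[k] k) (d : ℕ) (w : Word n d) (a : H) :
    crossMap (vecCoact hV hu) φ (wordVec x d w ⊗ₜ a) =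
      ∑ w', wordVec x d w' ⊗ₜ hit (TensorProduct.curry φ (wordMat u d w w')) a := by
  simp [crossMap, vecCoact_word, sum_tmul]

/-- Composing cross maps convolves their forms, so convolution inverses yield inverse maps. -/
theorem crossMap_crossMap (hV : IsVectorAlg R' x) (hu : IsVectorCoaction R R' r u)
    {φ ψ : H ⊗[k] H →ₗ[k] k} (h : convMul φ ψ = counit) (z : V ⊗[k] H) :
    crossMap (vecCoact hV hu) φ (crossMap (vecCoact hV hu) ψ z) = z := by
  induction z with
  | zero => simp
  | add y z hy hz => simp only [map_add, hy, hz]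
  | tmul v a =>
    induction v using hV.word_induction with
    | word d w =>
      simp only [crossMap_word, map_sum]
      rw [Finset.sum_comm]
      simp only [← tmul_sum, (hu.word d).sum_hit_hit φ ψ h]
      simp [tmul_ite]
    | add v w hv hw => simp only [add_tmul, map_add, hv, hw]
    | smul c v hv => simp only [← smul_tmul', map_smul, hv]

/-- Reordering `v a` into `∑ a₁ (v ◁ a₂)` is `crossMap` followed by the flip, and the inverse of `r`
inverts `crossMap`. -/
theorem IsSmash.bijective_mul {E : Type*} [Ring E] [Algebra k E] {g : H →ₐ[k] E} {f : V →ₐ[k] E}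
    (h : IsSmash r u x g f) (hV : IsVectorAlg R' x) (hr : IsDualQuasitriangular r)
    (hu : IsVectorCoaction R R' r u) : Function.Bijective (LinearMap.mul' k E ∘ₗ
      TensorProduct.map f.toLinearMap g.toLinearMap) := by
  obtain ⟨s, hrs, hsr⟩ := hr.exists_inv
  have hc : TensorProduct.curry (TensorProduct.lift r) = r := LinearMap.ext₂ fun a b => by simp
  have e : (LinearMap.mul' k E ∘ₗ TensorProduct.map f.toLinearMap g.toLinearMap : V ⊗[k] H → E) =
      h.equiv ∘ TensorProduct.comm k V H ∘
        crossMap (vecCoact hV hu) (TensorProduct.lift r) := by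
    funext z
    simp only [Function.comp_apply]
    induction z with
    | zero => simp
    | add y z hy hz => simp only [map_add, hy, hz]
    | tmul v a =>
      induction v using hV.word_induction with
      | word d w =>
        rw [crossMap_word]
        simpa [h.equiv_tmul, hc] using crosses_word hr h.crosses d w a
      | add v w hv hw => simp only [add_tmul, map_add, hv, hw]
      | smul c v hv => simp only [← smul_tmul', map_smul, hv]
  rw [e]
  exact h.equiv.bijective.comp ((TensorProduct.comm k V H).bijective.comp
    (Function.bijective_iff_has_inverse.mpr ⟨crossMap (vecCoact hV hu) s,
      crossMap_crossMap hV hu hsr, crossMap_crossMap hV hu hrs⟩))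

variable {E : Type*} [Ring E] [HopfAlgebra k E] {g : H →ₐ[k] E} {f : V →ₐ[k] E}
  (h : IsGenBosonization r u x g f)

/-- The inclusion of `H` as a bialgebra homomorphism. -/
def IsGenBosonization.left : H →ₐc[k] E :=
  BialgHom.ofAlgHom g (by ext a; exact h.counit_left a) (by ext a; exact (h.comul_left a).symm)

theorem IsGenBosonization.left_apply (a : H) : h.left a = g a := rfl

theorem IsGenBosonization.isBosonization (hV : IsVectorAlg R' x) (hr : IsDualQuasitriangular r)
    (hu : IsVectorCoaction R R' r u) :
    IsBosonization (h.braidedHopf hV hr hu) f h.left where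
  bijective_mul := h.toIsSmash.bijective_mul hV hr hu
  bijective_mul' := h.bijective
  cross := smash_cross h.crosses hV hr hu
  comul_eq v := (h.cosmash_braidedComul hV hr hu v).symm
  counit_eq _ := rfl

end Bosonization

/-! ### The form on the extended Hopf algebra -/

section ExtForm

open Coalgebra HopfAlgebra

variable {k : Type u} [Field k] {A : Type v} [Ring A] [HopfAlgebra k A]

theorem lift_quasi_comm_left {H : Type*} [Ring H] [HopfAlgebra k H] (r : H →ₗ[k] H →ₗ[k] k)
    {ι κ : Type*} {s : Finset ι} {t : Finset κ}
    {a b : H} {x y : ι → H} {z w : κ → H} (ha : comul (R := k) a = ∑ i ∈ s, x i ⊗ₜ[k] y i)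
    (hb : comul (R := k) b = ∑ i ∈ t, z i ⊗ₜ[k] w i) :
    TensorProduct.lid k H (TensorProduct.map (TensorProduct.lift r) (LinearMap.mul' k H)
        (comul (R := k) (a ⊗ₜ[k] b))) = ∑ i ∈ s, ∑ j ∈ t, r (x i) (z j) • (y i * w j) := by
  simp [TensorProduct.comul_tmul, ha, hb, sum_tmul, tmul_sum]
  rw [Finset.sum_comm]

theorem lift_quasi_comm_right {H : Type*} [Ring H] [HopfAlgebra k H] (r : H →ₗ[k] H →ₗ[k] k)
    {ι κ : Type*} {s : Finset ι} {t : Finset κ}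
    {a b : H} {x y : ι → H} {z w : κ → H} (ha : comul (R := k) a = ∑ i ∈ s, x i ⊗ₜ[k] y i)
    (hb : comul (R := k) b = ∑ i ∈ t, z i ⊗ₜ[k] w i) :
    TensorProduct.rid k H (TensorProduct.map
        (LinearMap.mul' k H ∘ₗ (TensorProduct.comm k H H).toLinearMap) (TensorProduct.lift r)
        (comul (R := k) (a ⊗ₜ[k] b))) = ∑ i ∈ s, ∑ j ∈ t, r (y i) (w j) • (z j * x i) := by
  simp [TensorProduct.comul_tmul, ha, hb, sum_tmul, tmul_sum]
  rw [Finset.sum_comm]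

/-- The powers of `g` are group-like and span the second factor, so identities on `Ã` reduce to
identities on `A` together with exponents of `λ`. -/
theorem ext_induction {P : Ext k A → Prop} (z : Ext k A) (tmul : ∀ a p, P (a ⊗ₜ T p))
    (add : ∀ y z, P y → P z → P (y + z)) : P z := by
  induction z using TensorProduct.induction_on with
  | zero => simpa using tmul 0 0
  | add y z hy hz => exact add y z hy hz
  | tmul a q =>
    induction q using LaurentPolynomial.induction_on' with
    | add p q hp hq => rw [tmul_add]; exact add _ _ hp hq
    | C_mul_T m c =>
      rw [← LaurentPolynomial.smul_eq_C_mul, ← TensorProduct.smul_tmul]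
      exact tmul _ _

theorem comul_tmul_T {ι : Type*} {s : Finset ι} {a : A} {x y : ι → A}
    (ha : comul (R := k) a = ∑ i ∈ s, x i ⊗ₜ[k] y i) (p : ℤ) :
    comul (R := k) (a ⊗ₜ[k] (T p : k[T;T⁻¹])) =
      ∑ i ∈ s, (x i ⊗ₜ[k] (T p : k[T;T⁻¹])) ⊗ₜ[k] (y i ⊗ₜ[k] (T p : k[T;T⁻¹])) := by
  rw [TensorProduct.comul_tmul, ha]
  simp [sum_tmul]

/-- The tensor product of a functional on `A ⊗ A` with `zForm lam`. -/
def extFunctional (φ : A ⊗[k] A →ₗ[k] k) (lam : k) : Ext k A ⊗[k] Ext k A →ₗ[k] k :=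
  LinearMap.mul' k k ∘ₗ TensorProduct.map φ (TensorProduct.lift (zForm lam)) ∘ₗ
    (TensorProduct.tensorTensorTensorComm k A k[T;T⁻¹] A k[T;T⁻¹]).toLinearMap

theorem lift_extForm (r : A →ₗ[k] A →ₗ[k] k) (lam : k) :
    TensorProduct.lift (extForm r lam) = extFunctional (TensorProduct.lift r) lam :=
  TensorProduct.ext' fun a b => by simp [extForm, extFunctional]

theorem extFunctional_tmul_T (φ : A ⊗[k] A →ₗ[k] k) (lam : k) (a b : A) (p q : ℤ) :
    extFunctional φ lam ((a ⊗ₜ T p) ⊗ₜ (b ⊗ₜ T q)) = φ (a ⊗ₜ b) * lam ^ (-(p * q)) := by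
  have h : φ = TensorProduct.lift (TensorProduct.curry φ) := TensorProduct.ext' fun a b => by simp
  rw [h, ← lift_extForm, TensorProduct.lift.tmul, extForm_tmul_T]
  simp

/-- Convolution on group-like elements is pointwise, so the factors `c ^ (-(p q))` and `d ^ (-(p
q))` cancel. Hence the inverse of the extended form uses `λ⁻¹`. -/
theorem convMul_extFunctional {φ ψ : A ⊗[k] A →ₗ[k] k} {c d : k} (h : convMul φ ψ = counit)
    (hcd : c * d = 1) : convMul (C := Ext k A ⊗[k] Ext k A)
      (extFunctional φ c) (extFunctional ψ d) = counit := by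
  refine TensorProduct.ext' fun y z => ?_
  induction y using ext_induction with
  | add y y' hy hy' => simp only [add_tmul, map_add, hy, hy']
  | tmul a p =>
    induction z using ext_induction with
    | add y y' hy hy' => simp only [tmul_add, map_add, hy, hy']
    | tmul b q =>
      have h1 := LinearMap.congr_fun h (a ⊗ₜ b)
      rw [convMul_tmul _ _ (Repr.arbitrary k a).eq.symm (Repr.arbitrary k b).eq.symm] at h1
      rw [convMul_tmul _ _ (comul_tmul_T (Repr.arbitrary k a).eq.symm p)
        (comul_tmul_T (Repr.arbitrary k b).eq.symm q)]
      have h2 : ∀ y z : k, y * c ^ (-(p * q)) * (z * d ^ (-(p * q))) = y * z := fun y z => by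
        rw [mul_mul_mul_comm, ← mul_zpow, hcd, one_zpow, mul_one]
      simp only [extFunctional_tmul_T, h2, h1]
      simp [TensorProduct.counit_tmul]

theorem IsDualQuasitriangular.extForm {r : A →ₗ[k] A →ₗ[k] k} (hr : IsDualQuasitriangular r)
    {lam : k} (hlam : lam ≠ 0) : IsDualQuasitriangular (extForm r lam) where
  exists_inv := by
    obtain ⟨s, hrs, hsr⟩ := hr.exists_inv
    refine ⟨extFunctional s lam⁻¹, ?_, ?_⟩ <;> rw [lift_extForm]
    · exact convMul_extFunctional hrs (mul_inv_cancel₀ hlam)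
    · exact convMul_extFunctional hsr (inv_mul_cancel₀ hlam)
  mul_left x y z := by
    induction x using ext_induction with
    | add x x' hx hx' =>
      simp only [add_mul, map_add, LinearMap.add_apply, TensorProduct.map_add_left, hx, hx']
    | tmul a p =>
      induction y using ext_induction with
      | add x x' hx hx' =>
        simp only [mul_add, map_add, LinearMap.add_apply, TensorProduct.map_add_right, hx, hx']
      | tmul b q =>
        induction z using ext_induction with
        | add x x' hx hx' => simp only [map_add, hx, hx']
        | tmul c m =>
          rw [comul_tmul_T (Repr.arbitrary k c).eq.symm, Algebra.TensorProduct.tmul_mul_tmul,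
            ← LaurentPolynomial.T_add, extForm_tmul_T, hr.mul_left]
          conv_lhs => rw [← (Repr.arbitrary k c).eq]
          simp only [map_sum, TensorProduct.map_tmul, LinearMap.mul'_apply, extForm_tmul_T,
            Finset.sum_mul, add_mul, neg_add, zpow_add₀ hlam]
          exact Finset.sum_congr rfl fun i _ => mul_mul_mul_comm _ _ _ _
  mul_right x y z := by
    induction x using ext_induction with
    | add x x' hx hx' => simp only [map_add, LinearMap.add_apply, hx, hx']
    | tmul a p =>
      induction y using ext_induction with
      | add x x' hx hx' =>
        simp only [add_mul, map_add, TensorProduct.map_add_right, LinearMap.add_apply, hx, hx']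
      | tmul b q =>
        induction z using ext_induction with
        | add x x' hx hx' =>
          simp only [mul_add, map_add, TensorProduct.map_add_left, LinearMap.add_apply, hx, hx']
        | tmul c m =>
          rw [comul_tmul_T (Repr.arbitrary k a).eq.symm, Algebra.TensorProduct.tmul_mul_tmul,
            ← LaurentPolynomial.T_add, extForm_tmul_T, hr.mul_right]
          conv_lhs => rw [← (Repr.arbitrary k a).eq]
          simp only [map_sum, TensorProduct.map_tmul, LinearMap.mul'_apply, extForm_tmul_T,
            LinearMap.flip_apply, Finset.sum_mul, mul_add, neg_add_rev, zpow_add₀ hlam]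
          exact Finset.sum_congr rfl fun i _ => mul_mul_mul_comm _ _ _ _
  quasi_comm x y := by
    induction x using ext_induction with
    | add x x' hx hx' => simp only [add_tmul, map_add, hx, hx']
    | tmul a p =>
      induction y using ext_induction with
      | add x x' hx hx' => simp only [tmul_add, map_add, hx, hx']
      | tmul b q =>
        have h := hr.quasi_comm a b
        rw [lift_quasi_comm_left r (Repr.arbitrary k a).eq.symm (Repr.arbitrary k b).eq.symm,
          lift_quasi_comm_right r (Repr.arbitrary k a).eq.symm (Repr.arbitrary k b).eq.symm] at h
        rw [lift_quasi_comm_left _ (comul_tmul_T (Repr.arbitrary k a).eq.symm p)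
            (comul_tmul_T (Repr.arbitrary k b).eq.symm q),
          lift_quasi_comm_right _ (comul_tmul_T (Repr.arbitrary k a).eq.symm p)
            (comul_tmul_T (Repr.arbitrary k b).eq.symm q)]
        -- The form on the powers of `g` contributes the same scalar to both sides, and those powers
        -- commute.
        have h2 := congrArg (fun z : A => lam ^ (-(p * q)) • (z ⊗ₜ[k] (T (p + q) : k[T;T⁻¹]))) h
        simp only [sum_tmul, Finset.smul_sum, ← smul_tmul', smul_smul] at h2
        simp only [extForm_tmul_T, Algebra.TensorProduct.tmul_mul_tmul, ← LaurentPolynomial.T_add,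
          mul_comm (r _ _), h2, add_comm q p]

end ExtForm

/-! ### The quantum matrix `g⁻¹ St` and the values of the form -/

section Matrices

open Coalgebra HopfAlgebra

variable {k : Type u} [Field k] {n : ℕ} {A : Type v} [Ring A] [HopfAlgebra k A]
  {t : Fin n → Fin n → A}

section Antipode

variable (comul_t : ∀ i j, comul (R := k) (t i j) = ∑ a, t i a ⊗ₜ[k] t a j)
  (counit_t : ∀ i j, counit (R := k) (t i j) = if i = j then 1 else 0)
include comul_t counit_t

theorem sum_antipode_mul_of_comul (i j : Fin n) :
    ∑ a, antipode k (t i a) * t a j = if i = j then 1 else 0 := by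
  have h := mul_antipode_rTensor_comul_apply (R := k) (t i j)
  rw [comul_t, counit_t] at h
  simpa [apply_ite] using h

theorem sum_mul_antipode_of_comul (i j : Fin n) :
    ∑ a, t i a * antipode k (t a j) = if i = j then 1 else 0 := by
  have h := mul_antipode_lTensor_comul_apply (R := k) (t i j)
  rw [comul_t, counit_t] at h
  simpa [apply_ite] using h

/-- Two inverses of one matrix agree: the right-hand side is a left inverse of `Δ t`, and `Δ(St)` is
a right inverse. -/
theorem comul_antipode_of_comul (i j : Fin n) :
    comul (R := k) (antipode k (t i j)) =
      ∑ a, antipode k (t a j) ⊗ₜ[k] antipode k (t i a) := by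
  let X : Matrix (Fin n) (Fin n) (A ⊗[k] A) :=
    fun i j => ∑ a, antipode k (t a j) ⊗ₜ antipode k (t i a)
  let Y : Matrix (Fin n) (Fin n) (A ⊗[k] A) := fun i j => comul (R := k) (t i j)
  let Z : Matrix (Fin n) (Fin n) (A ⊗[k] A) := fun i j => comul (R := k) (antipode k (t i j))
  have hXY : X * Y = 1 := by
    ext i l
    rw [Matrix.mul_apply, Matrix.one_apply]
    simp only [X, Y, comul_t, Finset.sum_mul_sum,
      Algebra.TensorProduct.tmul_mul_tmul]
    rw [Finset.sum_comm]
    refine (Finset.sum_congr rfl fun a _ => Finset.sum_comm).trans ?_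
    simp only [← sum_tmul, sum_antipode_mul_of_comul comul_t counit_t]
    simp [ite_tmul, ← tmul_sum, sum_antipode_mul_of_comul comul_t counit_t, tmul_ite,
      Algebra.TensorProduct.one_def]
  have hYZ : Y * Z = 1 := by
    ext i l
    rw [Matrix.mul_apply, Matrix.one_apply]
    simp only [Y, Z, ← Bialgebra.comul_mul, ← map_sum,
      sum_mul_antipode_of_comul comul_t counit_t]
    split_ifs <;> simp
  have h : X = Z := left_inv_eq_right_inv hXY hYZ
  exact (congrFun (congrFun h i) j).symm

end Antipode

/-- The values of a form on matrix elements, as a matrix. -/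
def formMatrix (r : A →ₗ[k] A →ₗ[k] k) (t s : Fin n → Fin n → A) : Mat2 k n :=
  fun p q => r (t p.1 q.1) (s p.2 q.2)

/-- Apply `r(·, t)` to `∑ S(t i a) t a l = δ`; the bicharacter law turns the product in `A` into a
matrix product. -/
theorem formMatrix_antipode_mul {r : A →ₗ[k] A →ₗ[k] k} (hr : IsDualQuasitriangular r)
    (comul_t : ∀ i j, comul (R := k) (t i j) = ∑ a, t i a ⊗ₜ[k] t a j)
    (counit_t : ∀ i j, counit (R := k) (t i j) = if i = j then 1 else 0) :
    formMatrix r (fun i j => antipode k (t i j)) t * formMatrix r t t = 1 := by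
  ext ⟨i, j⟩ ⟨l, b⟩
  have h : ∑ a, r (antipode k (t i a) * t a l) (t j b) =
      r (if i = l then 1 else 0) (t j b) := by
    rw [← sum_antipode_mul_of_comul comul_t counit_t, map_sum, LinearMap.sum_apply]
  simp only [hr.mul_left, comul_t, map_sum, TensorProduct.map_tmul, LinearMap.mul'_apply] at h
  rw [Matrix.mul_apply, Fintype.sum_prod_type]
  refine h.trans ?_
  rw [apply_ite r, hr.one_left, Matrix.one_apply]
  by_cases hi : i = l <;> simp [hi, counit_t]

/-- Apply `r(St, ·)` to `St · t = 1`. The reversal in the second bicharacter law cancels the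
reversal in the coproduct of `St`, so an ordinary matrix product results. -/
theorem formMatrix_antipode_antipode_mul {r : A →ₗ[k] A →ₗ[k] k} (hr : IsDualQuasitriangular r)
    (comul_t : ∀ i j, comul (R := k) (t i j) = ∑ a, t i a ⊗ₜ[k] t a j)
    (counit_t : ∀ i j, counit (R := k) (t i j) = if i = j then 1 else 0) :
    formMatrix r (fun i j => antipode k (t i j)) (fun i j => antipode k (t i j)) *
      formMatrix r (fun i j => antipode k (t i j)) t = 1 := by
  ext ⟨i, j⟩ ⟨l, m⟩
  have h : ∑ b, r (antipode k (t i l)) (antipode k (t j b) * t b m) =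
      r (antipode k (t i l)) (if j = m then 1 else 0) := by
    rw [← sum_antipode_mul_of_comul comul_t counit_t, map_sum]
  simp only [hr.mul_right, comul_antipode_of_comul comul_t counit_t, map_sum,
    TensorProduct.map_tmul, LinearMap.mul'_apply, LinearMap.flip_apply _ (antipode k _),
    mul_comm (r _ (t _ _))] at h
  rw [Matrix.mul_apply, Fintype.sum_prod_type, Finset.sum_comm]
  refine h.trans ?_
  have h1 : r (antipode k (t i l)) 1 = _ := LinearMap.congr_fun hr.one_right (antipode k (t i l))
  rw [Matrix.one_apply]
  by_cases hj : j = m <;> simp [hj, h1, counit_t]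

theorem gPow_mul_antipode_toExt (a : A) :
    gPow k A (-1) * antipode k (toExt k a) = antipode k a ⊗ₜ[k] (T (-1) : k[T;T⁻¹]) := by
  rw [toExt, gPow, TensorProduct.antipode_def]
  simp

variable {R R' : Mat2 k n} {r : A →ₗ[k] A →ₗ[k] k} {lam : k}

section Ext

variable (hr : IsDualQuasitriangular r)
  (comul_t : ∀ i j, comul (R := k) (t i j) = ∑ a, t i a ⊗ₜ[k] t a j)
  (counit_t : ∀ i j, counit (R := k) (t i j) = if i = j then 1 else 0)
  (hrt : ∀ i j a b, r (t i a) (t j b) = lam * R (i, j) (a, b))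
include hr comul_t counit_t hrt

theorem form_antipode_left (hlam : lam ≠ 0) (hR : IsUnit R) (i j a b : Fin n) :
    r (antipode k (t i a)) (t j b) = lam⁻¹ * R⁻¹ (i, j) (a, b) := by
  have h : formMatrix r t t = lam • R := by ext p q; exact hrt _ _ _ _
  have h1 : formMatrix r (fun i j => antipode k (t i j)) t = lam⁻¹ • R⁻¹ := by
    refine left_inv_eq_right_inv (formMatrix_antipode_mul hr comul_t counit_t) ?_
    rw [h, smul_mul_smul_comm, Matrix.mul_nonsing_inv _ ((Matrix.isUnit_iff_isUnit_det _).mp hR),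
      mul_inv_cancel₀ hlam, one_smul]
  exact congrFun (congrFun h1 (i, j)) (a, b)

/-- Both `r(St, St)` and `r(t, t)` are inverse to `r(St, t)`, on opposite sides, and hence equal. -/
theorem form_antipode_antipode (i j a b : Fin n) :
    r (antipode k (t i a)) (antipode k (t j b)) = lam * R (i, j) (a, b) := by
  rw [← hrt]
  have h := left_inv_eq_right_inv (formMatrix_antipode_antipode_mul hr comul_t counit_t)
    (formMatrix_antipode_mul hr comul_t counit_t)
  exact congrFun (congrFun h (i, j)) (a, b)

/-- The quadratic relation is the antipode of the one for `t`, with the order of factors reversed.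
The factor `g⁻¹` scales the form by `λ⁻¹`, turning `λR` into `R`. -/
theorem isVectorCoaction_ext (hlam : lam ≠ 0)
    (hR't : ∀ i j a b, ∑ c, ∑ d, R' (i, j) (c, d) • (t c a * t d b) =
      ∑ c, ∑ d, R' (c, d) (a, b) • (t j d * t i c)) :
    IsVectorCoaction R R' (extForm r lam)
      (fun i j => gPow k A (-1) * antipode k (toExt k (t i j))) := by
  simp only [gPow_mul_antipode_toExt]
  refine ⟨⟨fun i j => ?_, fun i j => ?_⟩, fun i j q p => ?_, fun i j a b => ?_⟩
  · exact comul_tmul_T (comul_antipode_of_comul comul_t counit_t i j) _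
  · simp [TensorProduct.counit_tmul, counit_t]
  · have h := congrArg (antipode k) (hR't i j p q)
    simp only [map_sum, map_smul, antipode_mul_antidistrib] at h
    simp only [Algebra.TensorProduct.tmul_mul_tmul, smul_tmul', ← sum_tmul, h]
  · rw [extForm_tmul_T, form_antipode_antipode hr comul_t counit_t hrt]
    simp [mul_comm lam, hlam]

end Ext

theorem hit_extForm_toExt (b : Ext k A) (j l : Fin n)
    (comul_t : ∀ i j, comul (R := k) (t i j) = ∑ a, t i a ⊗ₜ[k] t a j) :
    hit (extForm r lam b) (toExt k (t j l)) =
      ∑ m, extForm r lam b (toExt k (t m l)) • toExt k (t j m) := by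
  have h := comul_tmul_T (comul_t j l) 0
  rw [LaurentPolynomial.T_zero] at h
  rw [hit_apply, toExt, h]
  simp [toExt]

theorem comul_gPow (m : ℤ) : comul (R := k) (gPow k A m) = gPow k A m ⊗ₜ gPow k A m := by
  have h : comul (R := k) (1 : A) = ∑ _i : Unit, 1 ⊗ₜ 1 := by simp [Algebra.TensorProduct.one_def]
  exact (comul_tmul_T h m).trans (Fintype.sum_unique _)

end Matrices

end BraidedVectors

end

/-! ### The bosonization of `V(R')` by the extended Hopf algebra -/

theorem proposition7 {k : Type u} [Field k] {n : ℕ} (R R' : Mat2 k n)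
    (hR : IsBraidedVectorDatum R R')
    {A : Type v} [Ring A] [HopfAlgebra k A] (t : Fin n → Fin n → A)
    (comul_t : ∀ i j, Coalgebra.comul (R := k) (t i j) = ∑ a, t i a ⊗ₜ[k] t a j)
    (counit_t : ∀ i j, Coalgebra.counit (R := k) (t i j) = if i = j then 1 else 0)
    (r : A →ₗ[k] A →ₗ[k] k) (hr : IsDualQuasitriangular r)
    (lam : k) (hlam : lam ≠ 0)
    (hrt : ∀ i j a b, r (t i a) (t j b) = lam * R (i, j) (a, b))
    (hR't : ∀ i j a b, ∑ c, ∑ d, R' (i, j) (c, d) • (t c a * t d b) =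
      ∑ c, ∑ d, R' (c, d) (a, b) • (t j d * t i c)) :
    IsDualQuasitriangular (extForm r lam) ∧
    ∃ B : BraidedHopfAlgebra (extForm r lam) (VectorAlg R'),
      (∀ i, B.coact (vecGen R' i) =
        ∑ j, vecGen R' j ⊗ₜ[k] (gPow k A (-1) * HopfAlgebra.antipode k (toExt k (t i j)))) ∧
      (∀ i, B.comul (vecGen R' i) = vecGen R' i ⊗ₜ[k] 1 + 1 ⊗ₜ[k] vecGen R' i) ∧
      (∀ i, B.counit (vecGen R' i) = 0) ∧
      (∀ i, B.antipode (vecGen R' i) = - vecGen R' i) ∧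
      (∀ i j, braiding (extForm r lam) B.coact.toLinearMap (vecGen R' i ⊗ₜ[k] vecGen R' j) =
        ∑ a, ∑ b, R (i, j) (a, b) • (vecGen R' b ⊗ₜ[k] vecGen R' a)) ∧
      ∃ (E : Type (max u v)) (_ : Ring E) (_ : HopfAlgebra k E)
        (ιV : VectorAlg R' →ₐ[k] E) (ιA : Ext k A →ₐc[k] E),
        IsBosonization B ιV ιA ∧
        (∀ i, ιV (vecGen R' i) * ιA (gPow k A 1) =
          lam • (ιA (gPow k A 1) * ιV (vecGen R' i))) ∧
        (∀ i j l, ιV (vecGen R' i) * ιA (toExt k (t j l)) =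
          lam⁻¹ • ∑ m, ∑ a, R⁻¹ (i, m) (a, l) •
            (ιA (toExt k (t j m)) * ιV (vecGen R' a))) ∧
        (∀ i, Coalgebra.comul (R := k) (ιV (vecGen R' i)) =
          (∑ j, ιV (vecGen R' j) ⊗ₜ[k]
            ιA (gPow k A (-1) * HopfAlgebra.antipode k (toExt k (t i j)))) +
          1 ⊗ₜ[k] ιV (vecGen R' i)) ∧
        (∀ i j, Coalgebra.comul (R := k) (ιA (toExt k (t i j))) =
          ∑ a, ιA (toExt k (t i a)) ⊗ₜ[k] ιA (toExt k (t a j))) ∧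
        Coalgebra.comul (R := k) (ιA (gPow k A 1)) =
          ιA (gPow k A 1) ⊗ₜ[k] ιA (gPow k A 1) := by
  have hr' := hr.extForm hlam
  have hV := isVectorAlg_vecGen R'
  have hu := isVectorCoaction_ext hr comul_t counit_t hrt hlam hR't
  obtain ⟨E, _, _, g, f, h⟩ := exists_isGenBosonization hR hV hr' hu
  have comul_left : ∀ {ι : Type} (s : Finset ι) (a : Ext k A) (y z : ι → Ext k A),
      Coalgebra.comul (R := k) a = ∑ i ∈ s, y i ⊗ₜ[k] z i →
      Coalgebra.comul (R := k) (h.left a) = ∑ i ∈ s, h.left (y i) ⊗ₜ[k] h.left (z i) := by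
    intro ι s a y z ha
    rw [h.left_apply, h.comul_left, ha, map_sum]
    rfl
  refine ⟨hr', h.braidedHopf hV hr' hu, vecCoact_gen hV hu, h.braidedComul_gen hu,
    h.counit_gen, h.braidedAntipode_gen hV hr' hu, braiding_gen hV hu, E, _, _, f, h.left,
    h.isBosonization hV hr' hu, fun i => ?_, fun i j l => ?_, fun i => ?_, fun i j => ?_, ?_⟩
  -- The `A`-part pairs `St` with `1` and gives a Kronecker delta; the other part pairs `g⁻¹` with
  -- `g` and gives `λ`.
  · have h1 : ∀ j, hit (extForm r lam (gPow k A (-1) *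
        HopfAlgebra.antipode k (toExt k (t i j)))) (gPow k A 1) =
        if i = j then lam • gPow k A 1 else 0 := fun j => by
      have h2 : r (HopfAlgebra.antipode k (t i j)) 1 = _ :=
        LinearMap.congr_fun hr.one_right (HopfAlgebra.antipode k (t i j))
      rw [hit_apply, comul_gPow, LinearMap.lTensor_tmul, TensorProduct.rid_tmul,
        gPow_mul_antipode_toExt]
      conv_lhs => rw [gPow, extForm_tmul_T, h2]
      simp [counit_t, gPow]
    refine (h.crosses i (gPow k A 1)).trans ?_
    simp only [h1]
    simp [h.left_apply, apply_ite]
  -- Here `g⁻¹` pairs trivially with `t`, so `λ⁻¹ R⁻¹` is just `r(St, t)`, the inverse of `r(t, t) =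
  -- λR`.
  · have h1 : ∀ a m, extForm r lam (gPow k A (-1) * HopfAlgebra.antipode k (toExt k (t i a)))
        (toExt k (t m l)) = lam⁻¹ * R⁻¹ (i, m) (a, l) := fun a m => by
      rw [gPow_mul_antipode_toExt, toExt, ← LaurentPolynomial.T_zero, extForm_tmul_T,
        form_antipode_left hr comul_t counit_t hrt hlam hR.isUnit_R]
      simp
    refine (h.crosses i (toExt k (t j l))).trans ?_
    simp only [hit_extForm_toExt _ _ _ comul_t, h1, map_sum, map_smul, Finset.sum_mul,
      smul_mul_assoc, Finset.smul_sum, smul_smul]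
    exact Finset.sum_comm
  · exact h.comul_gen i
  · have h1 := comul_tmul_T (comul_t i j) 0
    rw [LaurentPolynomial.T_zero] at h1
    exact comul_left _ _ _ _ h1
  · have h1 := comul_left {()} (gPow k A 1) (fun _ => gPow k A 1) (fun _ => gPow k A 1)
      (by simp [comul_gPow])
    simpa using h1
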